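/- Identify the plane with $\mathbb{C}$. **Domains.** A compact set $S\subset\mathbb{C}$ is a *spiral-shaped domain with centre $c$* if its interior $S^\circ$ is nonempty and connected, $S$ is the closure of $S^\circ$, there is $\kappa\in\mathbb{C}$ with $\operatorname{Re}\kappa<0$ such that $c+e^{t\kappa}(x-c)\in S$ for all $x\in S$ and all $t\in[0,\infty)$, and every line segment not containing $c$ meets $S^\circ$ in a set with finitely many connected components. (Polygons, disks and regions between two logarithmic spirals all satisfy the last condition. Real $\kappa$ gives star-shaped domains.) **Flat foldings.** A *flat folding of $S$ without interior vertices* is a continuous map $f:S\to\mathbb{C}$ such that near each point $x\in S^\circ$ it is either an isometry of the plane (then $x$ is *unfolded*), or a fold of the plane along one straight line through $x$ followed by an isometry of the plane (then $x$ is a *fold point*), and such that the set of fold points has finitely many connected components (the *fold lines*). Say that $x\ne y$ are *in contact* if both are unfolded points of $S^\circ$ and $f(x)=f(y)$. A *consistent local stacking order* for $f$ is a relation "above" on the pairs in contact such that: 1. for $x,y$ in contact exactly one of $x,y$ is above the other, and the relation is transitive on triples of points pairwise in contact; 2. it is locally constant on the set of pairs in contact; 3. if $k$ is a fold point, $z$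 is unfolded and $f(k)=f(z)$, then all points near $k$ lie on the same side of the points near $z$ with which they are in contact; 4. if $k\neq l$ are fold points with $f(k)=f(l)$, there are no points $x_1,x_2$ arbitrarily close to $k$ and $y_1,y_2$ arbitrarily close to $l$, with the consecutive pairs in contact, such that $x_1$ is above $y_1$, $y_1$ is above $x_2$, and $x_2$ is above $y_2$. **Theorem.** Let $S$ be a spiral-shaped domain with centre $c$, and let $f$ be a flat folding of $S$ without interior vertices with a consistent local stacking order $\lambda$. Then there is a family $(f_t,\lambda_t)_{t\in[0,1]}$ of flat foldings of $S$ without interior vertices with consistent local stacking orders, with $(f_0,\lambda_0)=(f,\lambda)$, such that $t\mapsto f_t$ is continuous in the sup-norm over $S$; the order is consistent in time, that is, $\lambda_t(x,y)$ is locally constant on the set of all $(t,x,y)$ such that $x,y$ are in contact for $f_t$; and $f_1$ is unfolded, that is, it is the restriction to $S$ of an isometry of the plane. -/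

import Mathlib

open Set Filter Topology

/-- The set of connected components of a planar set `A`. -/
def componentsOf (A : Set ℂ) : Set (Set ℂ) := connectedComponentIn A '' A

/-- `c` is the centre of an inward-spiralling shrinking motion of `S` into itself: with `q = exp κ`,
`|q| < 1`, the copies `q ^ t • S` (scaled and rotated about `c`), `t ∈ [0, ∞)`, all lie in `S`.
Star-shaped sets are the case of real `κ`. -/
def IsSpiralCenter (S : Set ℂ) (c : ℂ) : Prop :=
  ∃ κ : ℂ, κ.re < 0 ∧ ∀ t : ℝ, 0 ≤ t → ∀ x ∈ S, c + Complex.exp (t * κ) * (x - c) ∈ S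

/-- A (bounded) spiral-shaped domain with centre `c`: a compact set, the closure of a nonempty
connected open set, which spirals into itself about `c`, and which has no more than finitely many
pieces along any line segment that avoids the centre. -/
structure IsSpiralShapedDomain (S : Set ℂ) (c : ℂ) : Prop where
  isCompact : IsCompact S
  isConnected_interior : IsConnected (interior S)
  subset_closure_interior : S ⊆ closure (interior S)
  isSpiralCenter : IsSpiralCenter S c
  finite_segment : ∀ a b : ℂ, c ∉ segment ℝ a b →
    (componentsOf (segment ℝ a b ∩ interior S)).Finite

/-- The plane folded along the line through `x` with direction `u` (a unit vector): the half-plane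
to the left of the line is fixed, the other half-plane is reflected onto it. -/
noncomputable def foldAlong (x u y : ℂ) : ℂ :=
  x + u * ⟨((y - x) / u).re, |((y - x) / u).im|⟩

/-- Near `x` the map `f` is an isometry of the plane. -/
def UnfoldedAt (f : ℂ → ℂ) (x : ℂ) : Prop :=
  ∃ g : ℂ ≃ᵢ ℂ, ∀ᶠ y in 𝓝 x, f y = g y

/-- Near `x` the map `f` folds the plane flat along a straight line through `x`. -/
def FoldedAt (f : ℂ → ℂ) (x : ℂ) : Prop :=
  ∃ g : ℂ ≃ᵢ ℂ, ∃ u : ℂ, ‖u‖ = 1 ∧ ∀ᶠ y in 𝓝 x, f y = g (foldAlong x u y)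

/-- The interior points of `S` that do not lie on a fold. -/
def unfoldedSet (S : Set ℂ) (f : ℂ → ℂ) : Set ℂ := {x ∈ interior S | UnfoldedAt f x}

/-- The interior points of `S` that lie on a fold. -/
def foldSet (S : Set ℂ) (f : ℂ → ℂ) : Set ℂ := {x ∈ interior S | ¬ UnfoldedAt f x}

/-- `f` (whose values outside `S` are irrelevant) maps `S` to the plane as a flat folding without
interior vertices. At every interior point of `S` it is either unfolded or folded along one straight
line through that point, so that no fold ends, bends, branches or crosses another fold inside `S`:
the components of the fold set (the fold lines) are open line segments which extend across `S`.
There are finitely many fold lines; equivalently, as the interior of a spiral-shaped domain is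
simply connected, they cut it into finitely many connected linear pieces. -/
structure IsFlatFolding (S : Set ℂ) (f : ℂ → ℂ) : Prop where
  continuousOn : ContinuousOn f S
  unfoldedAt_or_foldedAt : ∀ x ∈ interior S, UnfoldedAt f x ∨ FoldedAt f x
  finite_foldLines : (componentsOf (foldSet S f)).Finite

/-- Two different interior points of the paper, neither on a fold, that are mapped to the same
point. -/
def Contact (S : Set ℂ) (f : ℂ → ℂ) (x y : ℂ) : Prop :=
  x ∈ unfoldedSet S f ∧ y ∈ unfoldedSet S f ∧ x ≠ y ∧ f x = f y

/-- `above x y` (read: the paper at `x` lies above the paper at `y`) is a consistent local stacking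
order of the flat folding `f`. Only its values on pairs in contact matter. -/
structure IsStackingOrder (S : Set ℂ) (f : ℂ → ℂ) (above : ℂ → ℂ → Prop) : Prop where
  total : ∀ x y, Contact S f x y → above x y ∨ above y x
  asymm : ∀ x y, Contact S f x y → above x y → ¬ above y x
  trans : ∀ x y z, Contact S f x y → Contact S f y z → Contact S f x z →
    above x y → above y z → above x z
  /-- The order does not change as both points move, in contact, across unfolded paper. -/
  consistent : ∀ x y, Contact S f x y →
    ∀ᶠ p : ℂ × ℂ in 𝓝 (x, y), Contact S f p.1 p.2 → (above p.1 p.2 ↔ above x y)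
  /-- Unfolded paper does not cross a fold: the two layers that meet at a fold point `k` are on the
  same side of a layer through a point `z` with the same image. -/
  not_cross_fold : ∀ k ∈ foldSet S f, ∀ z ∈ unfoldedSet S f, f k = f z →
    ∀ᶠ p : (ℂ × ℂ) × ℂ in 𝓝 ((k, k), z),
      Contact S f p.1.1 p.2 → Contact S f p.1.2 p.2 → (above p.1.1 p.2 ↔ above p.1.2 p.2)
  /-- Two folds do not cross each other: the two layers that meet at a fold point `k` do not
  alternate with the two layers that meet at another fold point `l` with the same image. -/
  not_interleave : ∀ k ∈ foldSet S f, ∀ l ∈ foldSet S f, k ≠ l → f k = f l →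
    ∀ᶠ p : (ℂ × ℂ) × (ℂ × ℂ) in 𝓝 ((k, k), (l, l)),
      Contact S f p.1.1 p.2.1 → Contact S f p.2.1 p.1.2 → Contact S f p.1.2 p.2.2 →
        ¬ (above p.1.1 p.2.1 ∧ above p.2.1 p.1.2 ∧ above p.1.2 p.2.2)

/-- A continuous motion through flat foldings of `S` without interior vertices, with stacking
orders: a map from the time interval `[0, 1]` to such folded states, continuous in the sup-norm over
`S`, during which the stacking order of points in contact is consistent over time. -/
structure IsFoldingMotion (S : Set ℂ) (F : ℝ → ℂ → ℂ) (A : ℝ → ℂ → ℂ → Prop) : Prop where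
  isFlatFolding : ∀ t ∈ Icc (0 : ℝ) 1, IsFlatFolding S (F t)
  isStackingOrder : ∀ t ∈ Icc (0 : ℝ) 1, IsStackingOrder S (F t) (A t)
  continuous : ∀ t ∈ Icc (0 : ℝ) 1, TendstoUniformlyOn F (F t) (𝓝[Icc (0 : ℝ) 1] t) S
  consistent : ∀ t ∈ Icc (0 : ℝ) 1, ∀ x y, Contact S (F t) x y →
    ∀ᶠ p : ℝ × (ℂ × ℂ) in 𝓝[Icc (0 : ℝ) 1] t ×ˢ 𝓝 (x, y),
      Contact S (F p.1) p.2.1 p.2.2 → (A p.1 p.2.1 p.2.2 ↔ A t x y)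

/-- The unfolded states: `f` is on all of `S` an isometry of the plane. -/
def IsUnfolded (S : Set ℂ) (f : ℂ → ℂ) : Prop := ∃ g : ℂ ≃ᵢ ℂ, EqOn f g S

/-! Restricting `f` to a small copy of the paper about `c` is itself an unfolding step. By the
spiral hypothesis the copies of `S` under x ↦ c + e^{tκ}(x - c) stay in `S`. Restricting `f` to such
a copy and scaling back (`zoom`) gives, as the copy shrinks, a motion that starts at `f`
(`isFoldingMotion_zoom`). So it suffices to unfold what `f` looks like near the centre
(`canUnfold_of_zoom`). The delicate point is that a rescaled fold line must meet the interior in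
finitely many pieces. Away from `c` this is the segment condition. At `c` it holds for real κ
because `S` is star-shaped, and for non-real κ because a segment in `S` ending at `c` sweeps a full
neighbourhood of `c` as it spirals, so that `c` is interior (`center_mem_interior_of_spiral`,
`hasFinitelyManyPieces_of_line`).

If `c` is interior, a small copy is either flat or folded along a single line through `c`. In the
latter case the crease is pushed sideways, parallel to itself, until it leaves the paper
(`canUnfold_of_single_fold`).

If `c` is on the boundary, only fold lines with `c` in their closure come near `c`. For non-real κ
there are none, by the sweeping argument, and a small copy is flat. For real κ they lie on rays from
`c`, and a small copy carries a conical folding: distances from `c` are preserved and polar angles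
are changed by a function φ with slopes 1 and -1 (`exists_conic`). The polar angle is a continuous
function on `S` without `c` because some ray misses the interior and, by the segment condition, `S`
does not approach a point of that ray other than `c` from both sides (`exists_isPolarChart`). The
conical folding is opened by replacing φ with φ(θ₀ + τ(θ - θ₀))/τ for τ decreasing from 1, where θ₀
is an unfolded ray. For small τ only the part of φ near θ₀ is used, where it has constant slope
(`canUnfold_of_conic`).

In each of these motions the stacking order at time t is the pullback of one fixed order along a map
m t into a model space: the paper itself for the zoom, the line with its fold at 0 for the single
crease, the line of angles for the cone. If m is jointly continuous and sends contacts to contacts,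
all axioms, and consistency in time, follow from those of the fixed order (`LayerOrder.comap`,
`LayerOrder.isFoldingMotion`). -/

/-! ### Finitely many connected pieces -/

/-- `A` is a finite union of preconnected sets. -/
def HasFinitelyManyPieces (A : Set ℂ) : Prop :=
  ∃ T : Set (Set ℂ), T.Finite ∧ (∀ C ∈ T, IsPreconnected C) ∧ ⋃₀ T = A

/-- Each preconnected piece lies in a single component, so there are no more components than pieces.
Pieces, unlike components, need not be maximal or disjoint, which makes them easy to unite and to
cut. -/
theorem hasFinitelyManyPieces_iff {A : Set ℂ} :
    HasFinitelyManyPieces A ↔ (componentsOf A).Finite := by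
  constructor
  · rintro ⟨T, hT, hpre, rfl⟩
    classical
    let p : Set ℂ → ℂ := fun C => if h : C.Nonempty then h.some else 0
    refine (hT.image fun C => connectedComponentIn (⋃₀ T) (p C)).subset ?_
    rintro _ ⟨x, ⟨C, hC, hx⟩, rfl⟩
    refine ⟨C, hC, ?_⟩
    have hne : C.Nonempty := ⟨x, hx⟩
    have hp : p C ∈ C := by
      simp only [p, dif_pos hne]
      exact hne.some_mem
    exact connectedComponentIn_eq
      ((hpre C hC).subset_connectedComponentIn hp (subset_sUnion_of_mem hC) hx)
  · intro h
    refine ⟨componentsOf A, h, ?_, ?_⟩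
    · rintro _ ⟨x, _, rfl⟩
      exact isPreconnected_connectedComponentIn
    · apply Subset.antisymm
      · rintro y ⟨_, ⟨x, _, rfl⟩, hy⟩
        exact connectedComponentIn_subset _ _ hy
      · intro x hx
        exact ⟨_, ⟨x, hx, rfl⟩, mem_connectedComponentIn hx⟩

theorem IsPreconnected.hasFinitelyManyPieces {A : Set ℂ} (h : IsPreconnected A) :
    HasFinitelyManyPieces A :=
  ⟨{A}, finite_singleton A, by simpa using h, by simp⟩

theorem HasFinitelyManyPieces.biUnion {ι : Type*} {I : Set ι} (hI : I.Finite) {A : ι → Set ℂ}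
    (h : ∀ i ∈ I, HasFinitelyManyPieces (A i)) : HasFinitelyManyPieces (⋃ i ∈ I, A i) := by
  choose! T hT hpre hA using h
  refine ⟨⋃ i ∈ I, T i, hI.biUnion hT, ?_, ?_⟩
  · intro C hC
    simp only [mem_iUnion] at hC
    obtain ⟨i, hi, hC⟩ := hC
    exact hpre i hi C hC
  · ext x
    constructor
    · rintro ⟨C, hC, hx⟩
      simp only [mem_iUnion] at hC ⊢
      obtain ⟨i, hi, hC⟩ := hC
      exact ⟨i, hi, hA i hi ▸ ⟨C, hC, hx⟩⟩
    · intro hx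
      simp only [mem_iUnion] at hx
      obtain ⟨i, hi, hx⟩ := hx
      rw [← hA i hi] at hx
      obtain ⟨C, hC, hx⟩ := hx
      exact ⟨C, by simp only [mem_iUnion]; exact ⟨i, hi, hC⟩, hx⟩

theorem HasFinitelyManyPieces.union {A B : Set ℂ} (hA : HasFinitelyManyPieces A)
    (hB : HasFinitelyManyPieces B) : HasFinitelyManyPieces (A ∪ B) := by
  obtain ⟨T, hT, hpT, rfl⟩ := hA
  obtain ⟨T', hT', hpT', rfl⟩ := hB
  refine ⟨T ∪ T', hT.union hT', ?_, sUnion_union _ _⟩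
  rintro C (hC | hC)
  exacts [hpT C hC, hpT' C hC]

/-! ### Layer orders on a general folded space -/

/-- Two different points of `U` with the same image. -/
def LayerContact {X Y : Type*} (U : Set X) (f : X → Y) (x y : X) : Prop :=
  x ∈ U ∧ y ∈ U ∧ x ≠ y ∧ f x = f y

/-- The axioms of a consistent stacking order, for a map `f` on a topological space with sets `U`
of unfolded points and `K` of fold points. -/
structure LayerOrder {X Y : Type*} [TopologicalSpace X] (U K : Set X) (f : X → Y)
    (above : X → X → Prop) : Prop where
  total : ∀ x y, LayerContact U f x y → above x y ∨ above y x
  asymm : ∀ x y, LayerContact U f x y → above x y → ¬ above y x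
  trans : ∀ x y z, LayerContact U f x y → LayerContact U f y z → LayerContact U f x z →
    above x y → above y z → above x z
  consistent : ∀ x y, LayerContact U f x y →
    ∀ᶠ p : X × X in 𝓝 (x, y), LayerContact U f p.1 p.2 → (above p.1 p.2 ↔ above x y)
  not_cross_fold : ∀ k ∈ K, ∀ z ∈ U, f k = f z →
    ∀ᶠ p : (X × X) × X in 𝓝 ((k, k), z),
      LayerContact U f p.1.1 p.2 → LayerContact U f p.1.2 p.2 →
        (above p.1.1 p.2 ↔ above p.1.2 p.2)
  not_interleave : ∀ k ∈ K, ∀ l ∈ K, k ≠ l → f k = f l →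
    ∀ᶠ p : (X × X) × (X × X) in 𝓝 ((k, k), (l, l)),
      LayerContact U f p.1.1 p.2.1 → LayerContact U f p.2.1 p.1.2 →
        LayerContact U f p.1.2 p.2.2 →
        ¬ (above p.1.1 p.2.1 ∧ above p.2.1 p.1.2 ∧ above p.1.2 p.2.2)

theorem isStackingOrder_iff {S : Set ℂ} {f : ℂ → ℂ} {above : ℂ → ℂ → Prop} :
    IsStackingOrder S f above ↔ LayerOrder (unfoldedSet S f) (foldSet S f) f above :=
  ⟨fun h => ⟨h.total, h.asymm, h.trans, h.consistent, h.not_cross_fold, h.not_interleave⟩,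
    fun h => ⟨h.total, h.asymm, h.trans, h.consistent, h.not_cross_fold, h.not_interleave⟩⟩

section LayerOrder

variable {X X' Y Y' : Type*} [TopologicalSpace X] [TopologicalSpace X'] {U K : Set X}
  {U' K' : Set X'} {f : X → Y} {f' : X' → Y'} {above above' : X → X → Prop}

/-- Contacts go to contacts, because `m` respects equality of images and is injective on each fibre,
and the "nearby" clauses pull back along a continuous map. -/
theorem LayerOrder.comap (h : LayerOrder U K f above) {m : X' → X} (hU : MapsTo m U' U)
    (hK : MapsTo m K' K) (hm : ∀ x ∈ U' ∪ K', ContinuousAt m x)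
    (hc : ∀ x ∈ U' ∪ K', ∀ y ∈ U' ∪ K', f' x = f' y → f (m x) = f (m y) ∧ (x ≠ y → m x ≠ m y)) :
    LayerOrder U' K' f' (fun x y => above (m x) (m y)) := by
  have hC : ∀ {x y}, LayerContact U' f' x y → LayerContact U f (m x) (m y) := by
    rintro x y ⟨hx, hy, hne, he⟩
    obtain ⟨h1, h2⟩ := hc x (.inl hx) y (.inl hy) he
    exact ⟨hU hx, hU hy, h2 hne, h1⟩
  refine ⟨fun x y hxy => h.total _ _ (hC hxy), fun x y hxy => h.asymm _ _ (hC hxy),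
    fun x y z hxy hyz hxz => h.trans _ _ _ (hC hxy) (hC hyz) (hC hxz), ?_, ?_, ?_⟩
  · intro x y hxy
    have ht : Tendsto (Prod.map m m) (𝓝 (x, y)) (𝓝 (m x, m y)) :=
      (hm x (.inl hxy.1)).tendsto.prodMap_nhds (hm y (.inl hxy.2.1))
    exact (ht.eventually (h.consistent _ _ (hC hxy))).mono fun p hp hp' => hp (hC hp')
  · intro k hk z hz hkz
    have ht : Tendsto (Prod.map (Prod.map m m) m) (𝓝 ((k, k), z)) (𝓝 ((m k, m k), m z)) :=
      ((hm k (.inr hk)).tendsto.prodMap_nhds (hm k (.inr hk))).prodMap_nhds (hm z (.inl hz))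
    refine (ht.eventually (h.not_cross_fold _ (hK hk) _ (hU hz)
      (hc k (.inr hk) z (.inl hz) hkz).1)).mono ?_
    exact fun p hp h1 h2 => hp (hC h1) (hC h2)
  · intro k hk l hl hne hkl
    have ht : Tendsto (Prod.map (Prod.map m m) (Prod.map m m)) (𝓝 ((k, k), (l, l)))
        (𝓝 ((m k, m k), (m l, m l))) :=
      ((hm k (.inr hk)).tendsto.prodMap_nhds (hm k (.inr hk))).prodMap_nhds
        ((hm l (.inr hl)).tendsto.prodMap_nhds (hm l (.inr hl)))
    obtain ⟨h1, h2⟩ := hc k (.inr hk) l (.inr hl) hkl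
    refine (ht.eventually (h.not_interleave _ (hK hk) _ (hK hl) (h2 hne) h1)).mono ?_
    exact fun p hp h1 h2 h3 => hp (hC h1) (hC h2) (hC h3)

theorem LayerOrder.congr (h : LayerOrder U K f above)
    (h' : ∀ x y, LayerContact U f x y → (above' x y ↔ above x y)) :
    LayerOrder U K f above' := by
  have hs : ∀ {x y}, LayerContact U f x y → LayerContact U f y x :=
    fun hxy => ⟨hxy.2.1, hxy.1, hxy.2.2.1.symm, hxy.2.2.2.symm⟩
  refine ⟨fun x y hxy => ?_, fun x y hxy => ?_, fun x y z hxy hyz hxz => ?_, fun x y hxy => ?_,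
    fun k hk z hz hkz => ?_, fun k hk l hl hne hkl => ?_⟩
  · rw [h' _ _ hxy, h' _ _ (hs hxy)]
    exact h.total _ _ hxy
  · rw [h' _ _ hxy, h' _ _ (hs hxy)]
    exact h.asymm _ _ hxy
  · rw [h' _ _ hxy, h' _ _ hyz, h' _ _ hxz]
    exact h.trans _ _ _ hxy hyz hxz
  · refine (h.consistent _ _ hxy).mono fun p hp hp' => ?_
    rw [h' _ _ hxy, h' _ _ hp']
    exact hp hp'
  · refine (h.not_cross_fold k hk z hz hkz).mono fun p hp h1 h2 => ?_
    rw [h' _ _ h1, h' _ _ h2]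
    exact hp h1 h2
  · refine (h.not_interleave k hk l hl hne hkl).mono fun p hp h1 h2 h3 => ?_
    rw [h' _ _ h1, h' _ _ h2, h' _ _ h3]
    exact hp h1 h2 h3

/-- The axioms of a layer order only involve neighbourhoods of at most three points. -/
theorem LayerOrder.of_local (h : ∀ x ∈ U ∪ K, ∀ y ∈ U ∪ K, ∀ z ∈ U ∪ K, ∃ W : Set X, IsOpen W ∧
    x ∈ W ∧ y ∈ W ∧ z ∈ W ∧ LayerOrder (U ∩ W) (K ∩ W) f above) : LayerOrder U K f above := by
  have hC : ∀ {W x y}, x ∈ W → y ∈ W → LayerContact U f x y → LayerContact (U ∩ W) f x y :=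
    fun hx hy hxy => ⟨⟨hxy.1, hx⟩, ⟨hxy.2.1, hy⟩, hxy.2.2⟩
  refine ⟨fun x y hxy => ?_, fun x y hxy => ?_, fun x y z hxy hyz hxz => ?_, fun x y hxy => ?_,
    fun k hk z hz hkz => ?_, fun k hk l hl hne hkl => ?_⟩
  · obtain ⟨W, hW, hx, hy, -, hL⟩ := h x (.inl hxy.1) y (.inl hxy.2.1) y (.inl hxy.2.1)
    exact hL.total x y (hC hx hy hxy)
  · obtain ⟨W, hW, hx, hy, -, hL⟩ := h x (.inl hxy.1) y (.inl hxy.2.1) y (.inl hxy.2.1)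
    exact hL.asymm x y (hC hx hy hxy)
  · obtain ⟨W, hW, hx, hy, hz, hL⟩ := h x (.inl hxy.1) y (.inl hxy.2.1) z (.inl hyz.2.1)
    exact hL.trans x y z (hC hx hy hxy) (hC hy hz hyz) (hC hx hz hxz)
  · obtain ⟨W, hW, hx, hy, -, hL⟩ := h x (.inl hxy.1) y (.inl hxy.2.1) y (.inl hxy.2.1)
    filter_upwards [hL.consistent x y (hC hx hy hxy), (hW.prod hW).mem_nhds ⟨hx, hy⟩]
      with p hp hpW hp'
    exact hp (hC hpW.1 hpW.2 hp')
  · obtain ⟨W, hW, hx, hy, -, hL⟩ := h k (.inr hk) z (.inl hz) z (.inl hz)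
    filter_upwards [hL.not_cross_fold k ⟨hk, hx⟩ z ⟨hz, hy⟩ hkz,
      ((hW.prod hW).prod hW).mem_nhds ⟨⟨hx, hx⟩, hy⟩] with p hp hpW h1 h2
    exact hp (hC hpW.1.1 hpW.2 h1) (hC hpW.1.2 hpW.2 h2)
  · obtain ⟨W, hW, hx, hy, -, hL⟩ := h k (.inr hk) l (.inr hl) l (.inr hl)
    filter_upwards [hL.not_interleave k ⟨hk, hx⟩ l ⟨hl, hy⟩ hne hkl,
      ((hW.prod hW).prod (hW.prod hW)).mem_nhds ⟨⟨hx, hx⟩, ⟨hy, hy⟩⟩] with p hp hpW h1 h2 h3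
    exact hp (hC hpW.1.1 hpW.2.1 h1) (hC hpW.2.1 hpW.1.2 h2) (hC hpW.1.2 hpW.2.2 h3)

end LayerOrder

/-! ### Motions -/

/-- Heine–Cantor on the compact product of the time interval and the paper. -/
theorem tendstoUniformlyOn_of_continuousOn_prod {S : Set ℂ} (hS : IsCompact S) {F : ℝ → ℂ → ℂ}
    (h : ContinuousOn (fun p : ℝ × ℂ => F p.1 p.2) (Icc (0 : ℝ) 1 ×ˢ S)) {t : ℝ}
    (ht : t ∈ Icc (0 : ℝ) 1) : TendstoUniformlyOn F (F t) (𝓝[Icc (0 : ℝ) 1] t) S := by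
  have hu := (isCompact_Icc.prod hS).uniformContinuousOn_of_continuous h
  rw [Metric.uniformContinuousOn_iff] at hu
  rw [Metric.tendstoUniformlyOn_iff]
  intro ε hε
  obtain ⟨δ, hδ, H⟩ := hu ε hε
  filter_upwards [self_mem_nhdsWithin, mem_nhdsWithin_of_mem_nhds (Metric.ball_mem_nhds t hδ)]
    with s hs hsδ x hx
  refine H (t, x) ⟨ht, hx⟩ (s, x) ⟨hs, hx⟩ ?_
  rw [Prod.dist_eq]
  simpa [dist_comm t s, hδ] using hsδ

/-- A motion whose stacking orders are pulled back from one layer order. -/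
theorem LayerOrder.isFoldingMotion {X Y : Type*} [TopologicalSpace X] {U K : Set X} {f : X → Y}
    {above : X → X → Prop} (h : LayerOrder U K f above) {S : Set ℂ} (hS : IsCompact S)
    {F : ℝ → ℂ → ℂ} {m : ℝ → ℂ → X}
    (hF : ∀ t ∈ Icc (0 : ℝ) 1, IsFlatFolding S (F t))
    (hcont : ContinuousOn (fun p : ℝ × ℂ => F p.1 p.2) (Icc (0 : ℝ) 1 ×ˢ S))
    (hU : ∀ t ∈ Icc (0 : ℝ) 1, MapsTo (m t) (unfoldedSet S (F t)) U)
    (hK : ∀ t ∈ Icc (0 : ℝ) 1, MapsTo (m t) (foldSet S (F t)) K)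
    (hm : ∀ t ∈ Icc (0 : ℝ) 1, ∀ x ∈ interior S, Tendsto (fun p : ℝ × ℂ => m p.1 p.2)
      (𝓝[Icc (0 : ℝ) 1] t ×ˢ 𝓝 x) (𝓝 (m t x)))
    (hc : ∀ t ∈ Icc (0 : ℝ) 1, ∀ x ∈ interior S, ∀ y ∈ interior S, F t x = F t y →
      f (m t x) = f (m t y) ∧ (x ≠ y → m t x ≠ m t y)) :
    IsFoldingMotion S F (fun t x y => above (m t x) (m t y)) := by
  refine ⟨hF, fun t ht => ?_, fun t ht => tendstoUniformlyOn_of_continuousOn_prod hS hcont ht,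
    fun t ht x y hxy => ?_⟩
  · have hsub : ∀ x ∈ unfoldedSet S (F t) ∪ foldSet S (F t), x ∈ interior S := by
      rintro x (hx | hx)
      exacts [hx.1, hx.1]
    refine isStackingOrder_iff.2 (h.comap (hU t ht) (hK t ht) (fun x hx => ?_) fun x hx y hy =>
      hc t ht x (hsub x hx) y (hsub y hy))
    have h1 : Tendsto (fun y : ℂ => (t, y)) (𝓝 x) (𝓝[Icc (0 : ℝ) 1] t ×ˢ 𝓝 x) :=
      (tendsto_const_nhdsWithin ht).prodMk tendsto_id
    exact (hm t ht x (hsub x hx)).comp h1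
  · have hC : ∀ t ∈ Icc (0 : ℝ) 1, ∀ x y, Contact S (F t) x y →
        LayerContact U f (m t x) (m t y) := by
      rintro t ht x y ⟨hx, hy, hne, he⟩
      obtain ⟨h1, h2⟩ := hc t ht x hx.1 y hy.1 he
      exact ⟨hU t ht hx, hU t ht hy, h2 hne, h1⟩
    -- Consistency in time is the consistency of the fixed order `above`, composed with (t, x, y) ↦
    -- (m t x, m t y).
    have hx := (hm t ht x hxy.1.1).comp
      (tendsto_fst.prodMk (tendsto_fst.comp tendsto_snd) :
        Tendsto (fun p : ℝ × (ℂ × ℂ) => (p.1, p.2.1)) (𝓝[Icc (0 : ℝ) 1] t ×ˢ (𝓝 x ×ˢ 𝓝 y)) _)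
    have hy := (hm t ht y hxy.2.1.1).comp
      (tendsto_fst.prodMk (tendsto_snd.comp tendsto_snd) :
        Tendsto (fun p : ℝ × (ℂ × ℂ) => (p.1, p.2.2)) (𝓝[Icc (0 : ℝ) 1] t ×ˢ (𝓝 x ×ˢ 𝓝 y)) _)
    have ht' : ∀ᶠ p : ℝ × (ℂ × ℂ) in 𝓝[Icc (0 : ℝ) 1] t ×ˢ 𝓝 (x, y), p.1 ∈ Icc (0 : ℝ) 1 :=
      tendsto_fst.eventually self_mem_nhdsWithin
    have hev := (h.consistent _ _ (hC t ht x y hxy))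
    rw [nhds_prod_eq] at hev ht' ⊢
    filter_upwards [(hx.prodMk hy).eventually hev, ht'] with p hp hpt hpc
    exact hp (hC _ hpt _ _ hpc)

/-- The folded state `(f, above)` can be unfolded by a motion. -/
def CanUnfold (S : Set ℂ) (f : ℂ → ℂ) (above : ℂ → ℂ → Prop) : Prop :=
  ∃ (F : ℝ → ℂ → ℂ) (A : ℝ → ℂ → ℂ → Prop),
    IsFoldingMotion S F A ∧ F 0 = f ∧ A 0 = above ∧ IsUnfolded S (F 1)

theorem eventuallyEq_of_eqOn_of_mem_interior {S : Set ℂ} {f f' : ℂ → ℂ} (h : EqOn f f' S) {x : ℂ}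
    (hx : x ∈ interior S) : f =ᶠ[𝓝 x] f' := by
  filter_upwards [mem_interior_iff_mem_nhds.1 hx] with y hy
  exact h hy

theorem UnfoldedAt.congr {f f' : ℂ → ℂ} {x : ℂ} (h : UnfoldedAt f x) (h' : f' =ᶠ[𝓝 x] f) :
    UnfoldedAt f' x := by
  obtain ⟨g, hg⟩ := h
  exact ⟨g, by filter_upwards [hg, h'] with y h1 h2; rw [h2, h1]⟩

theorem FoldedAt.congr {f f' : ℂ → ℂ} {x : ℂ} (h : FoldedAt f x) (h' : f' =ᶠ[𝓝 x] f) :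
    FoldedAt f' x := by
  obtain ⟨g, u, hu, hg⟩ := h
  exact ⟨g, u, hu, by filter_upwards [hg, h'] with y h1 h2; rw [h2, h1]⟩

theorem unfoldedSet_congr {S : Set ℂ} {f f' : ℂ → ℂ} (h : EqOn f f' S) :
    unfoldedSet S f = unfoldedSet S f' := by
  ext x
  refine and_congr_right fun hx => ?_
  have := eventuallyEq_of_eqOn_of_mem_interior h hx
  exact ⟨fun hu => hu.congr this.symm, fun hu => hu.congr this⟩

theorem foldSet_congr {S : Set ℂ} {f f' : ℂ → ℂ} (h : EqOn f f' S) :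
    foldSet S f = foldSet S f' := by
  ext x
  refine and_congr_right fun hx => ?_
  have := eventuallyEq_of_eqOn_of_mem_interior h hx
  exact not_congr ⟨fun hu => hu.congr this.symm, fun hu => hu.congr this⟩

theorem contact_congr {S : Set ℂ} {f f' : ℂ → ℂ} (h : EqOn f f' S) {x y : ℂ} :
    Contact S f x y ↔ Contact S f' x y := by
  unfold Contact
  rw [unfoldedSet_congr h]
  refine and_congr_right fun hx => and_congr_right fun hy => and_congr_right fun _ => ?_
  rw [h (interior_subset hx.1), h (interior_subset hy.1)]

theorem IsFlatFolding.congr {S : Set ℂ} {f f' : ℂ → ℂ} (hf : IsFlatFolding S f)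
    (h : EqOn f f' S) : IsFlatFolding S f' := by
  refine ⟨hf.continuousOn.congr h.symm, fun x hx => ?_, foldSet_congr h ▸ hf.finite_foldLines⟩
  have := eventuallyEq_of_eqOn_of_mem_interior h hx
  exact (hf.unfoldedAt_or_foldedAt x hx).imp (fun hu => hu.congr this.symm)
    fun hu => hu.congr this.symm

theorem LayerOrder.congr_map {X Y : Type*} [TopologicalSpace X] {U K : Set X} {f f' : X → Y}
    {above : X → X → Prop} (h : LayerOrder U K f above) (h' : EqOn f f' (U ∪ K)) :
    LayerOrder U K f' above :=
  h.comap (m := id) (mapsTo_id U) (mapsTo_id K) (fun _ _ => continuousAt_id)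
    fun x hx y hy hxy => ⟨by rw [id, id, h' hx, h' hy, hxy], fun hne => hne⟩

theorem IsStackingOrder.congr {S : Set ℂ} {f f' : ℂ → ℂ} {above above' : ℂ → ℂ → Prop}
    (h : IsStackingOrder S f above) (hf : EqOn f f' S)
    (ha : ∀ x y, Contact S f x y → (above' x y ↔ above x y)) : IsStackingOrder S f' above' := by
  rw [isStackingOrder_iff] at h ⊢
  rw [← unfoldedSet_congr hf, ← foldSet_congr hf]
  refine (h.congr ha).congr_map ?_
  rintro x (hx | hx)
  exacts [hf (interior_subset hx.1), hf (interior_subset hx.1)]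

theorem IsFoldingMotion.congr {S : Set ℂ} {F F' : ℝ → ℂ → ℂ} {A A' : ℝ → ℂ → ℂ → Prop}
    (h : IsFoldingMotion S F A) (hF : ∀ t ∈ Icc (0 : ℝ) 1, EqOn (F t) (F' t) S)
    (hA : ∀ t ∈ Icc (0 : ℝ) 1, ∀ x y, Contact S (F t) x y → (A' t x y ↔ A t x y)) :
    IsFoldingMotion S F' A' := by
  refine ⟨fun t ht => (h.isFlatFolding t ht).congr (hF t ht),
    fun t ht => (h.isStackingOrder t ht).congr (hF t ht) (hA t ht), fun t ht => ?_,
    fun t ht x y hxy => ?_⟩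
  · refine ((h.continuous t ht).congr ?_).congr_right (hF t ht)
    filter_upwards [self_mem_nhdsWithin] with s hs
    exact hF s hs
  · have hxy' := (contact_congr (hF t ht)).2 hxy
    have ht' : ∀ᶠ p : ℝ × (ℂ × ℂ) in 𝓝[Icc (0 : ℝ) 1] t ×ˢ 𝓝 (x, y), p.1 ∈ Icc (0 : ℝ) 1 :=
      tendsto_fst.eventually self_mem_nhdsWithin
    filter_upwards [h.consistent t ht x y hxy', ht'] with p hp hpt hpc
    have hpc' := (contact_congr (hF _ hpt)).2 hpc
    rw [hA t ht x y hxy', hA _ hpt _ _ hpc']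
    exact hp hpc'

/-- The motion is altered at time 0 only. The axioms do not see this, as they ignore values outside
`S` and pairs not in contact. So a motion may start from a formula that agrees with `f` on `S`
alone. -/
theorem CanUnfold.congr {S : Set ℂ} {f f' : ℂ → ℂ} {above above' : ℂ → ℂ → Prop}
    (h : CanUnfold S f above) (hf : EqOn f f' S)
    (ha : ∀ x y, Contact S f x y → (above' x y ↔ above x y)) : CanUnfold S f' above' := by
  obtain ⟨F, A, hFA, rfl, rfl, hu⟩ := h
  classical
  refine ⟨fun t => if t = 0 then f' else F t, fun t => if t = 0 then above' else A t,
    hFA.congr (fun t ht => ?_) (fun t ht x y hxy => ?_), if_pos rfl, if_pos rfl, ?_⟩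
  · by_cases h0 : t = 0
    · subst h0; simpa using hf
    · simpa [h0] using eqOn_refl _ _
  · by_cases h0 : t = 0
    · subst h0; simpa using ha x y hxy
    · simp [h0]
  · simpa using hu

theorem CanUnfold.of_isUnfolded {S : Set ℂ} {f : ℂ → ℂ} {above : ℂ → ℂ → Prop}
    (hf : IsFlatFolding S f) (ha : IsStackingOrder S f above) (hu : IsUnfolded S f) :
    CanUnfold S f above := by
  refine ⟨fun _ => f, fun _ => above, ⟨fun _ _ => hf, fun _ _ => ha, fun t ht => ?_,
    fun t ht x y hxy => ?_⟩, rfl, rfl, hu⟩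
  · intro u hu
    exact Eventually.of_forall fun _ _ _ => refl_mem_uniformity hu
  · exact tendsto_snd.eventually (ha.consistent x y hxy)

/-- Motions can be performed one after the other. -/
theorem IsFoldingMotion.canUnfold {S : Set ℂ} {F : ℝ → ℂ → ℂ} {A : ℝ → ℂ → ℂ → Prop}
    (h : IsFoldingMotion S F A) (h1 : CanUnfold S (F 1) (A 1)) : CanUnfold S (F 0) (A 0) := by
  obtain ⟨G, B, hGB, hG, hB, hu⟩ := h1
  classical
  set F' : ℝ → ℂ → ℂ := fun t => if t ≤ 1 / 2 then F (2 * t) else G (2 * t - 1) with hF'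
  set A' : ℝ → ℂ → ℂ → Prop := fun t => if t ≤ 1 / 2 then A (2 * t) else B (2 * t - 1) with hA'
  have F1 : ∀ t ≤ 1 / 2, F' t = F (2 * t) := fun t ht => if_pos ht
  have A1 : ∀ t ≤ 1 / 2, A' t = A (2 * t) := fun t ht => if_pos ht
  -- At t = 1/2 both formulas hold, since `G` starts where `F` ends. The two closed halves of the
  -- time interval can then be treated separately.
  have F2 : ∀ t, 1 / 2 ≤ t → F' t = G (2 * t - 1) := by
    intro t ht
    rcases ht.eq_or_lt with rfl | ht
    · simp only [hF', le_refl, if_true]; norm_num [hG]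
    · exact if_neg (not_le.2 ht)
  have A2 : ∀ t, 1 / 2 ≤ t → A' t = B (2 * t - 1) := by
    intro t ht
    rcases ht.eq_or_lt with rfl | ht
    · simp only [hA', le_refl, if_true]; norm_num [hB]
    · exact if_neg (not_le.2 ht)
  have I1 : ∀ t ∈ Icc (0 : ℝ) (1 / 2), 2 * t ∈ Icc (0 : ℝ) 1 := fun t ht =>
    ⟨by linarith [ht.1], by linarith [ht.2]⟩
  have I2 : ∀ t ∈ Icc (1 / 2 : ℝ) 1, 2 * t - 1 ∈ Icc (0 : ℝ) 1 := fun t ht =>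
    ⟨by linarith [ht.1], by linarith [ht.2]⟩
  have hsplit : ∀ t ∈ Icc (0 : ℝ) 1, t ∈ Icc (0 : ℝ) (1 / 2) ∨ t ∈ Icc (1 / 2 : ℝ) 1 :=
    fun t ht => (le_total t (1 / 2)).imp (fun h => ⟨ht.1, h⟩) fun h => ⟨h, ht.2⟩
  have hunion : Icc (0 : ℝ) 1 = Icc 0 (1 / 2) ∪ Icc (1 / 2) 1 :=
    (Icc_union_Icc_eq_Icc (by norm_num) (by norm_num)).symm
  have T1 : ∀ t ∈ Icc (0 : ℝ) (1 / 2),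
      Tendsto (fun s : ℝ => 2 * s) (𝓝[Icc 0 (1 / 2)] t) (𝓝[Icc 0 1] (2 * t)) := fun t _ =>
    (Continuous.continuousWithinAt (by fun_prop)).tendsto_nhdsWithin I1
  have T2 : ∀ t ∈ Icc (1 / 2 : ℝ) 1,
      Tendsto (fun s : ℝ => 2 * s - 1) (𝓝[Icc (1 / 2) 1] t) (𝓝[Icc 0 1] (2 * t - 1)) :=
    fun t _ => (Continuous.continuousWithinAt (by fun_prop)).tendsto_nhdsWithin I2
  -- For a time outside one half, the condition along that half is void.
  have hleft : ∀ t ∈ Icc (0 : ℝ) 1, t ∉ Icc (0 : ℝ) (1 / 2) → 𝓝[Icc (0 : ℝ) (1 / 2)] t = ⊥ :=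
    fun t _ h => by rwa [← notMem_closure_iff_nhdsWithin_eq_bot, isClosed_Icc.closure_eq]
  have hright : ∀ t ∈ Icc (0 : ℝ) 1, t ∉ Icc (1 / 2 : ℝ) 1 → 𝓝[Icc (1 / 2 : ℝ) 1] t = ⊥ :=
    fun t _ h => by rwa [← notMem_closure_iff_nhdsWithin_eq_bot, isClosed_Icc.closure_eq]
  refine ⟨F', A', ⟨fun t ht => ?_, fun t ht => ?_, fun t ht => ?_, fun t ht x y hxy => ?_⟩, ?_, ?_,
    ?_⟩
  · rcases hsplit t ht with ht | ht
    · rw [F1 t ht.2]; exact h.isFlatFolding _ (I1 t ht)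
    · rw [F2 t ht.1]; exact hGB.isFlatFolding _ (I2 t ht)
  · rcases hsplit t ht with ht | ht
    · rw [F1 t ht.2, A1 t ht.2]; exact h.isStackingOrder _ (I1 t ht)
    · rw [F2 t ht.1, A2 t ht.1]; exact hGB.isStackingOrder _ (I2 t ht)
  · intro u hu
    rw [hunion, nhdsWithin_union, eventually_sup]
    constructor
    · by_cases ht' : t ∈ Icc (0 : ℝ) (1 / 2)
      · filter_upwards [(T1 t ht').eventually (h.continuous _ (I1 t ht') u hu),
          self_mem_nhdsWithin] with s hs hs'
        rw [F1 s hs'.2, F1 t ht'.2]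
        exact hs
      · rw [hleft t ht ht']; exact eventually_bot
    · by_cases ht' : t ∈ Icc (1 / 2 : ℝ) 1
      · filter_upwards [(T2 t ht').eventually (hGB.continuous _ (I2 t ht') u hu),
          self_mem_nhdsWithin] with s hs hs'
        rw [F2 s hs'.1, F2 t ht'.1]
        exact hs
      · rw [hright t ht ht']; exact eventually_bot
  · rw [hunion, nhdsWithin_union, sup_prod, eventually_sup]
    constructor
    · by_cases ht' : t ∈ Icc (0 : ℝ) (1 / 2)
      · rw [F1 t ht'.2] at hxy
        have hev : ∀ᶠ p : ℝ × (ℂ × ℂ) in 𝓝[Icc (0 : ℝ) (1 / 2)] t ×ˢ 𝓝 (x, y),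
            p.1 ∈ Icc (0 : ℝ) (1 / 2) := tendsto_fst.eventually self_mem_nhdsWithin
        filter_upwards [((T1 t ht').prodMap tendsto_id).eventually
          (h.consistent _ (I1 t ht') x y hxy), hev] with p hp hp'
        rw [F1 p.1 hp'.2, A1 p.1 hp'.2, A1 t ht'.2]
        exact hp
      · rw [hleft t ht ht', bot_prod]; exact eventually_bot
    · by_cases ht' : t ∈ Icc (1 / 2 : ℝ) 1
      · rw [F2 t ht'.1] at hxy
        have hev : ∀ᶠ p : ℝ × (ℂ × ℂ) in 𝓝[Icc (1 / 2 : ℝ) 1] t ×ˢ 𝓝 (x, y),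
            p.1 ∈ Icc (1 / 2 : ℝ) 1 := tendsto_fst.eventually self_mem_nhdsWithin
        filter_upwards [((T2 t ht').prodMap tendsto_id).eventually
          (hGB.consistent _ (I2 t ht') x y hxy), hev] with p hp hp'
        rw [F2 p.1 hp'.1, A2 p.1 hp'.1, A2 t ht'.1]
        exact hp
      · rw [hright t ht ht', bot_prod]; exact eventually_bot
  · rw [F1 0 (by norm_num), mul_zero]
  · rw [A1 0 (by norm_num), mul_zero]
  · rw [F2 1 (by norm_num)]; norm_num; exact hu

/-! ### Isometries and folds of the plane in coordinates -/

-- By Mazur–Ulam an isometry of the plane is affine; its linear part is a rotation, possibly after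
-- conjugation.
open ComplexConjugate in
theorem isometryEquiv_complex_form (g : ℂ ≃ᵢ ℂ) :
    ∃ a b : ℂ, ‖a‖ = 1 ∧ ((∀ z, g z = b + a * z) ∨ ∀ z, g z = b + a * conj z) := by
  obtain ⟨a, ha⟩ := linear_isometry_complex g.toRealLinearIsometryEquiv
  have hg : ∀ z, g z = g 0 + g.toRealLinearIsometryEquiv z := fun z => by
    rw [IsometryEquiv.toRealLinearIsometryEquiv_apply]; ring
  refine ⟨a, g 0, Circle.norm_coe a, ha.imp (fun h z => ?_) fun h z => ?_⟩
  · rw [hg z, h, rotation_apply]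
  · rw [hg z, h]
    simp [rotation_apply]

theorem exists_isometryEquiv_mul {a : ℂ} (ha : ‖a‖ = 1) (b : ℂ) :
    ∃ g : ℂ ≃ᵢ ℂ, ∀ z, g z = b + a * z := by
  let a' : Circle := ⟨a, mem_sphere_zero_iff_norm.2 ha⟩
  refine ⟨(rotation a').toIsometryEquiv.trans (IsometryEquiv.addLeft b), fun z => ?_⟩
  change b + rotation a' z = _
  rw [rotation_apply]

open ComplexConjugate in
theorem exists_isometryEquiv_conj {a : ℂ} (ha : ‖a‖ = 1) (b : ℂ) :
    ∃ g : ℂ ≃ᵢ ℂ, ∀ z, g z = b + a * conj z := by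
  obtain ⟨g, hg⟩ := exists_isometryEquiv_mul ha b
  exact ⟨Complex.conjLIE.toIsometryEquiv.trans g, fun z => by simp [hg]⟩

open ComplexConjugate in
theorem isometryEquiv_eq_of_eventuallyEq {g h : ℂ ≃ᵢ ℂ} {x : ℂ} (H : ∀ᶠ y in 𝓝 x, g y = h y) :
    ∀ y, g y = h y := by
  -- evaluate at `x`, `x + ε` and `x + ε * I`
  obtain ⟨ε, hε, hball⟩ := Metric.eventually_nhds_iff_ball.1 H
  have h0 := hball x (Metric.mem_ball_self hε)
  have h1 := hball (x + (ε / 2 : ℝ)) (by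
    rw [mem_ball_iff_norm, add_sub_cancel_left, Complex.norm_real, Real.norm_of_nonneg] <;> linarith)
  have h2 := hball (x + (ε / 2 : ℝ) * Complex.I) (by
    rw [mem_ball_iff_norm, add_sub_cancel_left, norm_mul, Complex.norm_I, Complex.norm_real,
      Real.norm_of_nonneg] <;> linarith)
  have hne : ((ε / 2 : ℝ) : ℂ) ≠ 0 := by exact_mod_cast (half_pos hε).ne'
  have hI : (2 : ℂ) * Complex.I ≠ 0 := by simp
  obtain ⟨a, b, ha, hg | hg⟩ := isometryEquiv_complex_form g <;>
  obtain ⟨a', b', ha', hh | hh⟩ := isometryEquiv_complex_form h <;>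
  · rw [hg, hh] at h0 h1 h2
    try simp only [map_add, map_mul, Complex.conj_ofReal, Complex.conj_I] at h1 h2
    have e1 : a = a' := mul_right_cancel₀ hne (by linear_combination h1 - h0)
    subst e1
    -- When both maps have the same orientation they are equal. Otherwise the value at the third
    -- point gives a · (ε/2) · 2i = 0, which is absurd.
    first
    | exact fun y => by rw [hg, hh]; linear_combination h0
    | exfalso
      have hane : a ≠ 0 := by rintro rfl; simp at ha
      exact mul_ne_zero (mul_ne_zero hane hne) hI (by first | linear_combination h2 - h0 |
        linear_combination h0 - h2)

/-- The plane folded along the real axis. -/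
noncomputable def foldReal (z : ℂ) : ℂ := ⟨z.re, |z.im|⟩

theorem continuous_foldReal : Continuous foldReal := by
  have : foldReal = fun z : ℂ => (z.re : ℂ) + (|z.im| : ℝ) * Complex.I := by
    ext z
    simp [foldReal, Complex.ext_iff]
  rw [this]
  fun_prop

theorem foldReal_of_nonneg {z : ℂ} (h : 0 ≤ z.im) : foldReal z = z := by
  simp [foldReal, abs_of_nonneg h]

open ComplexConjugate in
theorem foldReal_of_nonpos {z : ℂ} (h : z.im ≤ 0) : foldReal z = conj z := by
  simp [foldReal, Complex.ext_iff, abs_of_nonpos h]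

-- Keeping the other half-plane changes the fold only by an isometry; this is used to reverse the
-- direction of a crease.
open ComplexConjugate in
theorem foldReal_neg (z : ℂ) : foldReal (-z) = -conj (foldReal z) := by
  simp [foldReal, Complex.ext_iff]

theorem foldReal_add_ofReal (z : ℂ) (r : ℝ) : foldReal (z + r) = foldReal z + r := by
  simp [foldReal, Complex.ext_iff]

open ComplexConjugate in
theorem unfoldedAt_of_foldReal {f : ℂ → ℂ} {a b p u x : ℂ} (ha : ‖a‖ = 1) (hu : ‖u‖ = 1)
    (hf : ∀ᶠ y in 𝓝 x, f y = b + a * foldReal ((y - p) / u)) (hx : ((x - p) / u).im ≠ 0) :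
    UnfoldedAt f x := by
  have hcont : ContinuousAt (fun y : ℂ => ((y - p) / u).im) x :=
    (Complex.continuous_im.comp ((continuous_id.sub continuous_const).div_const u)).continuousAt
  rcases hx.lt_or_gt with hx | hx
  · have hu' : ‖a / conj u‖ = 1 := by simp [ha, hu]
    obtain ⟨g, hg⟩ := exists_isometryEquiv_conj hu' (b - a / conj u * conj p)
    refine ⟨g, ?_⟩
    filter_upwards [hf, hcont.eventually_lt_const hx] with y hy hy'
    rw [hy, foldReal_of_nonpos hy'.le, hg, map_div₀, map_sub]
    ring
  · have hu' : ‖a / u‖ = 1 := by simp [ha, hu]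
    obtain ⟨g, hg⟩ := exists_isometryEquiv_mul hu' (b - a / u * p)
    refine ⟨g, ?_⟩
    filter_upwards [hf, hcont.eventually_const_lt hx] with y hy hy'
    rw [hy, foldReal_of_nonneg hy'.le, hg]
    ring

/-- Two nearby points that are mirror images in the crease have the same image, while isometries are
injective. -/
theorem not_unfoldedAt_of_foldReal {f : ℂ → ℂ} {a b p u x : ℂ} (hu : ‖u‖ = 1)
    (hf : ∀ᶠ y in 𝓝 x, f y = b + a * foldReal ((y - p) / u)) (hx : ((x - p) / u).im = 0) :
    ¬ UnfoldedAt f x := by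
  rintro ⟨g, hg⟩
  obtain ⟨ε, hε, hball⟩ := Metric.eventually_nhds_iff_ball.1 (hf.and hg)
  have hu0 : u ≠ 0 := by rintro rfl; simp at hu
  have key : ∀ δ : ℝ, |δ| < ε → x + δ * Complex.I * u ∈ Metric.ball x ε := by
    intro δ hδ
    rw [mem_ball_iff_norm, add_sub_cancel_left]
    simpa [hu] using hδ
  have e : ∀ δ : ℝ, (x + δ * Complex.I * u - p) / u = (x - p) / u + δ * Complex.I := by
    intro δ; field_simp; ring
  have h1 := hball _ (key (ε / 2) (by rw [abs_of_pos] <;> linarith))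
  have h2 := hball _ (key (-(ε / 2)) (by rw [abs_neg, abs_of_pos] <;> linarith))
  rw [e] at h1 h2
  have h3 : foldReal ((x - p) / u + ((ε / 2 : ℝ) : ℂ) * Complex.I) =
      foldReal ((x - p) / u + ((-(ε / 2) : ℝ) : ℂ) * Complex.I) := by
    simp [foldReal, hx]
  rw [h3, ← h2.1, h2.2] at h1
  have h4 := g.injective (h1.2.symm.trans h1.1)
  have h5 : ((ε : ℂ)) * (Complex.I * u) = 0 := by
    push_cast at h4
    linear_combination h4
  simp [hu0, hε.ne'] at h5

-- A normal form in which the outer isometry preserves orientation: a reversing one is absorbed by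
-- replacing `u` with `-u`.
open ComplexConjugate in
theorem FoldedAt.exists_foldReal {f : ℂ → ℂ} {x : ℂ} (h : FoldedAt f x) :
    ∃ a b u : ℂ, ‖a‖ = 1 ∧ ‖u‖ = 1 ∧ ∀ᶠ y in 𝓝 x, f y = b + a * foldReal ((y - x) / u) := by
  obtain ⟨g, u, hu, h⟩ := h
  obtain ⟨a, b, ha, hg | hg⟩ := isometryEquiv_complex_form g
  · refine ⟨a * u, b + a * x, u, by simp [ha, hu], hu, h.mono fun y hy => ?_⟩
    rw [hy, hg, foldAlong]
    change _ = _ + _ * (⟨_, _⟩ : ℂ)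
    ring
  · refine ⟨-(a * conj u), b + a * conj x, -u, by simp [ha, hu], by simp [hu],
      h.mono fun y hy => ?_⟩
    rw [hy, hg, foldAlong, div_neg, foldReal_neg]
    change _ + _ * conj (_ + _ * foldReal ((y - x) / u)) = _
    rw [map_add, map_mul]
    ring

/-- The base point `p` may be any point of the crease, because folding commutes with translations
along it. -/
theorem foldedAt_of_foldReal {f : ℂ → ℂ} {a b p u x : ℂ} (ha : ‖a‖ = 1) (hu : ‖u‖ = 1)
    (hf : ∀ᶠ y in 𝓝 x, f y = b + a * foldReal ((y - p) / u)) (hx : ((x - p) / u).im = 0) :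
    FoldedAt f x := by
  have hu0 : u ≠ 0 := by rintro rfl; simp at hu
  have ha' : ‖a / u‖ = 1 := by simp [ha, hu]
  obtain ⟨r, hr⟩ : ∃ r : ℝ, (x - p) / u = r := ⟨((x - p) / u).re, Complex.ext rfl (by simpa using hx)⟩
  obtain ⟨g, hg⟩ := exists_isometryEquiv_mul ha' (b + a * r - a / u * x)
  refine ⟨g, u, hu, hf.mono fun y hy => ?_⟩
  have e : (y - p) / u = (y - x) / u + r := by rw [← hr]; ring
  rw [hy, e, foldReal_add_ofReal, hg, foldAlong]
  change _ = _ + _ * (_ + _ * foldReal ((y - x) / u))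
  field_simp
  ring

theorem unfoldedAt_iff_of_foldReal {f : ℂ → ℂ} {a b p u x : ℂ} (ha : ‖a‖ = 1) (hu : ‖u‖ = 1)
    (hf : ∀ᶠ y in 𝓝 x, f y = b + a * foldReal ((y - p) / u)) :
    UnfoldedAt f x ↔ ((x - p) / u).im ≠ 0 :=
  ⟨fun h h' => not_unfoldedAt_of_foldReal hu hf h' h, unfoldedAt_of_foldReal ha hu hf⟩

/-! ### Straightness of fold lines, and foldings without folds -/

theorem UnfoldedAt.eventually {f : ℂ → ℂ} {x : ℂ} (h : UnfoldedAt f x) :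
    ∀ᶠ y in 𝓝 x, UnfoldedAt f y := by
  obtain ⟨g, hg⟩ := h
  exact hg.eventually_nhds.mono fun y hy => ⟨g, hy⟩

/-- Near a fold point, the fold set is a straight line. -/
theorem IsFlatFolding.exists_fold_direction {S : Set ℂ} {f : ℂ → ℂ} (hf : IsFlatFolding S f)
    {x : ℂ} (hx : x ∈ foldSet S f) :
    ∃ u : ℂ, ‖u‖ = 1 ∧ ∀ᶠ y in 𝓝 x, (y ∈ foldSet S f ↔ ((y - x) / u).im = 0) := by
  obtain ⟨a, b, u, ha, hu, h⟩ :=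
    ((hf.unfoldedAt_or_foldedAt x hx.1).resolve_left hx.2).exists_foldReal
  refine ⟨u, hu, ?_⟩
  filter_upwards [h.eventually_nhds, isOpen_interior.mem_nhds hx.1] with y hy hyS
  rw [foldSet, mem_ofPred_eq, unfoldedAt_iff_of_foldReal ha hu hy]
  simp [hyS]

theorem line_eq_of_germ {x y u v : ℂ} (hu : ‖u‖ = 1) (hv : ‖v‖ = 1) (hy : ((y - x) / u).im = 0)
    (h : ∀ᶠ z in 𝓝 y, ((z - y) / v).im = 0 → ((z - x) / u).im = 0) (z : ℂ) :
    ((z - x) / u).im = 0 ↔ ((z - y) / v).im = 0 := by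
  have hu0 : u ≠ 0 := by rintro rfl; simp at hu
  have hv0 : v ≠ 0 := by rintro rfl; simp at hv
  obtain ⟨ε, hε, hball⟩ := Metric.eventually_nhds_iff_ball.1 h
  have h1 := hball (y + (ε / 2 : ℝ) * v) (by
    rw [mem_ball_iff_norm, add_sub_cancel_left, norm_mul, hv, Complex.norm_real,
      Real.norm_of_nonneg] <;> linarith) (by
    rw [add_sub_cancel_left, mul_div_cancel_right₀ _ hv0, Complex.ofReal_im])
  have e : (y + (ε / 2 : ℝ) * v - x) / u = (y - x) / u + (ε / 2 : ℝ) * (v / u) := by ring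
  rw [e, Complex.add_im, hy, zero_add, Complex.im_ofReal_mul] at h1
  have hvu : (v / u).im = 0 := (mul_eq_zero.1 h1).resolve_left (half_pos hε).ne'
  have hre : (v / u).re ≠ 0 := fun h0 =>
    div_ne_zero hv0 hu0 (Complex.ext (by simpa using h0) (by simpa using hvu))
  have e2 : (z - x) / u = (y - x) / u + (z - y) / v * (v / u) := by field_simp; ring
  rw [e2, Complex.add_im, hy, zero_add, Complex.mul_im, hvu, mul_zero, zero_add, mul_eq_zero,
    or_iff_left hre]

/-- The fold set is near each of its points a straight line, and two lines that share a germ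
coincide. So the line through `x` with direction `u x` is locally constant along the fold set, hence
constant on a preconnected part of it. -/
theorem IsFlatFolding.exists_fold_lines {S : Set ℂ} {f : ℂ → ℂ} (hf : IsFlatFolding S f) :
    ∃ u : ℂ → ℂ, (∀ x ∈ foldSet S f, ‖u x‖ = 1 ∧
      ∀ᶠ y in 𝓝 x, (y ∈ foldSet S f ↔ ((y - x) / u x).im = 0)) ∧
      ∀ C ⊆ foldSet S f, IsPreconnected C → ∀ x ∈ C, ∀ y ∈ C, ((y - x) / u x).im = 0 := by
  have h := fun x (hx : x ∈ foldSet S f) => hf.exists_fold_direction hx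
  choose! u hu using h
  refine ⟨u, hu, fun C hC hpre x hx y hy => ?_⟩
  have key : {z : ℂ | ((z - x) / u x).im = 0} = {z : ℂ | ((z - y) / u y).im = 0} := by
    refine hpre.induction₂ (fun x y => {z : ℂ | ((z - x) / u x).im = 0} =
      {z : ℂ | ((z - y) / u y).im = 0}) (fun x hx => ?_) (fun _ _ _ _ _ _ h1 h2 => h1.trans h2)
      (fun _ _ _ _ h1 => h1.symm) hx hy
    have hx' := hu x (hC hx)
    filter_upwards [self_mem_nhdsWithin, nhdsWithin_le_nhds hx'.2.eventually_nhds] with y hy hxy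
    have hy' := hu y (hC hy)
    ext z
    refine line_eq_of_germ hx'.1 hy'.1 (hxy.self_of_nhds.1 (hC hy)) ?_ z
    filter_upwards [hxy, hy'.2] with z h1 h2 h3
    exact h1.1 (h2.2 h3)
  have : y ∈ {z : ℂ | ((z - y) / u y).im = 0} := by simp
  rw [← key] at this
  exact this

/-- The local isometries agree where they overlap, because an isometry is determined by its germ.
Connectedness makes them one isometry, and density of the interior carries the equality to `S`. -/
theorem isUnfolded_of_foldSet_eq_empty {S : Set ℂ} {f : ℂ → ℂ} (hS : IsConnected (interior S))
    (hS' : S ⊆ closure (interior S)) (hf : ContinuousOn f S) (h : foldSet S f = ∅) :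
    IsUnfolded S f := by
  have h' : ∀ x ∈ interior S, UnfoldedAt f x := fun x hx => by
    by_contra hn
    exact (h ▸ (⟨hx, hn⟩ : x ∈ foldSet S f) : x ∈ (∅ : Set ℂ))
  choose! g hg using h'
  obtain ⟨x, hx⟩ := hS.nonempty
  refine ⟨g x, ?_⟩
  have hint : EqOn f (g x) (interior S) := by
    intro y hy
    have : ∀ z, g x z = g y z := by
      refine hS.isPreconnected.induction₂ (fun x y => ∀ z, g x z = g y z) (fun x hx => ?_)
        (fun _ _ _ _ _ _ h1 h2 z => (h1 z).trans (h2 z)) (fun _ _ _ _ h1 z => (h1 z).symm) hx hy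
      filter_upwards [self_mem_nhdsWithin, nhdsWithin_le_nhds (hg x hx).eventually_nhds]
        with y hy hxy
      refine isometryEquiv_eq_of_eventuallyEq (x := y) ?_
      filter_upwards [hxy, hg y hy] with z h1 h2
      rw [← h1, h2]
    rw [this, (hg y hy).self_of_nhds]
  exact hint.of_subset_closure hf (g x).continuous.continuousOn interior_subset hS'

/-! ### Pieces of a domain along a line -/

theorem eq_of_div_im_eq_zero {p u y : ℂ} (hu : u ≠ 0) (h : ((y - p) / u).im = 0) :
    y = p + ((y - p) / u).re * u := by
  have : (((y - p) / u).re : ℂ) = (y - p) / u := Complex.ext rfl (by simpa using h.symm)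
  rw [this, div_mul_cancel₀ _ hu, add_sub_cancel]

/-- The coordinate along the line is injective and affine on `Q`, and preconnected sets of reals are
convex. -/
theorem IsPreconnected.convex_of_subset_line {Q : Set ℂ} (h : IsPreconnected Q) {p u : ℂ}
    (hu : u ≠ 0) (hQ : ∀ y ∈ Q, ((y - p) / u).im = 0) : Convex ℝ Q := by
  have hπ : Continuous fun y : ℂ => ((y - p) / u).re :=
    Complex.continuous_re.comp ((continuous_id.sub continuous_const).div_const u)
  have hc : Convex ℝ ((fun y : ℂ => ((y - p) / u).re) '' Q) :=
    Real.convex_iff_isPreconnected.2 (h.image _ hπ.continuousOn)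
  intro x hx y hy a b ha hb hab
  obtain ⟨w, hw, hw'⟩ := hc (mem_image_of_mem _ hx) (mem_image_of_mem _ hy) ha hb hab
  convert hw using 1
  rw [eq_of_div_im_eq_zero hu (hQ w hw)]
  simp only [smul_eq_mul] at hw'
  rw [hw']
  conv_lhs => rw [eq_of_div_im_eq_zero hu (hQ x hx), eq_of_div_im_eq_zero hu (hQ y hy)]
  have hab' : (a : ℂ) + b = 1 := by exact_mod_cast hab
  simp only [Complex.real_smul, Complex.ofReal_add, Complex.ofReal_mul]
  linear_combination p * hab'

theorem convex_of_isPreconnected_of_subset_segment {D : Set ℂ} (hD : IsPreconnected D) {a b : ℂ}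
    (h : D ⊆ segment ℝ a b) : Convex ℝ D := by
  rcases eq_or_ne a b with rfl | hab
  · rw [segment_same] at h
    exact (subsingleton_singleton.anti h).convex
  · refine hD.convex_of_subset_line (p := a) (sub_ne_zero.2 hab.symm) fun y hy => ?_
    obtain ⟨θ, -, rfl⟩ := segment_eq_image' ℝ a b ▸ h hy
    rw [add_sub_cancel_left, Complex.real_smul, mul_div_cancel_right₀ _ (sub_ne_zero.2 hab.symm),
      Complex.ofReal_im]

section Pieces

variable {S : Set ℂ} {c : ℂ}

/-- The pieces of the whole segment are convex, so they stay connected when cut down to the convex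
set `Q`. -/
theorem hasFinitelyManyPieces_of_subset_segment (h : ∀ a b : ℂ, c ∉ segment ℝ a b →
    (componentsOf (segment ℝ a b ∩ interior S)).Finite) {Q : Set ℂ} (hQ : Convex ℝ Q) {a b : ℂ}
    (hab : Q ⊆ segment ℝ a b) (hc : c ∉ segment ℝ a b) :
    HasFinitelyManyPieces (Q ∩ interior S) := by
  obtain ⟨T, hT, hpre, hTeq⟩ := hasFinitelyManyPieces_iff.2 (h a b hc)
  refine ⟨(fun D => Q ∩ D) '' T, hT.image _, ?_, ?_⟩
  · rintro _ ⟨D, hD, rfl⟩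
    have hDs : D ⊆ segment ℝ a b := (subset_sUnion_of_mem hD).trans (hTeq.subset.trans inter_subset_left)
    exact (hQ.inter (convex_of_isPreconnected_of_subset_segment (hpre D hD) hDs)).isPreconnected
  · rw [sUnion_image, ← inter_iUnion₂, ← sUnion_eq_biUnion, hTeq, ← inter_assoc,
      inter_eq_left.2 hab]

/-- The extreme points of the compact set `closure Q` along the line span a segment that contains
`Q` and lies in `closure Q`, so it avoids `c`. -/
theorem hasFinitelyManyPieces_of_notMem_closure (h : ∀ a b : ℂ, c ∉ segment ℝ a b →
    (componentsOf (segment ℝ a b ∩ interior S)).Finite) {Q : Set ℂ} (hQ : Convex ℝ Q)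
    (hb : Bornology.IsBounded Q) {p u : ℂ} (hu : u ≠ 0) (hQl : ∀ y ∈ Q, ((y - p) / u).im = 0)
    (hc : c ∉ closure Q) : HasFinitelyManyPieces (Q ∩ interior S) := by
  rcases Q.eq_empty_or_nonempty with rfl | hne
  · simpa using isPreconnected_empty.hasFinitelyManyPieces
  have hπ : Continuous fun y : ℂ => (y - p) / u := (continuous_id.sub continuous_const).div_const u
  have hcl : ∀ y ∈ closure Q, ((y - p) / u).im = 0 := fun y hy =>
    closure_minimal hQl (isClosed_singleton.preimage (Complex.continuous_im.comp hπ)) hy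
  have hcpt : IsCompact (closure Q) := hb.isCompact_closure
  obtain ⟨x, hx, hxmin⟩ := hcpt.exists_isMinOn hne.closure
    (Complex.continuous_re.comp hπ).continuousOn
  obtain ⟨y, hy, hymax⟩ := hcpt.exists_isMaxOn hne.closure
    (Complex.continuous_re.comp hπ).continuousOn
  refine hasFinitelyManyPieces_of_subset_segment h hQ (a := x) (b := y) (fun z hz => ?_)
    fun hc' => hc (hQ.closure.segment_subset hx hy hc')
  have hzc := subset_closure hz
  have h1 : ((x - p) / u).re ≤ ((z - p) / u).re := hxmin hzc
  have h2 : ((z - p) / u).re ≤ ((y - p) / u).re := hymax hzc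
  have hmem : ((z - p) / u).re ∈ segment ℝ ((x - p) / u).re ((y - p) / u).re := by
    rw [segment_eq_Icc (h1.trans h2)]; exact ⟨h1, h2⟩
  obtain ⟨α, β, hα, hβ, hαβ, he⟩ := hmem
  refine ⟨α, β, hα, hβ, hαβ, ?_⟩
  have hab' : (α : ℂ) + β = 1 := by exact_mod_cast hαβ
  simp only [smul_eq_mul] at he
  conv_lhs => rw [eq_of_div_im_eq_zero hu (hcl x hx), eq_of_div_im_eq_zero hu (hcl y hy)]
  rw [eq_of_div_im_eq_zero hu (hcl z hzc), ← he]
  simp only [Complex.real_smul, Complex.ofReal_add, Complex.ofReal_mul]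
  linear_combination p * hab'

/-- Up to parameter `r` the ray meets the interior in one interval; beyond `r` the bounded set `Q`
only needs a segment that stays away from `c`. -/
theorem hasFinitelyManyPieces_ray (h : ∀ a b : ℂ, c ∉ segment ℝ a b →
    (componentsOf (segment ℝ a b ∩ interior S)).Finite) {Q : Set ℂ} (hQ : Convex ℝ Q)
    (hb : Bornology.IsBounded Q) {u : ℂ} (hu : u ≠ 0) {r : ℝ} (hr : 0 < r)
    (hord : OrdConnected {t : ℝ | t ∈ Ioo 0 r ∧ c + t * u ∈ interior S}) :
    HasFinitelyManyPieces (Q ∩ {y | ∃ t : ℝ, 0 < t ∧ y = c + t * u} ∩ interior S) := by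
  set ℓ : ℝ → ℂ := fun t => c + t * u with hℓ
  have hℓc : Continuous ℓ := by fun_prop
  have hconv : ∀ J : Set ℝ, OrdConnected J → Convex ℝ (Q ∩ ℓ '' J) := by
    intro J hJ
    refine hQ.inter (IsPreconnected.convex_of_subset_line (p := c) ?_ hu ?_)
    · exact (isPreconnected_iff_ordConnected.2 hJ).image _ hℓc.continuousOn
    · rintro _ ⟨t, -, rfl⟩
      simp [hℓ, hu]
  obtain ⟨R, hR⟩ := hb.subset_ball c
  have hR' : ∀ t : ℝ, ℓ t ∈ Q → t ≤ R / ‖u‖ := fun t ht => by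
    have := hR ht
    rw [mem_ball_iff_norm, hℓ, add_sub_cancel_left, norm_mul, Complex.norm_real] at this
    rw [le_div_iff₀ (norm_pos_iff.2 hu)]
    exact (mul_le_mul_of_nonneg_right (le_abs_self t) (norm_nonneg u)).trans this.le
  have hr' : r ≤ max r (R / ‖u‖) := le_max_left _ _
  have hseg : ℓ '' Icc r (max r (R / ‖u‖)) = segment ℝ (ℓ r) (ℓ (max r (R / ‖u‖))) := by
    rw [← segment_eq_Icc hr', segment_eq_image, segment_eq_image, image_image]
    refine image_congr fun θ _ => ?_
    simp only [hℓ, smul_eq_mul, Complex.real_smul]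
    push_cast
    ring
  have hc : c ∉ ℓ '' Icc r (max r (R / ‖u‖)) := by
    rintro ⟨t, ht, he⟩
    have : (t : ℂ) * u = 0 := by linear_combination he
    rcases mul_eq_zero.1 this with h0 | h0
    · have : t = 0 := by exact_mod_cast h0
      linarith [ht.1]
    · exact hu h0
  have h1 : HasFinitelyManyPieces (Q ∩ ℓ '' {t : ℝ | t ∈ Ioo 0 r ∧ c + t * u ∈ interior S}) :=
    (hconv _ hord).isPreconnected.hasFinitelyManyPieces
  have h2 := hasFinitelyManyPieces_of_subset_segment h
    (hconv (Icc r (max r (R / ‖u‖))) ordConnected_Icc) (inter_subset_right.trans hseg.subset)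
    (hseg ▸ hc)
  convert h1.union h2 using 1
  ext y
  constructor
  · rintro ⟨⟨hyQ, t, ht, rfl⟩, hyS⟩
    rcases lt_or_ge t r with htr | htr
    · exact .inl ⟨hyQ, t, ⟨⟨ht, htr⟩, hyS⟩, rfl⟩
    · exact .inr ⟨⟨hyQ, t, ⟨htr, (hR' t hyQ).trans (le_max_right _ _)⟩, rfl⟩, hyS⟩
  · rintro (⟨hyQ, t, ⟨ht, hyS⟩, rfl⟩ | ⟨⟨hyQ, t, ht, rfl⟩, hyS⟩)
    · exact ⟨⟨hyQ, t, ht.1, rfl⟩, hyS⟩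
    · exact ⟨⟨hyQ, t, hr.trans_le ht.1, rfl⟩, hyS⟩

/-- If `c` is in the closure of `Q`, the line passes through `c`, and `Q` splits into parts of two
opposite rays and at most the point `c`. -/
theorem hasFinitelyManyPieces_of_line (h : ∀ a b : ℂ, c ∉ segment ℝ a b →
    (componentsOf (segment ℝ a b ∩ interior S)).Finite) {Q : Set ℂ} (hQ : IsPreconnected Q)
    (hb : Bornology.IsBounded Q) {p u : ℂ} (hu : u ≠ 0) (hQl : ∀ y ∈ Q, ((y - p) / u).im = 0)
    (hc : c ∈ closure Q → ∀ v : ℂ, v ≠ 0 →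
      ∃ r > 0, OrdConnected {t : ℝ | t ∈ Ioo 0 r ∧ c + t * v ∈ interior S}) :
    HasFinitelyManyPieces (Q ∩ interior S) := by
  have hQc := hQ.convex_of_subset_line hu hQl
  by_cases hcQ : c ∈ closure Q
  swap
  · exact hasFinitelyManyPieces_of_notMem_closure h hQc hb hu hQl hcQ
  have hπ : Continuous fun y : ℂ => (y - p) / u := (continuous_id.sub continuous_const).div_const u
  have hcl : ((c - p) / u).im = 0 :=
    closure_minimal hQl (isClosed_singleton.preimage (Complex.continuous_im.comp hπ)) hcQ
  obtain ⟨r, hr, hord⟩ := hc hcQ u hu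
  obtain ⟨r', hr', hord'⟩ := hc hcQ (-u) (neg_ne_zero.2 hu)
  have h1 := hasFinitelyManyPieces_ray h hQc hb hu hr hord
  have h2 := hasFinitelyManyPieces_ray h hQc hb (neg_ne_zero.2 hu) hr' hord'
  have h3 : HasFinitelyManyPieces (Q ∩ {c} ∩ interior S) :=
    (subsingleton_singleton.anti
      (inter_subset_left.trans inter_subset_right)).isPreconnected.hasFinitelyManyPieces
  convert (h1.union h2).union h3 using 1
  rw [← union_inter_distrib_right, ← union_inter_distrib_right, ← inter_union_distrib_left,
    ← inter_union_distrib_left]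
  congr 1
  refine (inter_eq_left.2 fun y hy => ?_).symm
  have hy' : ((y - c) / u).im = 0 := by
    have : (y - c) / u = (y - p) / u - (c - p) / u := by ring
    rw [this, Complex.sub_im, hQl y hy, hcl, sub_zero]
  have hyc := eq_of_div_im_eq_zero hu hy'
  rcases lt_trichotomy ((y - c) / u).re 0 with hlt | heq | hgt
  · refine .inl (.inr ⟨-((y - c) / u).re, neg_pos.2 hlt, ?_⟩)
    push_cast
    linear_combination hyc
  · rw [heq] at hyc
    exact .inr (by simpa using hyc)
  · exact .inl (.inl ⟨_, hgt, hyc⟩)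

end Pieces

/-! ### The shrinking motion of a spiral-shaped domain -/

/-- The similarity of the plane with fixed point `c` and factor `α`. -/
def similarity (c α x : ℂ) : ℂ := c + α * (x - c)

theorem continuous_similarity (c α : ℂ) : Continuous (similarity c α) := by
  unfold similarity; fun_prop

theorem similarity_similarity (c α β x : ℂ) :
    similarity c α (similarity c β x) = similarity c (α * β) x := by
  simp only [similarity]; ring

theorem similarity_one (c x : ℂ) : similarity c 1 x = x := by simp [similarity]

theorem similarity_inv {c α : ℂ} (hα : α ≠ 0) (x : ℂ) :
    similarity c α (similarity c α⁻¹ x) = x := by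
  rw [similarity_similarity, mul_inv_cancel₀ hα, similarity_one]

theorem similarity_inv' {c α : ℂ} (hα : α ≠ 0) (x : ℂ) :
    similarity c α⁻¹ (similarity c α x) = x := by
  rw [similarity_similarity, inv_mul_cancel₀ hα, similarity_one]

theorem similarity_injective {c α : ℂ} (hα : α ≠ 0) : Function.Injective (similarity c α) :=
  fun x y h => by rw [← similarity_inv' (c := c) hα x, h, similarity_inv' hα]

theorem mapsTo_similarity_interior {S : Set ℂ} {c α : ℂ} (hα : α ≠ 0)
    (h : MapsTo (similarity c α) S S) : MapsTo (similarity c α) (interior S) (interior S) := by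
  intro x hx
  have ho : IsOpen (similarity c α⁻¹ ⁻¹' interior S) :=
    isOpen_interior.preimage (continuous_similarity c α⁻¹)
  refine interior_maximal (fun y hy => ?_) ho (by rwa [mem_preimage, similarity_inv' hα])
  rw [← similarity_inv (c := c) hα y]
  exact h (interior_subset hy)

/-- The restriction of `f` to the copy of the paper under a similarity, scaled back to the size of
the paper. -/
noncomputable def zoom (f : ℂ → ℂ) (c α x : ℂ) : ℂ := f c + α⁻¹ * (f (similarity c α x) - f c)

theorem zoom_one (f : ℂ → ℂ) (c : ℂ) : zoom f c 1 = f := by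
  ext x; simp [zoom, similarity_one]

theorem zoom_zoom_inv (f : ℂ → ℂ) (c : ℂ) {α : ℂ} (hα : α ≠ 0) :
    zoom (zoom f c α) c α⁻¹ = f := by
  ext x
  have : similarity c α c = c := by simp [similarity]
  simp only [zoom, similarity_inv hα, inv_inv, this]
  field_simp
  ring

-- Conjugating an isometry by a similarity gives an isometry. If it reverses orientation, its linear
-- factor is multiplied by `α⁻¹ * conj α`, which has modulus 1.
open ComplexConjugate in
theorem UnfoldedAt.zoom {f : ℂ → ℂ} {c α x : ℂ} (hα : α ≠ 0)
    (h : UnfoldedAt f (similarity c α x)) : UnfoldedAt (zoom f c α) x := by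
  obtain ⟨g, hg⟩ := h
  have hev := (continuous_similarity c α).continuousAt.tendsto.eventually hg
  obtain ⟨a, b, ha, hab | hab⟩ := isometryEquiv_complex_form g
  · obtain ⟨g', hg'⟩ := exists_isometryEquiv_mul ha (f c + α⁻¹ * (b + a * (c - α * c) - f c))
    refine ⟨g', hev.mono fun y hy => ?_⟩
    rw [_root_.zoom, hy, hab, hg', similarity]
    field_simp
    ring
  · have ha' : ‖α⁻¹ * a * conj α‖ = 1 := by simp [ha, hα]
    obtain ⟨g', hg'⟩ := exists_isometryEquiv_conj ha'
      (f c + α⁻¹ * (b + a * (conj c - conj α * conj c) - f c))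
    refine ⟨g', hev.mono fun y hy => ?_⟩
    rw [_root_.zoom, hy, hab, hg', similarity, map_add, map_mul, map_sub]
    ring

theorem unfoldedAt_zoom_iff {f : ℂ → ℂ} {c α x : ℂ} (hα : α ≠ 0) :
    UnfoldedAt (zoom f c α) x ↔ UnfoldedAt f (similarity c α x) := by
  refine ⟨fun h => ?_, fun h => h.zoom hα⟩
  rw [← zoom_zoom_inv f c hα]
  refine UnfoldedAt.zoom (inv_ne_zero hα) ?_
  rwa [similarity_inv' hα]

theorem foldReal_ofReal_mul {r : ℝ} (hr : 0 ≤ r) (z : ℂ) : foldReal (r * z) = r * foldReal z := by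
  simp [foldReal, Complex.ext_iff, abs_mul, abs_of_nonneg hr]

theorem FoldedAt.zoom {f : ℂ → ℂ} {c α x : ℂ} (hα : α ≠ 0)
    (h : FoldedAt f (similarity c α x)) : FoldedAt (zoom f c α) x := by
  obtain ⟨a, b, u, ha, hu, hg⟩ := h.exists_foldReal
  have hu0 : u ≠ 0 := by rintro rfl; simp at hu
  have hn : (‖α‖ : ℂ) ≠ 0 := by exact_mod_cast (norm_pos_iff.2 hα).ne'
  have hev := (continuous_similarity c α).continuousAt.tendsto.eventually hg
  -- The crease direction is turned back by the argument of `α`; the modulus of `α` is positive and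
  -- passes through `foldReal`.
  refine foldedAt_of_foldReal (a := α⁻¹ * ‖α‖ * a) (b := f c + α⁻¹ * (b - f c))
    (u := u * ‖α‖ / α) (p := x) (by simp [ha, hα]) (by simp [hu, hα]) (hev.mono fun y hy => ?_)
    (by simp)
  have e : (similarity c α y - similarity c α x) / u = ‖α‖ * ((y - x) / (u * ‖α‖ / α)) := by
    simp only [similarity]; field_simp; ring
  rw [_root_.zoom, hy, e, foldReal_ofReal_mul (norm_nonneg α)]
  ring

section Spiral

variable {S : Set ℂ} {c : ℂ}

theorem IsSpiralShapedDomain.center_mem (hS : IsSpiralShapedDomain S c) : c ∈ S := by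
  obtain ⟨κ, hκ, h⟩ := hS.isSpiralCenter
  obtain ⟨x, hx⟩ := hS.isConnected_interior.nonempty
  have hlim : Tendsto (fun t : ℝ => Complex.exp (t * κ)) atTop (𝓝 0) := by
    rw [tendsto_zero_iff_norm_tendsto_zero]
    simp only [Complex.norm_exp, Complex.re_ofReal_mul]
    exact Real.tendsto_exp_atBot.comp (tendsto_id.atTop_mul_const_of_neg hκ)
  have hlim' : Tendsto (fun t : ℝ => c + Complex.exp (t * κ) * (x - c)) atTop (𝓝 c) := by
    simpa using (hlim.mul_const (x - c)).const_add c
  exact hS.isCompact.isClosed.mem_of_tendsto hlim'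
    ((eventually_ge_atTop 0).mono fun t ht => h t ht x (interior_subset hx))

theorem IsSpiralShapedDomain.exists_mapsTo_ball (hS : IsSpiralShapedDomain S c) {κ : ℂ}
    (hκ : κ.re < 0) {r : ℝ} (hr : 0 < r) :
    ∃ s : ℝ, 0 ≤ s ∧ MapsTo (similarity c (Complex.exp (s * κ))) S (Metric.ball c r) := by
  obtain ⟨R, hR0, hR⟩ := hS.isCompact.isBounded.subset_ball_lt 0 c
  have hlim : Tendsto (fun t : ℝ => Real.exp (t * κ.re)) atTop (𝓝 0) :=
    Real.tendsto_exp_atBot.comp (tendsto_id.atTop_mul_const_of_neg hκ)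
  obtain ⟨s, hs, hs0⟩ := ((hlim.eventually_lt_const (div_pos hr hR0)).and
    (eventually_ge_atTop 0)).exists
  refine ⟨s, hs0, fun x hx => ?_⟩
  rw [mem_ball_iff_norm, similarity, add_sub_cancel_left, norm_mul, Complex.norm_exp,
    Complex.re_ofReal_mul]
  calc _ ≤ Real.exp (s * κ.re) * R :=
        mul_le_mul_of_nonneg_left (mem_ball_iff_norm.1 (hR hx)).le (Real.exp_nonneg _)
    _ < r / R * R := mul_lt_mul_of_pos_right hs hR0
    _ = r := div_mul_cancel₀ _ hR0.ne'

/-- For real `κ` the motion is a radial contraction, and the factor `l` is reached at time `log l /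
κ`. -/
theorem mem_interior_of_star {κ : ℂ} (hκ : κ.re < 0) (hκ' : κ.im = 0)
    (h : ∀ t : ℝ, 0 ≤ t → ∀ x ∈ S, c + Complex.exp (t * κ) * (x - c) ∈ S) {x : ℂ}
    (hx : x ∈ interior S) {l : ℝ} (hl : l ∈ Ioc (0 : ℝ) 1) : c + l * (x - c) ∈ interior S := by
  have hne : (l : ℂ) ≠ 0 := by exact_mod_cast hl.1.ne'
  refine mapsTo_similarity_interior hne (fun y hy => ?_) hx
  have := h (Real.log l / κ.re) (div_nonneg_of_nonpos (Real.log_nonpos hl.1.le hl.2) hκ.le) y hy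
  have e : ((Real.log l / κ.re : ℝ) : ℂ) * κ = (Real.log l : ℝ) := by
    have : κ = (κ.re : ℂ) := Complex.ext rfl (by simpa using hκ')
    have h0 : (κ.re : ℂ) ≠ 0 := by exact_mod_cast hκ.ne
    rw [this]
    push_cast
    rw [Complex.ofReal_re, div_mul_cancel₀ _ h0]
  rwa [e, ← Complex.ofReal_exp, Real.exp_log hl.1] at this

/-- A segment ending in the centre of a properly spiralling motion sweeps a neighbourhood. -/
theorem center_mem_interior_of_spiral {κ : ℂ} (hκ : κ.re < 0) (hκ' : κ.im ≠ 0)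
    (h : ∀ t : ℝ, 0 ≤ t → ∀ x ∈ S, c + Complex.exp (t * κ) * (x - c) ∈ S) {x : ℂ} (hx : x ≠ c)
    (hc : c ∈ S) (hseg : ∀ l ∈ Ioc (0 : ℝ) 1, c + l * (x - c) ∈ S) : c ∈ interior S := by
  -- `P` is the time of a full turn. During one turn the segment from `c` to `x` shrinks at most by
  -- the factor `exp (κ.re * P)`, so it sweeps the ball of the radius chosen below.
  set P : ℝ := 2 * Real.pi / |κ.im| with hP
  have hP0 : 0 < P := div_pos Real.two_pi_pos (abs_pos.2 hκ')
  have hxc : x - c ≠ 0 := sub_ne_zero.2 hx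
  rw [mem_interior_iff_mem_nhds, Metric.mem_nhds_iff]
  refine ⟨Real.exp (κ.re * P) * ‖x - c‖, by positivity, fun z hz => ?_⟩
  rcases eq_or_ne z c with rfl | hzc
  · exact hc
  set ρ : ℂ := (z - c) / (x - c) with hρ
  have hρ0 : ρ ≠ 0 := div_ne_zero (sub_ne_zero.2 hzc) hxc
  have hρn : ‖ρ‖ ≤ Real.exp (κ.re * P) := by
    rw [hρ, norm_div, div_le_iff₀ (norm_pos_iff.2 hxc)]
    exact (mem_ball_iff_norm.1 hz).le
  -- The time within the first turn at which the segment points towards `z`.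
  obtain ⟨n, hn⟩ : ∃ n : ℤ, ρ.arg / κ.im - n * P ∈ Ico 0 P := by
    refine ⟨toIcoDiv hP0 0 (ρ.arg / κ.im), ?_⟩
    have := sub_toIcoDiv_zsmul_mem_Ico hP0 0 (ρ.arg / κ.im)
    simpa using this
  set s : ℝ := ρ.arg / κ.im - n * P with hs
  have hl : ‖ρ‖ * Real.exp (-(s * κ.re)) ∈ Ioc (0 : ℝ) 1 := by
    refine ⟨mul_pos (norm_pos_iff.2 hρ0) (Real.exp_pos _), ?_⟩
    calc _ ≤ Real.exp (κ.re * P) * Real.exp (-(s * κ.re)) :=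
          mul_le_mul_of_nonneg_right hρn (Real.exp_nonneg _)
      _ = Real.exp (κ.re * (P - s)) := by rw [← Real.exp_add]; ring_nf
      _ ≤ 1 := Real.exp_le_one_iff.2 (mul_nonpos_of_nonpos_of_nonneg hκ.le (by linarith [hn.2]))
  have hmem := h s hn.1 _ (hseg _ hl)
  convert hmem using 1
  rw [add_sub_cancel_left]
  obtain ⟨m, hm⟩ : ∃ m : ℤ, n * P * κ.im = m * (2 * Real.pi) := by
    rcases hκ'.lt_or_gt with hneg | hpos
    · refine ⟨-n, ?_⟩
      rw [hP, abs_of_neg hneg]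
      push_cast
      field_simp
    · refine ⟨n, ?_⟩
      rw [hP, abs_of_pos hpos]
      field_simp
  have harg : s * κ.im = ρ.arg - m * (2 * Real.pi) := by
    rw [← hm, hs]
    field_simp
  have hexp : Complex.exp (s * κ) =
      Real.exp (s * κ.re) * Complex.exp (ρ.arg * Complex.I) := by
    have e : (s : ℂ) * κ = ((s * κ.re : ℝ) : ℂ) + (ρ.arg * Complex.I - m * (2 * Real.pi * Complex.I)) := by
      apply Complex.ext
      · simp
      · simp [harg]
    rw [e, Complex.exp_add, Complex.exp_sub, Complex.exp_int_mul_two_pi_mul_I, div_one,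
      Complex.ofReal_exp]
  have hzρ : z = c + ρ * (x - c) := by rw [hρ, div_mul_cancel₀ _ hxc]; ring
  have hone : (Real.exp (-(s * κ.re)) : ℂ) * Real.exp (s * κ.re) = 1 := by
    rw [← Complex.ofReal_mul, ← Real.exp_add]; simp
  rw [hexp, hzρ]
  conv_lhs => rw [← Complex.norm_mul_exp_arg_mul_I ρ]
  push_cast at hone ⊢
  linear_combination -(‖ρ‖ : ℂ) * Complex.exp (ρ.arg * Complex.I) * (x - c) * hone

/-- A connected subset of a line is convex, so if it has `c` in its closure it contains the segment
from any of its points to `c`, except perhaps `c` itself. That segment sweeps a neighbourhood of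
`c`. -/
theorem center_mem_interior_of_mem_closure {κ : ℂ} (hκ : κ.re < 0) (hκ' : κ.im ≠ 0)
    (h : ∀ t : ℝ, 0 ≤ t → ∀ x ∈ S, c + Complex.exp (t * κ) * (x - c) ∈ S) (hcS : c ∈ S)
    {C : Set ℂ} (hC : IsPreconnected C) (hCS : C ⊆ interior S) {p u : ℂ} (hu : u ≠ 0)
    (hCl : ∀ y ∈ C, ((y - p) / u).im = 0) (hc : c ∈ closure C) : c ∈ interior S := by
  obtain ⟨x, hx⟩ := closure_nonempty_iff.1 ⟨c, hc⟩
  rcases eq_or_ne x c with rfl | hxc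
  · exact hCS hx
  have hconv := hC.convex_of_subset_line hu hCl
  refine center_mem_interior_of_spiral hκ hκ' h hxc hcS fun l hl => interior_subset (hCS ?_)
  rcases hl.2.eq_or_lt with rfl | hl1
  · simpa using hx
  have hxc' : 0 < ‖x - c‖ := norm_pos_iff.2 (sub_ne_zero.2 hxc)
  obtain ⟨w, hw, hwc⟩ := Metric.mem_closure_iff.1 hc (l * ‖x - c‖) (mul_pos hl.1 hxc')
  have hπ : Continuous fun y : ℂ => (y - p) / u := (continuous_id.sub continuous_const).div_const u
  have hcl : ((c - p) / u).im = 0 :=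
    closure_minimal hCl (isClosed_singleton.preimage (Complex.continuous_im.comp hπ)) hc
  -- coordinates on the line with origin `c`
  have hco : ∀ y ∈ C, ∃ τ : ℝ, y = c + τ * u := fun y hy => by
    refine ⟨((y - c) / u).re, eq_of_div_im_eq_zero hu ?_⟩
    have : (y - c) / u = (y - p) / u - (c - p) / u := by ring
    rw [this, Complex.sub_im, hCl y hy, hcl, sub_zero]
  obtain ⟨ξ, rfl⟩ := hco x hx
  obtain ⟨ω, rfl⟩ := hco w hw
  have hun : 0 < ‖u‖ := norm_pos_iff.2 hu
  simp only [add_sub_cancel_left, norm_mul, Complex.norm_real, Real.norm_eq_abs, dist_self_add_right]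
    at hwc hxc'
  have hωξ : |ω| < l * |ξ| := by
    rw [← mul_assoc] at hwc; exact lt_of_mul_lt_mul_right hwc hun.le
  have hξ0 : 0 < |ξ| := (mul_pos_iff_of_pos_right hun).1 hxc'
  -- `l * ξ` lies between `ω` and `ξ`
  have hmem : l * ξ ∈ segment ℝ ω ξ := by
    rw [segment_eq_uIcc, mem_uIcc]
    rw [abs_lt] at hωξ
    rcases lt_or_gt_of_ne (abs_pos.1 hξ0) with hneg | hpos
    · rw [abs_of_neg hneg] at hωξ
      right; constructor <;> nlinarith
    · rw [abs_of_pos hpos] at hωξ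
      left; constructor <;> nlinarith
  obtain ⟨a, b, ha, hb, hab, he⟩ := hmem
  have := hconv hw hx ha hb hab
  convert this using 1
  have hab' : (a : ℂ) + b = 1 := by exact_mod_cast hab
  have he' : (a : ℂ) * ω + b * ξ = l * ξ := by exact_mod_cast he
  simp only [Complex.real_smul]
  linear_combination -c * hab' - u * he'

/-- For real `κ`, star-shapedness makes the set of parameters an initial part of the interval;
otherwise a ball about `c` lies in the interior and the set is the whole interval. -/
theorem exists_ordConnected_ray {κ : ℂ} (hκ : κ.re < 0)
    (h : ∀ t : ℝ, 0 ≤ t → ∀ x ∈ S, c + Complex.exp (t * κ) * (x - c) ∈ S)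
    (h' : κ.im ≠ 0 → c ∈ interior S) {v : ℂ} (hv : v ≠ 0) :
    ∃ r > 0, OrdConnected {t : ℝ | t ∈ Ioo 0 r ∧ c + t * v ∈ interior S} := by
  by_cases hκ' : κ.im = 0
  · refine ⟨1, one_pos, ⟨?_⟩⟩
    rintro t ⟨ht, hts⟩ t' ⟨ht', hts'⟩ τ hτ
    have hτ0 : 0 < τ := ht.1.trans_le hτ.1
    refine ⟨⟨hτ0, hτ.2.trans_lt ht'.2⟩, ?_⟩
    have := mem_interior_of_star hκ hκ' h hts' (l := τ / t')
      ⟨div_pos hτ0 ht'.1, (div_le_one ht'.1).2 hτ.2⟩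
    convert this using 2
    have : (t' : ℂ) ≠ 0 := by exact_mod_cast ht'.1.ne'
    push_cast
    field_simp
    ring
  · obtain ⟨r, hr, hball⟩ := Metric.isOpen_iff.1 isOpen_interior c (h' hκ')
    have hvn : 0 < ‖v‖ := norm_pos_iff.2 hv
    refine ⟨r / ‖v‖, div_pos hr hvn, ?_⟩
    have : {t : ℝ | t ∈ Ioo 0 (r / ‖v‖) ∧ c + t * v ∈ interior S} = Ioo 0 (r / ‖v‖) := by
      refine Subset.antisymm (fun t ht => ht.1) fun t ht => ⟨ht, hball ?_⟩
      rw [mem_ball_iff_norm, add_sub_cancel_left, norm_mul, Complex.norm_real,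
        Real.norm_of_nonneg ht.1.le]
      exact (lt_div_iff₀ hvn).1 ht.2
    rw [this]
    exact ordConnected_Ioo

theorem foldSet_zoom {f : ℂ → ℂ} {α : ℂ} (hα : α ≠ 0) (hM : MapsTo (similarity c α) S S) :
    foldSet S (zoom f c α) = similarity c α ⁻¹' foldSet S f ∩ interior S := by
  ext x
  constructor
  · rintro ⟨hx, hn⟩
    exact ⟨⟨mapsTo_similarity_interior hα hM hx, fun hu => hn (hu.zoom hα)⟩, hx⟩
  · rintro ⟨⟨_, hn⟩, hx⟩
    exact ⟨hx, fun hu => hn ((unfoldedAt_zoom_iff hα).1 hu)⟩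

/-- Only the finiteness of the fold lines needs an argument: an enlarged fold line can be cut into
several pieces by the boundary. It is straight, so `hasFinitelyManyPieces_of_line` applies. Near `c`
that lemma needs `exists_ordConnected_ray`, whose hypothesis on non-real `κ` holds because the
original fold line then has `c` in its closure. -/
theorem IsSpiralShapedDomain.isFlatFolding_zoom (hS : IsSpiralShapedDomain S c) {κ : ℂ}
    (hκ : κ.re < 0) (h : ∀ t : ℝ, 0 ≤ t → ∀ x ∈ S, c + Complex.exp (t * κ) * (x - c) ∈ S)
    {f : ℂ → ℂ} (hf : IsFlatFolding S f) {s : ℝ} (hs : 0 ≤ s) :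
    IsFlatFolding S (zoom f c (Complex.exp (s * κ))) := by
  set α := Complex.exp (s * κ) with hαdef
  have hα : α ≠ 0 := Complex.exp_ne_zero _
  have hM : MapsTo (similarity c α) S S := h s hs
  refine ⟨?_, fun x hx => ?_, ?_⟩
  · have : ContinuousOn (fun x => f (similarity c α x)) S :=
      hf.continuousOn.comp (continuous_similarity c α).continuousOn hM
    exact continuousOn_const.add (continuousOn_const.mul (this.sub continuousOn_const))
  · exact (hf.unfoldedAt_or_foldedAt _ (mapsTo_similarity_interior hα hM hx)).imp
      (fun hu => hu.zoom hα) fun hu => hu.zoom hα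
  · obtain ⟨u, hu, hline⟩ := hf.exists_fold_lines
    rw [← hasFinitelyManyPieces_iff, foldSet_zoom hα hM]
    have hunion : similarity c α ⁻¹' foldSet S f ∩ interior S =
        ⋃ C ∈ componentsOf (foldSet S f), similarity c α ⁻¹' C ∩ interior S := by
      ext x
      simp only [mem_iUnion]
      constructor
      · rintro ⟨hx, hxS⟩
        exact ⟨_, ⟨_, hx, rfl⟩, mem_connectedComponentIn hx, hxS⟩
      · rintro ⟨_, ⟨y, _, rfl⟩, hx, hxS⟩
        exact ⟨connectedComponentIn_subset (foldSet S f) y hx, hxS⟩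
    rw [hunion]
    refine .biUnion hf.finite_foldLines ?_
    rintro _ ⟨y, hy, rfl⟩
    set C := connectedComponentIn (foldSet S f) y with hC
    have hCsub : C ⊆ foldSet S f := connectedComponentIn_subset _ _
    have hCpre : IsPreconnected C := isPreconnected_connectedComponentIn
    have hCl : ∀ z ∈ C, ((z - y) / u y).im = 0 :=
      hline C hCsub hCpre y (mem_connectedComponentIn hy)
    have huy : u y ≠ 0 := by
      intro h0
      have := (hu y hy).1
      simp [h0] at this
    have hQ : similarity c α ⁻¹' C = similarity c α⁻¹ '' C := by
      ext z
      constructor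
      · exact fun hz => ⟨_, hz, similarity_inv' hα z⟩
      · rintro ⟨w, hw, rfl⟩
        rwa [mem_preimage, similarity_inv hα]
    refine hasFinitelyManyPieces_of_line hS.finite_segment (p := similarity c α⁻¹ y)
      (u := α⁻¹ * u y) ?_ ?_ (mul_ne_zero (inv_ne_zero hα) huy) (fun z hz => ?_) fun hc v hv => ?_
    · rw [hQ]
      exact hCpre.image _ (continuous_similarity c α⁻¹).continuousOn
    · rw [hQ]
      have hb : Bornology.IsBounded (closure C) :=
        (hS.isCompact.isBounded.subset ((hCsub.trans fun z hz => interior_subset hz.1))).closure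
      have hcpt : IsCompact (closure C) := Metric.isCompact_of_isClosed_isBounded isClosed_closure hb
      exact ((hcpt.image (continuous_similarity c α⁻¹)).isBounded).subset
        (image_mono subset_closure)
    · have := hCl _ hz
      convert this using 2
      simp only [similarity]
      field_simp
      ring
    · refine exists_ordConnected_ray hκ h (fun hκ' => ?_) hv
      refine center_mem_interior_of_mem_closure hκ hκ' h hS.center_mem hCpre
        (fun z hz => (hCsub hz).1) huy hCl ?_
      have h1 := image_closure_subset_closure_image (continuous_similarity c α)
        (mem_image_of_mem _ hc)
      have h2 : similarity c α c = c := by simp [similarity]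
      rw [h2] at h1
      exact closure_mono (image_preimage_subset _ _) h1

theorem IsSpiralShapedDomain.isFoldingMotion_zoom (hS : IsSpiralShapedDomain S c) {κ : ℂ}
    (hκ : κ.re < 0) (h : ∀ t : ℝ, 0 ≤ t → ∀ x ∈ S, c + Complex.exp (t * κ) * (x - c) ∈ S)
    {f : ℂ → ℂ} (hf : IsFlatFolding S f) {above : ℂ → ℂ → Prop} (ha : IsStackingOrder S f above)
    {s : ℝ} (hs : 0 ≤ s) :
    IsFoldingMotion S (fun t => zoom f c (Complex.exp ((t * s : ℝ) * κ)))
      (fun t x y => above (similarity c (Complex.exp ((t * s : ℝ) * κ)) x)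
        (similarity c (Complex.exp ((t * s : ℝ) * κ)) y)) := by
  have hα : ∀ t : ℝ, Complex.exp ((t * s : ℝ) * κ) ≠ 0 := fun t => Complex.exp_ne_zero _
  have hM : ∀ t ∈ Icc (0 : ℝ) 1, MapsTo (similarity c (Complex.exp ((t * s : ℝ) * κ))) S S :=
    fun t ht => h (t * s) (mul_nonneg ht.1 hs)
  have hcM : Continuous fun p : ℝ × ℂ => similarity c (Complex.exp ((p.1 * s : ℝ) * κ)) p.2 := by
    unfold similarity; fun_prop
  refine (isStackingOrder_iff.1 ha).isFoldingMotion hS.isCompact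
    (fun t ht => hS.isFlatFolding_zoom hκ h hf (mul_nonneg ht.1 hs)) ?_ ?_ ?_ ?_ ?_
  · have h1 : ContinuousOn (fun p : ℝ × ℂ => f (similarity c (Complex.exp ((p.1 * s : ℝ) * κ)) p.2))
        (Icc (0 : ℝ) 1 ×ˢ S) :=
      hf.continuousOn.comp hcM.continuousOn fun p hp => hM p.1 hp.1 hp.2
    have h2 : Continuous fun p : ℝ × ℂ => (Complex.exp ((p.1 * s : ℝ) * κ))⁻¹ :=
      Continuous.inv₀ (by fun_prop) fun p => Complex.exp_ne_zero _
    exact continuousOn_const.add (h2.continuousOn.mul (h1.sub continuousOn_const))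
  · rintro t ht x ⟨hx, hu⟩
    exact ⟨mapsTo_similarity_interior (hα t) (hM t ht) hx, (unfoldedAt_zoom_iff (hα t)).1 hu⟩
  · intro t ht x hx
    rw [foldSet_zoom (hα t) (hM t ht)] at hx
    exact hx.1
  · intro t _ x _
    have := (hcM.tendsto (t, x)).mono_left
      (prod_mono_left (𝓝 x) (nhdsWithin_le_nhds (s := Icc (0 : ℝ) 1) (a := t)) |>.trans
        (nhds_prod_eq (x := t) (y := x)).ge)
    exact this
  · intro t _ x _ y _ hxy
    refine ⟨?_, fun hne he => hne (similarity_injective (hα t) he)⟩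
    simp only [zoom] at hxy
    have := mul_left_cancel₀ (inv_ne_zero (hα t)) (add_left_cancel hxy)
    exact sub_left_injective this

/-- It suffices to unfold the restriction to a small copy of the paper. -/
theorem IsSpiralShapedDomain.canUnfold_of_zoom (hS : IsSpiralShapedDomain S c) {κ : ℂ}
    (hκ : κ.re < 0) (h : ∀ t : ℝ, 0 ≤ t → ∀ x ∈ S, c + Complex.exp (t * κ) * (x - c) ∈ S)
    {f : ℂ → ℂ} (hf : IsFlatFolding S f) {above : ℂ → ℂ → Prop} (ha : IsStackingOrder S f above)
    {s : ℝ} (hs : 0 ≤ s)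
    (hz : ∀ above' : ℂ → ℂ → Prop,
      (∀ x y, above' x y ↔ above (similarity c (Complex.exp (s * κ)) x)
        (similarity c (Complex.exp (s * κ)) y)) →
      IsFlatFolding S (zoom f c (Complex.exp (s * κ))) →
      IsStackingOrder S (zoom f c (Complex.exp (s * κ))) above' →
      CanUnfold S (zoom f c (Complex.exp (s * κ))) above') :
    CanUnfold S f above := by
  have hm := hS.isFoldingMotion_zoom hκ h hf ha hs
  have h1 : (1 : ℝ) ∈ Icc (0 : ℝ) 1 := by simp
  have hff := hm.isFlatFolding 1 h1
  have hfa := hm.isStackingOrder 1 h1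
  simp only [one_mul] at hff hfa
  have := hm.canUnfold (by
    simp only [one_mul]
    exact hz _ (fun _ _ => Iff.rfl) hff hfa)
  simpa [zoom_one, similarity_one] using this

end Spiral

/-! ### Unfolding a single fold through the centre -/

/-- The two layers of a single fold, with `β` telling whether the left one lies above. -/
theorem layerOrder_abs (β : Prop) :
    LayerOrder ({0}ᶜ : Set ℝ) {0} (fun p : ℝ => |p|) (fun p _ => (0 < p ↔ β)) := by
  -- Contacts are the pairs `p`, `-p`. So there are no three points pairwise in contact, and no
  -- other layer meets the fold at 0: transitivity and the two crossing axioms are vacuous.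
  have hneg : ∀ {p q : ℝ}, LayerContact ({0}ᶜ : Set ℝ) (fun p : ℝ => |p|) p q →
      p ≠ 0 ∧ q = -p := by
    rintro p q ⟨hp, hq, hne, he⟩
    refine ⟨hp, ?_⟩
    rcases abs_eq_abs.1 he with h | h
    · exact absurd h hne
    · rw [h, neg_neg]
  have hsign : ∀ {p : ℝ}, p ≠ 0 → (0 < -p ↔ ¬ 0 < p) := fun {p} hp => by
    rw [neg_pos, not_lt, le_iff_lt_or_eq, or_iff_left hp]
  refine ⟨fun p q h => ?_, fun p q h => ?_, fun p q r hpq hqr hpr => ?_, fun p q h => ?_,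
    fun k hk z hz hkz => ?_, fun k hk l hl hne => ?_⟩
  · obtain ⟨hp, rfl⟩ := hneg h
    have := hsign hp
    tauto
  · obtain ⟨hp, rfl⟩ := hneg h
    have := hsign hp
    tauto
  · obtain ⟨hp, rfl⟩ := hneg hpq
    obtain ⟨_, rfl⟩ := hneg hqr
    exact absurd (neg_neg p).symm hpr.2.2.1
  · have hp := (hneg h).1
    rcases lt_or_gt_of_ne hp with h' | h'
    · have hev : ∀ᶠ r : ℝ × ℝ in 𝓝 (p, q), r.1 < 0 :=
        continuous_fst.continuousAt.eventually_lt_const h'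
      filter_upwards [hev] with r hr _
      exact iff_congr (iff_of_false hr.not_gt h'.not_gt) Iff.rfl
    · have hev : ∀ᶠ r : ℝ × ℝ in 𝓝 (p, q), 0 < r.1 :=
        continuous_fst.continuousAt.eventually_const_lt h'
      filter_upwards [hev] with r hr _
      exact iff_congr (iff_of_true hr h') Iff.rfl
  · rw [mem_singleton_iff] at hk
    subst hk
    exact absurd (abs_eq_zero.1 (by simpa using hkz.symm)) hz
  · exact absurd ((mem_singleton_iff.1 hk).trans (mem_singleton_iff.1 hl).symm) hne

section Single

variable {S : Set ℂ} {c : ℂ}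

theorem hasFinitelyManyPieces_line_off_center (hS : IsSpiralShapedDomain S c) {p u : ℂ}
    (hu : u ≠ 0) (hc : ((c - p) / u).im ≠ 0) :
    HasFinitelyManyPieces ({x | ((x - p) / u).im = 0} ∩ interior S) := by
  obtain ⟨R, hR⟩ := hS.isCompact.isBounded.subset_closedBall c
  set Q : Set ℂ := {x | ((x - p) / u).im = 0} ∩ Metric.closedBall c R with hQ
  have hcl : IsClosed {x : ℂ | ((x - p) / u).im = 0} :=
    isClosed_eq (Complex.continuous_im.comp ((continuous_id.sub continuous_const).div_const u))
      continuous_const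
  have hconv : Convex ℝ {x : ℂ | ((x - p) / u).im = 0} := by
    have : {x : ℂ | ((x - p) / u).im = 0} = (fun t : ℝ => p + t * u) '' univ := by
      ext x
      constructor
      · exact fun hx => ⟨_, mem_univ _, (eq_of_div_im_eq_zero hu hx).symm⟩
      · rintro ⟨t, -, rfl⟩
        simp [hu]
    rw [this]
    refine IsPreconnected.convex_of_subset_line (p := p) (u := u) ?_ hu ?_
    · exact isPreconnected_univ.image _ (by fun_prop)
    · rintro _ ⟨t, -, rfl⟩
      simp [hu]
  have hQc : Convex ℝ Q := hconv.inter (convex_closedBall c R)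
  have hQcl : IsClosed Q := hcl.inter Metric.isClosed_closedBall
  have := hasFinitelyManyPieces_of_notMem_closure hS.finite_segment hQc
    (Metric.isBounded_closedBall.subset inter_subset_right) hu (fun y hy => hy.1)
    (fun h => hc ((hQcl.closure_eq ▸ h : c ∈ Q)).1)
  convert this using 1
  rw [hQ, inter_assoc, inter_eq_right.2 (interior_subset.trans hR)]

/-- The crease is translated perpendicularly to itself by `R`, the radius of a ball that contains
the paper, and so leaves it. The signed distance `m t x` from the crease maps each state to the
model `layerOrder_abs`. -/
theorem IsSpiralShapedDomain.canUnfold_of_single_fold (hS : IsSpiralShapedDomain S c) {f : ℂ → ℂ}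
    {above : ℂ → ℂ → Prop} (hf : IsFlatFolding S f) (ha : IsStackingOrder S f above)
    {a b u : ℂ} (hna : ‖a‖ = 1) (hu : ‖u‖ = 1)
    (hform : ∀ x ∈ S, f x = b + a * foldReal ((x - c) / u)) {β : Prop}
    (hβ : ∀ x y, Contact S f x y → 0 < ((x - c) / u).im → ((y - c) / u).im < 0 →
      (above x y ↔ β)) : CanUnfold S f above := by
  have hu0 : u ≠ 0 := by rintro rfl; simp at hu
  have hna0 : a ≠ 0 := by rintro rfl; simp at hna
  obtain ⟨R, hR0, hR⟩ := hS.isCompact.isBounded.subset_ball_lt 0 c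
  set p : ℝ → ℂ := fun t => c + (t * R : ℝ) * Complex.I * u with hp
  set F : ℝ → ℂ → ℂ := fun t x => b + a * foldReal ((x - p t) / u) with hF
  set m : ℝ → ℂ → ℝ := fun t x => ((x - p t) / u).im with hm
  have hm' : ∀ t x, m t x = ((x - c) / u).im - t * R := fun t x => by
    have : (x - p t) / u = (x - c) / u - (t * R : ℝ) * Complex.I := by
      simp only [hp]; field_simp; ring
    simp only [hm]
    rw [this]
    simp
  have hF0 : EqOn f (F 0) S := fun x hx => by simp [hF, hp, hform x hx]
  have hform' : ∀ t x, ∀ᶠ y in 𝓝 x, F t y = b + a * foldReal ((y - p t) / u) :=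
    fun t x => Eventually.of_forall fun y => rfl
  have hunf : ∀ t x, UnfoldedAt (F t) x ↔ m t x ≠ 0 := fun t x =>
    unfoldedAt_iff_of_foldReal hna hu (hform' t x)
  have hfs : ∀ t, foldSet S (F t) = {x | m t x = 0} ∩ interior S := fun t => by
    ext x
    change (x ∈ interior S ∧ ¬ _) ↔ (m t x = 0 ∧ _)
    rw [hunf, not_not, and_comm]
  have hflat : ∀ t ∈ Icc (0 : ℝ) 1, IsFlatFolding S (F t) := by
    intro t ht
    rcases ht.1.eq_or_lt with rfl | ht0
    -- At time 0 the crease passes through `c`, where the segment condition says nothing; finiteness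
    -- comes from `f` itself. At later times the crease misses `c`.
    · exact hf.congr hF0
    refine ⟨?_, fun x _ => ?_, ?_⟩
    · exact (continuous_const.add (continuous_const.mul (continuous_foldReal.comp
        ((continuous_id.sub continuous_const).div_const u)))).continuousOn
    · by_cases hx : m t x = 0
      · exact .inr (foldedAt_of_foldReal hna hu (hform' t x) hx)
      · exact .inl ((hunf t x).2 hx)
    · rw [← hasFinitelyManyPieces_iff, hfs]
      refine hasFinitelyManyPieces_line_off_center hS hu0 ?_
      change m t c ≠ 0
      rw [hm']
      simp [ht0.ne', hR0.ne']
  have hmcont : Continuous fun q : ℝ × ℂ => m q.1 q.2 := by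
    simp only [hm']
    exact (Complex.continuous_im.comp ((continuous_snd.sub continuous_const).div_const u)).sub
      (continuous_fst.mul continuous_const)
  have hmot : IsFoldingMotion S F (fun t x y => (0 < m t x ↔ β)) := by
    refine (layerOrder_abs β).isFoldingMotion hS.isCompact hflat ?_ ?_ ?_ ?_ ?_
    · refine Continuous.continuousOn ?_
      simp only [hF, hp]
      refine continuous_const.add (continuous_const.mul (continuous_foldReal.comp ?_))
      fun_prop
    · exact fun t _ x hx => (hunf t x).1 hx.2
    · intro t _ x hx
      rw [hfs] at hx
      exact hx.1
    · intro t _ x _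
      exact (hmcont.tendsto (t, x)).mono_left
        (prod_mono_left (𝓝 x) (nhdsWithin_le_nhds (s := Icc (0 : ℝ) 1) (a := t)) |>.trans
          (nhds_prod_eq (x := t) (y := x)).ge)
    · intro t _ x _ y _ hxy
      have h1 := mul_left_cancel₀ hna0 (add_left_cancel hxy)
      have hre : ((x - p t) / u).re = ((y - p t) / u).re := by
        simpa [foldReal] using congrArg Complex.re h1
      have him : |m t x| = |m t y| := by
        simpa [foldReal] using congrArg Complex.im h1
      refine ⟨him, fun hne he => hne ?_⟩
      have h2 : (x - p t) / u = (y - p t) / u := Complex.ext hre he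
      exact sub_left_injective ((div_left_inj' hu0).1 h2)
  have hF1 : IsUnfolded S (F 1) := by
    refine isUnfolded_of_foldSet_eq_empty hS.isConnected_interior hS.subset_closure_interior
      (hflat 1 (by simp)).continuousOn ?_
    rw [hfs]
    refine eq_empty_of_forall_notMem fun x hx => ?_
    have h0 : m 1 x = 0 := hx.1
    rw [hm', one_mul] at h0
    have h1 : ‖(x - c) / u‖ < R := by
      rw [norm_div, hu, div_one]
      exact mem_ball_iff_norm.1 (hR (interior_subset hx.2))
    linarith [(le_abs_self _).trans (Complex.abs_im_le_norm ((x - c) / u))]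
  have hcan : CanUnfold S (F 0) (fun x y => (0 < m 0 x ↔ β)) := ⟨F, _, hmot, rfl, rfl, hF1⟩
  refine hcan.congr hF0.symm fun x y hxy => ?_
  have hxy' := (contact_congr hF0).2 hxy
  have hm0 : ∀ x, m 0 x = ((x - c) / u).im := fun x => by rw [hm']; simp
  have hx0 := (hunf 0 x).1 hxy.1.2
  have hy0 := (hunf 0 y).1 hxy.2.1.2
  have hswap : Contact S f y x := ⟨hxy'.2.1, hxy'.1, hxy'.2.2.1.symm, hxy'.2.2.2.symm⟩
  have h1 := mul_left_cancel₀ hna0 (add_left_cancel hxy.2.2.2)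
  have hre : ((x - p 0) / u).re = ((y - p 0) / u).re := by
    simpa [foldReal] using congrArg Complex.re h1
  have him : |m 0 x| = |m 0 y| := by
    simpa [foldReal] using congrArg Complex.im h1
  have hopp : m 0 x = - m 0 y := by
    rcases abs_eq_abs.1 him with h | h
    · have h2 : (x - p 0) / u = (y - p 0) / u := Complex.ext hre h
      exact absurd (sub_left_injective ((div_left_inj' hu0).1 h2)) hxy.2.2.1
    · exact h
  -- `hβ` covers pairs with the first point on the positive side; the others follow by totality and
  -- asymmetry.
  rcases lt_or_gt_of_ne hx0 with hx | hx
  · have hy : 0 < m 0 y := by linarith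
    have h3 := hβ y x hswap (hm0 y ▸ hy) (hm0 x ▸ hx)
    have h4 : above x y ↔ ¬ above y x :=
      ⟨ha.asymm x y hxy', fun h => (ha.total x y hxy').resolve_right h⟩
    rw [h4, h3]
    exact ⟨fun h => ⟨fun h' => absurd h' hx.not_gt, fun h' => absurd h' h⟩,
      fun h hβ => hx.not_gt (h.2 hβ)⟩
  · have hy : m 0 y < 0 := by linarith
    rw [hβ x y hxy' (hm0 x ▸ hx) (hm0 y ▸ hy)]
    exact ⟨fun h => ⟨fun _ => h, fun _ => hx⟩, fun h => h.1 hx⟩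

/-- If no fold comes near the centre, it suffices to shrink the paper. -/
theorem IsSpiralShapedDomain.canUnfold_of_ball_disjoint (hS : IsSpiralShapedDomain S c) {f : ℂ → ℂ}
    {above : ℂ → ℂ → Prop} (hf : IsFlatFolding S f) (ha : IsStackingOrder S f above) {r : ℝ}
    (hr : 0 < r) (h : ∀ x ∈ Metric.ball c r, x ∉ foldSet S f) : CanUnfold S f above := by
  obtain ⟨κ, hκ, hsp⟩ := hS.isSpiralCenter
  obtain ⟨s, hs, hM⟩ := hS.exists_mapsTo_ball hκ hr
  refine hS.canUnfold_of_zoom hκ hsp hf ha hs fun above' _ hf' ha' =>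
    .of_isUnfolded hf' ha' (isUnfolded_of_foldSet_eq_empty hS.isConnected_interior
      hS.subset_closure_interior hf'.continuousOn ?_)
  rw [foldSet_zoom (Complex.exp_ne_zero _) (hsp s hs)]
  exact eq_empty_of_forall_notMem fun x hx => h _ (hM (interior_subset hx.2)) hx.1

open ComplexConjugate in
theorem foldReal_eq_foldReal {w z : ℂ} (h : foldReal w = foldReal z) (hw : 0 < w.im)
    (hz : z.im < 0) : z = conj w := by
  have h1 := congrArg Complex.re h
  have h2 := congrArg Complex.im h
  simp only [foldReal, abs_of_pos hw, abs_of_neg hz] at h1 h2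
  exact Complex.ext (by simp [h1]) (by simp [h2])

open ComplexConjugate in
/-- Near a fold point the order of the two layers is the same everywhere. -/
theorem exists_order_of_fold {f : ℂ → ℂ} {above : ℂ → ℂ → Prop} (ha : IsStackingOrder S f above)
    {a b u : ℂ} (hna : ‖a‖ = 1) (hu : ‖u‖ = 1) {r : ℝ} (hball : Metric.ball c r ⊆ interior S)
    (hform : ∀ x ∈ Metric.ball c r, f x = b + a * foldReal ((x - c) / u)) :
    ∃ β : Prop, ∀ x ∈ Metric.ball c r, ∀ y ∈ Metric.ball c r, f x = f y →
      0 < ((x - c) / u).im → ((y - c) / u).im < 0 → (above x y ↔ β) := by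
  have hu0 : u ≠ 0 := by rintro rfl; simp at hu
  have hna0 : a ≠ 0 := by rintro rfl; simp at hna
  -- The reflection in the crease. The contacts across the crease are the pairs `x`, `σ x`, and `x`
  -- runs through a half-disc, which is connected, so the order is constant.
  set σ : ℂ → ℂ := fun y => c + u * conj ((y - c) / u) with hσ
  have hσc : Continuous σ := by
    have h1 : Continuous fun y : ℂ => (y - c) / u :=
      (continuous_id.sub continuous_const).div_const u
    exact continuous_const.add (continuous_const.mul (Complex.continuous_conj.comp h1))
  have hσd : ∀ y, (σ y - c) / u = conj ((y - c) / u) := fun y => by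
    simp only [hσ]
    rw [add_sub_cancel_left, mul_div_cancel_left₀ _ hu0]
  have hσball : ∀ y ∈ Metric.ball c r, σ y ∈ Metric.ball c r := fun y hy => by
    rw [mem_ball_iff_norm] at hy ⊢
    rw [hσ, add_sub_cancel_left, norm_mul, Complex.norm_conj, norm_div, hu, div_one, one_mul]
    exact hy
  have hcontact : ∀ x ∈ Metric.ball c r, 0 < ((x - c) / u).im → Contact S f x (σ x) := by
    intro x hx hpos
    have hunf : ∀ y ∈ Metric.ball c r, ((y - c) / u).im ≠ 0 → y ∈ unfoldedSet S f :=
      fun y hy h0 => ⟨hball hy, unfoldedAt_of_foldReal hna hu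
        ((Metric.isOpen_ball.mem_nhds hy) |> mem_of_superset <| fun z hz => hform z hz) h0⟩
    have him : ((σ x - c) / u).im = -((x - c) / u).im := by rw [hσd, Complex.conj_im]
    refine ⟨hunf x hx hpos.ne', hunf _ (hσball x hx) (by rw [him]; simpa using hpos.ne'),
      fun he => ?_, ?_⟩
    · rw [← he] at him
      linarith
    · rw [hform x hx, hform _ (hσball x hx), hσd, foldReal_of_nonneg hpos.le,
        foldReal_of_nonpos (by rw [Complex.conj_im]; linarith), Complex.conj_conj]
  have hpre : IsPreconnected (Metric.ball c r ∩ {x | 0 < ((x - c) / u).im}) := by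
    refine ((convex_ball c r).inter ?_).isPreconnected
    intro x hx y hy s t hs ht hst
    change 0 < ((x - c) / u).im at hx
    change 0 < ((y - c) / u).im at hy
    change 0 < ((s • x + t • y - c) / u).im
    have hst' : (s : ℂ) + t = 1 := by exact_mod_cast hst
    have e : (s • x + t • y - c) / u = s * ((x - c) / u) + t * ((y - c) / u) := by
      simp only [Complex.real_smul]
      field_simp
      linear_combination c * hst'
    rw [e, Complex.add_im, Complex.im_ofReal_mul, Complex.im_ofReal_mul]
    rcases hs.eq_or_lt with rfl | hs
    · rw [zero_add] at hst; subst hst; simpa using hy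
    · exact add_pos_of_pos_of_nonneg (mul_pos hs hx) (mul_nonneg ht hy.le)
  have hconst : ∀ x ∈ Metric.ball c r ∩ {x | 0 < ((x - c) / u).im},
      ∀ y ∈ Metric.ball c r ∩ {x | 0 < ((x - c) / u).im},
      (above x (σ x) ↔ above y (σ y)) := by
    intro x hx y hy
    refine hpre.induction₂ (fun x y => (above x (σ x) ↔ above y (σ y))) (fun x hx => ?_)
      (fun _ _ _ _ _ _ h1 h2 => h1.trans h2) (fun _ _ _ _ h => h.symm) hx hy
    have ht : Tendsto (fun y => (y, σ y)) (𝓝 x) (𝓝 (x, σ x)) :=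
      (continuous_id.prodMk hσc).tendsto x
    filter_upwards [self_mem_nhdsWithin, nhdsWithin_le_nhds
      (ht.eventually (ha.consistent x (σ x) (hcontact x hx.1 hx.2)))] with y hy hev
    exact (hev (hcontact y hy.1 hy.2)).symm
  refine ⟨∃ x ∈ Metric.ball c r ∩ {x | 0 < ((x - c) / u).im}, above x (σ x),
    fun x hx y hy hxy hxp hyn => ?_⟩
  rw [hform x hx, hform y hy] at hxy
  have hyσ : y = σ x := by
    have := foldReal_eq_foldReal (mul_left_cancel₀ hna0 (add_left_cancel hxy)) hxp hyn
    simp only [hσ]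
    rw [← this, mul_div_cancel₀ _ hu0]
    ring
  rw [hyσ]
  exact ⟨fun h => ⟨x, ⟨hx, hxp⟩, h⟩, fun ⟨z, hz, h⟩ => (hconst z hz x ⟨hx, hxp⟩).1 h⟩

/-- In a ball about `c` the map is unfolded or a single fold through `c`. Zooming into this ball
spreads that form over the whole paper. -/
theorem IsSpiralShapedDomain.canUnfold_of_center_mem_interior (hS : IsSpiralShapedDomain S c)
    (hc : c ∈ interior S) {f : ℂ → ℂ} {above : ℂ → ℂ → Prop} (hf : IsFlatFolding S f)
    (ha : IsStackingOrder S f above) : CanUnfold S f above := by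
  rcases hf.unfoldedAt_or_foldedAt c hc with hunf | hfold
  · obtain ⟨r, hr, hball⟩ := Metric.eventually_nhds_iff_ball.1 hunf.eventually
    exact hS.canUnfold_of_ball_disjoint hf ha hr fun x hx hx' => hx'.2 (hball x hx)
  obtain ⟨a, b, u, hna, hu, h⟩ := hfold.exists_foldReal
  have hu0 : u ≠ 0 := by rintro rfl; simp at hu
  obtain ⟨r, hr, hball⟩ := Metric.eventually_nhds_iff_ball.1
    (h.and (isOpen_interior.mem_nhds hc))
  obtain ⟨β, hβ⟩ := exists_order_of_fold ha hna hu (fun x hx => (hball x hx).2)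
    fun x hx => (hball x hx).1
  obtain ⟨κ, hκ, hsp⟩ := hS.isSpiralCenter
  obtain ⟨s, hs, hM⟩ := hS.exists_mapsTo_ball hκ hr
  refine hS.canUnfold_of_zoom hκ hsp hf ha hs fun above' habove hf' ha' => ?_
  set α := Complex.exp (s * κ) with hαdef
  have hα : α ≠ 0 := Complex.exp_ne_zero _
  have hn : 0 < ‖α‖ := norm_pos_iff.2 hα
  have hn' : (‖α‖ : ℂ) ≠ 0 := by exact_mod_cast hn.ne'
  have e : ∀ x, (similarity c α x - c) / u = ‖α‖ * ((x - c) / (u * ‖α‖ / α)) := fun x => by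
    simp only [similarity]; field_simp; ring
  have him : ∀ x, ((similarity c α x - c) / u).im = ‖α‖ * ((x - c) / (u * ‖α‖ / α)).im :=
    fun x => by rw [e, Complex.im_ofReal_mul]
  refine hS.canUnfold_of_single_fold hf' ha' (a := α⁻¹ * ‖α‖ * a) (b := f c + α⁻¹ * (b - f c))
    (u := u * ‖α‖ / α) (β := β) (by simp [hna, hα]) (by simp [hu, hα]) (fun x hx => ?_)
    fun x y hxy hx hy => ?_
  · rw [zoom, (hball _ (hM hx)).1, e, foldReal_ofReal_mul hn.le]
    ring
  · rw [habove]
    have hxS := interior_subset hxy.1.1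
    have hyS := interior_subset hxy.2.1.1
    refine hβ _ (hM hxS) _ (hM hyS) ?_ ?_ ?_
    · have h1 := hxy.2.2.2
      simp only [zoom] at h1
      exact sub_left_injective (mul_left_cancel₀ (inv_ne_zero hα) (add_left_cancel h1))
    · rw [him]; exact mul_pos hn hx
    · rw [him]; exact mul_neg_of_pos_of_neg hn hy

end Single

/-! ### Polar coordinates about a boundary centre of a star-shaped domain -/

/-- The point with polar coordinates `ρ`, `θ` about `c`, angles being measured from `d`. -/
noncomputable def polarPoint (c d : ℂ) (ρ θ : ℝ) : ℂ := c + ρ * (d * Complex.exp (θ * Complex.I))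

/-- A continuous angular coordinate `Θ` about the centre `c` of a star-shaped paper `S`, where `c`
is on the boundary of `S`. -/
structure IsPolarChart (S : Set ℂ) (c d : ℂ) (Θ : ℂ → ℝ) : Prop where
  norm_eq_one : ‖d‖ = 1
  center_notMem : c ∉ interior S
  star : ∀ x ∈ interior S, ∀ l ∈ Ioc (0 : ℝ) 1, c + l * (x - c) ∈ interior S
  continuousOn : ContinuousOn Θ (S \ {c})
  polar : ∀ x ∈ S \ {c}, polarPoint c d ‖x - c‖ (Θ x) = x
  abs_lt : ∀ x ∈ interior S, |Θ x| < Real.pi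

section Chart

variable {S : Set ℂ} {c : ℂ}

/-- If every ray met the interior, star-shapedness and compactness of the circle of directions would
give a ball about `c` inside `S`. -/
theorem exists_missed_direction (hcS : c ∈ S) (hc : c ∉ interior S)
    (hstar : ∀ x ∈ interior S, ∀ l ∈ Ioc (0 : ℝ) 1, c + l * (x - c) ∈ interior S) :
    ∃ d : ℂ, ‖d‖ = 1 ∧ ∀ t : ℝ, 0 < t → c - t * d ∉ interior S := by
  by_contra! hcon
  have hcov : ∃ r > 0, ∀ v ∈ Metric.sphere (0 : ℂ) 1, ∀ ρ ∈ Ioc (0 : ℝ) r,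
      c + ρ * v ∈ interior S := by
    refine (isCompact_sphere (0 : ℂ) 1).induction_on
      (p := fun s => ∃ r > 0, ∀ v ∈ s, ∀ ρ ∈ Ioc (0 : ℝ) r, c + ρ * v ∈ interior S)
      ⟨1, one_pos, by simp⟩ ?_ ?_ ?_
    · rintro s t hst ⟨r, hr, h⟩
      exact ⟨r, hr, fun v hv => h v (hst hv)⟩
    · rintro s t ⟨r, hr, h⟩ ⟨r', hr', h'⟩
      refine ⟨min r r', lt_min hr hr', ?_⟩
      rintro v (hv | hv) ρ hρ
      · exact h v hv ρ ⟨hρ.1, hρ.2.trans (min_le_left _ _)⟩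
      · exact h' v hv ρ ⟨hρ.1, hρ.2.trans (min_le_right _ _)⟩
    · intro v hv
      obtain ⟨t, ht, hmem⟩ := hcon (-v) (by simpa using hv)
      have hmem' : c + t * v ∈ interior S := by convert hmem using 1; ring
      have hcont : Continuous fun v : ℂ => c + t * v := by fun_prop
      refine ⟨_, mem_nhdsWithin_of_mem_nhds (hcont.continuousAt.preimage_mem_nhds
        (isOpen_interior.mem_nhds hmem')), t, ht, fun w hw ρ hρ => ?_⟩
      have := hstar _ hw (ρ / t) ⟨div_pos hρ.1 ht, (div_le_one ht).2 hρ.2⟩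
      convert this using 1
      have : (t : ℂ) ≠ 0 := by exact_mod_cast ht.ne'
      push_cast
      field_simp
      ring
  obtain ⟨r, hr, h⟩ := hcov
  refine hc (mem_interior_iff_mem_nhds.2 (Metric.mem_nhds_iff.2 ⟨r, hr, fun z hz => ?_⟩))
  rcases eq_or_ne z c with rfl | hzc
  · exact hcS
  have hn : 0 < ‖z - c‖ := norm_pos_iff.2 (sub_ne_zero.2 hzc)
  have hn' : (‖z - c‖ : ℂ) ≠ 0 := by exact_mod_cast hn.ne'
  have := h ((z - c) / ‖z - c‖) (by simp [hn.ne']) ‖z - c‖ ⟨hn, (mem_ball_iff_norm.1 hz).le⟩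
  rw [mul_div_cancel₀ _ hn', add_sub_cancel] at this
  exact interior_subset this

/-- If points of `S` on one side of a ray accumulate at a point of the ray, then a transversal
segment starts inside `S` on that side. -/
theorem exists_transversal (hfin : ∀ a b : ℂ, c ∉ segment ℝ a b →
    (componentsOf (segment ℝ a b ∩ interior S)).Finite)
    (hstar : ∀ x ∈ interior S, ∀ l ∈ Ioc (0 : ℝ) 1, c + l * (x - c) ∈ interior S)
    {d : ℂ} (hd : d ≠ 0) {ρ : ℝ} (hρ : 0 < ρ) {σ : ℝ} (hσ : σ = 1 ∨ σ = -1)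
    (hacc : ∃ᶠ v in 𝓝 (c - ρ * d), v ∈ interior S ∧ 0 < σ * ((v - c) / d).im) :
    ∃ δ > 0, ∀ y ∈ Ioo (0 : ℝ) δ,
      c + d * (-(ρ / 2 : ℝ) + (σ * y : ℝ) * Complex.I) ∈ interior S := by
  set w : ℝ → ℂ := fun y => c + d * (-(ρ / 2 : ℝ) + (σ * y : ℝ) * Complex.I) with hw
  have hsmall : ∀ η > 0, ∃ y ∈ Ioo 0 η, w y ∈ interior S := by
    intro η hη
    have hcont : Continuous fun v : ℂ => (v - c) / d :=
      (continuous_id.sub continuous_const).div_const d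
    have hval : (c - ρ * d - c) / d = ((-ρ : ℝ) : ℂ) := by push_cast; field_simp; ring
    have h1 : ∀ᶠ v in 𝓝 (c - ρ * d), ((v - c) / d).re < -(ρ / 2) := by
      refine (Complex.continuous_re.comp hcont).continuousAt.eventually_lt_const ?_
      simp only [Function.comp, hval, Complex.ofReal_re]
      linarith
    have h2 : ∀ᶠ v in 𝓝 (c - ρ * d), σ * ((v - c) / d).im < η := by
      refine (continuous_const.mul (Complex.continuous_im.comp hcont)).continuousAt.eventually_lt_const ?_
      change σ * ((c - ρ * d - c) / d).im < η
      rwa [hval, Complex.ofReal_im, mul_zero]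
    obtain ⟨v, ⟨hvS, hvpos⟩, hvre, hvη⟩ := (hacc.and_eventually (h1.and h2)).exists
    set z := (v - c) / d with hz
    -- Contracting `v` towards `c` by this factor puts it on the transversal line at distance ρ/2,
    -- on the same side of the ray.
    set l : ℝ := ρ / 2 / -z.re with hl
    have hre : 0 < -z.re := by linarith
    have hl0 : 0 < l := div_pos (half_pos hρ) hre
    have hl1 : l ≤ 1 := (div_le_one hre).2 (by linarith)
    refine ⟨l * (σ * z.im), ⟨mul_pos hl0 hvpos, ?_⟩, ?_⟩
    · exact (mul_le_of_le_one_left hvpos.le hl1).trans_lt hvη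
    · have := hstar v hvS l ⟨hl0, hl1⟩
      convert this using 1
      have hv : v - c = d * z := by rw [hz, mul_div_cancel₀ _ hd]
      have hσσ : σ * (l * (σ * z.im)) = l * z.im := by
        rcases hσ with rfl | rfl <;> ring
      have hlre : l * z.re = -(ρ / 2) := by
        rw [hl]; field_simp; rw [div_self (neg_pos.1 hre).ne]
      have hlz : -((ρ / 2 : ℝ) : ℂ) + (l * z.im : ℝ) * Complex.I = l * z :=
        Complex.ext (by simp [← hlre]) (by simp)
      simp only [hw]
      rw [hσσ, hlz, hv]
      ring
  have hc : c ∉ segment ℝ (w (-1)) (w 1) := by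
    intro h
    obtain ⟨a, b, ha, hb, hab, he⟩ := h
    have hab' : (a : ℂ) + b = 1 := by exact_mod_cast hab
    simp only [hw, Complex.real_smul] at he
    have h1 : d * (-(ρ / 2 : ℝ) + (σ * (b - a) : ℝ) * Complex.I) = 0 := by
      push_cast at he ⊢
      linear_combination he + (-c + d * ρ / 2) * hab'
    have h2 := congrArg Complex.re ((mul_eq_zero.1 h1).resolve_left hd)
    simp at h2
    exact hρ.ne' h2
  obtain ⟨T, hT, hpre, hTeq⟩ := hasFinitelyManyPieces_iff.2 (hfin _ _ hc)
  have hwconv : ∀ {y z : ℝ} {a b : ℝ}, a + b = 1 → a • w y + b • w z = w (a * y + b * z) := by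
    intro y z a b hab
    have hab' : (a : ℂ) + b = 1 := by exact_mod_cast hab
    simp only [hw, Complex.real_smul]
    push_cast
    linear_combination (c - d * ρ / 2) * hab'
  have hwseg : ∀ y ∈ Ioo (0 : ℝ) 1, w y ∈ segment ℝ (w (-1)) (w 1) := by
    intro y hy
    refine ⟨(1 - y) / 2, (1 + y) / 2, by linarith [hy.2], by linarith [hy.1], by ring, ?_⟩
    rw [hwconv (by ring)]
    congr 1
    ring
  -- The transversal meets the interior arbitrarily close to the ray, in finitely many pieces, so a
  -- single piece accumulates at the ray. Being convex, it contains an initial interval.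
  have hcl : (0 : ℝ) ∈ closure (⋃ D ∈ T, {y : ℝ | 0 < y ∧ w y ∈ D}) := by
    rw [Metric.mem_closure_iff]
    intro η hη
    obtain ⟨y, hy, hyS⟩ := hsmall (min η 1) (lt_min hη one_pos)
    have hmem : w y ∈ ⋃₀ T := by
      rw [hTeq]
      exact ⟨hwseg y ⟨hy.1, hy.2.trans_le (min_le_right _ _)⟩, hyS⟩
    obtain ⟨D, hD, hyD⟩ := hmem
    refine ⟨y, mem_biUnion hD ⟨hy.1, hyD⟩, ?_⟩
    rw [dist_zero_left, Real.norm_of_nonneg hy.1.le]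
    exact hy.2.trans_le (min_le_left _ _)
  rw [hT.closure_biUnion] at hcl
  simp only [mem_iUnion] at hcl
  obtain ⟨D, hD, hcl⟩ := hcl
  have hDsub : D ⊆ segment ℝ (w (-1)) (w 1) ∩ interior S :=
    (subset_sUnion_of_mem hD).trans hTeq.subset
  have hDconv := convex_of_isPreconnected_of_subset_segment (hpre D hD)
    (hDsub.trans inter_subset_left)
  obtain ⟨y₀, hy₀⟩ := closure_nonempty_iff.1 ⟨0, hcl⟩
  refine ⟨y₀, hy₀.1, fun y hy => ?_⟩
  obtain ⟨y₁, hy₁, hlt⟩ := Metric.mem_closure_iff.1 hcl y hy.1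
  rw [dist_zero_left, Real.norm_of_nonneg hy₁.1.le] at hlt
  have hseg : y ∈ segment ℝ y₁ y₀ := by
    rw [segment_eq_Icc (hlt.trans hy.2).le]; exact ⟨hlt.le, hy.2.le⟩
  obtain ⟨a, b, ha, hb, hab, he⟩ := hseg
  have := hDconv hy₁.2 hy₀.2 ha hb hab
  rw [hwconv hab] at this
  simp only [smul_eq_mul] at he
  rw [he] at this
  exact (hDsub this).2

/-- A star-shaped domain does not approach a missed ray from both sides. -/
theorem not_two_sided (hS : IsClosed S) (hfin : ∀ a b : ℂ, c ∉ segment ℝ a b →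
    (componentsOf (segment ℝ a b ∩ interior S)).Finite)
    (hstar : ∀ x ∈ interior S, ∀ l ∈ Ioc (0 : ℝ) 1, c + l * (x - c) ∈ interior S)
    {d : ℂ} (hd : d ≠ 0) (hmiss : ∀ t : ℝ, 0 < t → c - t * d ∉ interior S) {ρ : ℝ} (hρ : 0 < ρ)
    (hpos : ∃ᶠ v in 𝓝 (c - ρ * d), v ∈ interior S ∧ 0 < ((v - c) / d).im)
    (hneg : ∃ᶠ v in 𝓝 (c - ρ * d), v ∈ interior S ∧ ((v - c) / d).im < 0) : False := by
  obtain ⟨δ, hδ, h⟩ := exists_transversal hfin hstar hd hρ (σ := 1) (.inl rfl)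
    (hpos.mono fun v hv => by simpa using hv)
  obtain ⟨δ', hδ', h'⟩ := exists_transversal hfin hstar hd hρ (σ := -1) (.inr rfl)
    (hneg.mono fun v hv => by simpa using hv)
  have hcont : Continuous fun v : ℂ => (v - c) / d :=
    (continuous_id.sub continuous_const).div_const d
  have hval : (c - (ρ / 4 : ℝ) * d - c) / d = ((-(ρ / 4) : ℝ) : ℂ) := by
    push_cast; field_simp; ring
  set η : ℝ := min δ δ' / 4 with hη
  have hη0 : 0 < η := div_pos (lt_min hδ hδ') (by norm_num)
  -- Contracting the two transversal segments towards `c`, by factors between 1/4 and 1, fills both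
  -- sides of the ray near distance ρ/4. The ray itself is added because `S` is closed, and so a
  -- point of the missed ray becomes interior.
  have key : ∀ v : ℂ, ((v - c) / d).re ∈ Ioo (-(ρ / 2)) (-(ρ / 8)) → ((v - c) / d).im ≠ 0 →
      |((v - c) / d).im| < η → v ∈ interior S := by
    intro v hre him himη
    set z := (v - c) / d with hz
    have hv : v = c + d * z := by rw [hz, mul_div_cancel₀ _ hd]; ring
    set l : ℝ := -z.re / (ρ / 2) with hl
    have hl0 : 1 / 4 < l := by rw [hl, lt_div_iff₀ (half_pos hρ)]; linarith [hre.2]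
    have hl1 : l ≤ 1 := by rw [hl, div_le_one (half_pos hρ)]; linarith [hre.1]
    have hlpos : 0 < l := by linarith
    have hlne : (l : ℂ) ≠ 0 := by exact_mod_cast hlpos.ne'
    have hlre : l * -(ρ / 2) = z.re := by rw [hl]; field_simp
    have hbd : |z.im| / l < 4 * η := by
      rw [div_lt_iff₀ hlpos]
      nlinarith
    have hmem : c + d * (-(ρ / 2 : ℝ) + (z.im / l : ℝ) * Complex.I) ∈ interior S := by
      rcases lt_or_gt_of_ne him with hlt | hgt
      · have := h' (-z.im / l) ⟨div_pos (neg_pos.2 hlt) hlpos, ?_⟩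
        · convert this using 6
          ring
        · rw [abs_of_neg hlt] at hbd
          have := min_le_right δ δ'
          linarith
      · have := h (z.im / l) ⟨div_pos hgt hlpos, ?_⟩
        · convert this using 6
          ring
        · rw [abs_of_pos hgt] at hbd
          have := min_le_left δ δ'
          linarith
    have := hstar _ hmem l ⟨hlpos, hl1⟩
    convert this using 1
    have hlz : (l : ℂ) * (-(ρ / 2 : ℝ) + (z.im / l : ℝ) * Complex.I) = z := by
      apply Complex.ext
      · simp [← hlre]
      · simp
        field_simp
    rw [hv]
    linear_combination -d * hlz
  refine hmiss (ρ / 4) (by linarith) (mem_interior_iff_mem_nhds.2 ?_)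
  have hre : ∀ᶠ v in 𝓝 (c - (ρ / 4 : ℝ) * d), ((v - c) / d).re ∈ Ioo (-(ρ / 2)) (-(ρ / 8)) := by
    refine (Complex.continuous_re.comp hcont).continuousAt.preimage_mem_nhds (Ioo_mem_nhds ?_ ?_) <;>
    · simp only [Function.comp, hval, Complex.ofReal_re]; linarith
  have him : ∀ᶠ v in 𝓝 (c - (ρ / 4 : ℝ) * d), |((v - c) / d).im| < η := by
    refine (continuous_abs.comp (Complex.continuous_im.comp hcont)).continuousAt.eventually_lt_const ?_
    simpa only [Function.comp, hval, Complex.ofReal_im, abs_zero] using hη0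
  filter_upwards [hre, him] with v hvre hvim
  by_cases h0 : ((v - c) / d).im = 0
  swap
  · exact interior_subset (key v hvre h0 hvim)
  have ht : Tendsto (fun ε : ℝ => v + d * (ε * Complex.I)) (𝓝[>] 0) (𝓝 v) := by
    have : Continuous fun ε : ℝ => v + d * (ε * Complex.I) := by fun_prop
    simpa using (this.tendsto 0).mono_left nhdsWithin_le_nhds
  refine hS.mem_of_tendsto ht ?_
  filter_upwards [Ioo_mem_nhdsGT hη0] with ε hε
  have e : (v + d * (ε * Complex.I) - c) / d = (v - c) / d + ε * Complex.I := by
    field_simp; ring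
  refine interior_subset (key _ ?_ ?_ ?_)
  · rw [e]; simpa using hvre
  · rw [e]; simp [h0, hε.1.ne']
  · rw [e]; simpa [h0, abs_of_pos hε.1] using hε.2

/-- The argument with its cut along a missed ray is continuous on the interior. At a point of `S` on
the cut, other than `c`, the interior accumulates from one side only, so the argument has a limit
there and extends continuously. -/
theorem exists_isPolarChart (hS : IsClosed S) (hcl : S ⊆ closure (interior S)) (hcS : c ∈ S)
    (hc : c ∉ interior S) (hfin : ∀ a b : ℂ, c ∉ segment ℝ a b →
      (componentsOf (segment ℝ a b ∩ interior S)).Finite)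
    (hstar : ∀ x ∈ interior S, ∀ l ∈ Ioc (0 : ℝ) 1, c + l * (x - c) ∈ interior S) :
    ∃ (d : ℂ) (Θ : ℂ → ℝ), IsPolarChart S c d Θ := by
  obtain ⟨d, hd1, hmiss⟩ := exists_missed_direction hcS hc hstar
  have hd : d ≠ 0 := by rintro rfl; simp at hd1
  have hcont : Continuous fun v : ℂ => (v - c) / d :=
    (continuous_id.sub continuous_const).div_const d
  set A : ℂ → ℝ := fun x => ((x - c) / d).arg with hA
  have hslit : ∀ x ∈ interior S, (x - c) / d ∈ Complex.slitPlane := by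
    intro x hx
    rw [Complex.mem_slitPlane_iff_not_le_zero]
    intro hle
    rw [Complex.le_def] at hle
    have hx' := eq_of_div_im_eq_zero hd hle.2
    rcases hle.1.eq_or_lt with h0 | h0
    · rw [Complex.zero_re] at h0
      rw [h0] at hx'
      simp only [Complex.ofReal_zero, zero_mul, add_zero] at hx'
      exact hc (hx' ▸ hx)
    · refine hmiss (-((x - c) / d).re) (neg_pos.2 h0) ?_
      convert hx using 1
      push_cast
      linear_combination -hx'
  have hcontA : ∀ x, (x - c) / d ∈ Complex.slitPlane → ContinuousAt A x := fun x hx =>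
    ContinuousAt.comp (f := fun v : ℂ => (v - c) / d) (Complex.continuousAt_arg hx)
      hcont.continuousAt
  have hlim : ∀ x ∈ S \ {c}, ∃ θ, Tendsto A (𝓝[interior S] x) (𝓝 θ) := by
    rintro x ⟨hx, hxc⟩
    by_cases hxs : (x - c) / d ∈ Complex.slitPlane
    · exact ⟨_, (hcontA x hxs).tendsto.mono_left nhdsWithin_le_nhds⟩
    rw [Complex.mem_slitPlane_iff_not_le_zero, not_not, Complex.le_def] at hxs
    have him : ((x - c) / d).im = 0 := hxs.2
    have hre : ((x - c) / d).re < 0 := by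
      refine lt_of_le_of_ne hxs.1 fun h0 => hxc ?_
      have := eq_of_div_im_eq_zero hd him
      rw [h0] at this
      simpa using this
    have hxeq : x = c - (-((x - c) / d).re : ℝ) * d := by
      have := eq_of_div_im_eq_zero hd him
      push_cast
      linear_combination this
    -- The weak inequality is on the upper side, where `arg` with value π on the cut is continuous;
    -- on the lower side the limit is -π.
    have hdich : (∀ᶠ v in 𝓝[interior S] x, 0 ≤ ((v - c) / d).im) ∨
        ∀ᶠ v in 𝓝[interior S] x, ((v - c) / d).im < 0 := by
      by_contra hcon
      rw [not_or, not_eventually, not_eventually] at hcon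
      have hreneg : ∀ᶠ v in 𝓝 x, ((v - c) / d).re < 0 :=
        (Complex.continuous_re.comp hcont).continuousAt.eventually_lt_const hre
      have h1 := frequently_nhdsWithin_iff.1 hcon.1
      have h2 := frequently_nhdsWithin_iff.1 hcon.2
      rw [hxeq] at h1 h2 hreneg
      refine not_two_sided hS hfin hstar hd hmiss (neg_pos.2 hre) ?_
        (h1.mono fun v hv => ⟨hv.2, not_le.1 hv.1⟩)
      refine (h2.and_eventually hreneg).mono fun v hv => ⟨hv.1.2, ?_⟩
      refine lt_of_le_of_ne (not_lt.1 hv.1.1) fun h0 => ?_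
      have hv' := hslit v hv.1.2
      rw [Complex.mem_slitPlane_iff] at hv'
      rcases hv' with h3 | h3
      · exact h3.not_gt hv.2
      · exact h3 h0.symm
    rcases hdich with hev | hev
    · refine ⟨((x - c) / d).arg, ?_⟩
      have h1 := Complex.continuousWithinAt_arg_of_re_neg_of_im_zero hre him
      refine h1.tendsto.comp (tendsto_nhdsWithin_iff.2 ⟨?_, hev⟩)
      exact hcont.continuousAt.tendsto.mono_left nhdsWithin_le_nhds
    · refine ⟨-Real.pi, ?_⟩
      have h1 := Complex.tendsto_arg_nhdsWithin_im_neg_of_re_neg_of_im_zero hre him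
      refine h1.comp (tendsto_nhdsWithin_iff.2 ⟨?_, hev⟩)
      exact hcont.continuousAt.tendsto.mono_left nhdsWithin_le_nhds
  have heq : ∀ x ∈ interior S, extendFrom (interior S) A x = A x := fun x hx =>
    extendFrom_eq (subset_closure hx) ((hcontA x (hslit x hx)).tendsto.mono_left nhdsWithin_le_nhds)
  have hpolar : ∀ x ≠ c, polarPoint c d ‖x - c‖ (A x) = x := by
    intro x _
    have h1 := Complex.norm_mul_exp_arg_mul_I ((x - c) / d)
    rw [norm_div, hd1, div_one, eq_div_iff hd] at h1
    rw [polarPoint]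
    simp only [hA]
    linear_combination h1
  refine ⟨d, extendFrom (interior S) A, hd1, hc, hstar,
    continuousOn_extendFrom (fun x hx => hcl hx.1) hlim, fun x hx => ?_, fun x hx => ?_⟩
  · have hne : (𝓝[interior S] x).NeBot := mem_closure_iff_nhdsWithin_neBot.1 (hcl hx.1)
    have h1 : Tendsto A (𝓝[interior S] x) (𝓝 (extendFrom (interior S) A x)) :=
      tendsto_extendFrom (hlim x hx)
    have h2 : Tendsto (fun y => polarPoint c d ‖y - c‖ (A y)) (𝓝[interior S] x)
        (𝓝 (polarPoint c d ‖x - c‖ (extendFrom (interior S) A x))) := by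
      have hc' : Continuous fun p : ℝ × ℝ => polarPoint c d p.1 p.2 := by
        unfold polarPoint; fun_prop
      have hn : Tendsto (fun y : ℂ => ‖y - c‖) (𝓝[interior S] x) (𝓝 ‖x - c‖) :=
        ((continuous_id.sub continuous_const).norm.tendsto x).mono_left nhdsWithin_le_nhds
      exact (hc'.tendsto _).comp (hn.prodMk_nhds h1)
    refine tendsto_nhds_unique h2 ?_
    refine (tendsto_id.mono_left nhdsWithin_le_nhds).congr' ?_
    filter_upwards [self_mem_nhdsWithin] with y hy
    exact (hpolar y fun h => hc (h ▸ hy)).symm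
  · rw [heq x hx, abs_lt]
    exact ⟨Complex.neg_pi_lt_arg _, lt_of_le_of_ne (Complex.arg_le_pi _)
      (Complex.mem_slitPlane_iff_arg.1 (hslit x hx)).1⟩

end Chart

/-! ### Angular functions and conical maps -/

theorem eq_of_exp_mul_I_eq {α β : ℝ} (h : Complex.exp (α * Complex.I) = Complex.exp (β * Complex.I))
    (hlt : |α - β| < 2 * Real.pi) : α = β := by
  obtain ⟨n, hn⟩ := Complex.exp_eq_exp_iff_exists_int.1 h
  have h1 : α - β = n * (2 * Real.pi) := by
    have h2 : ((α - β : ℝ) : ℂ) = ((n * (2 * Real.pi) : ℝ) : ℂ) := by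
      refine mul_right_cancel₀ Complex.I_ne_zero ?_
      push_cast
      linear_combination hn
    exact_mod_cast h2
  rw [h1, abs_mul, abs_of_pos Real.two_pi_pos] at hlt
  have h3 : |(n : ℝ)| < 1 := by
    by_contra hcon
    exact hlt.not_ge (le_mul_of_one_le_left Real.two_pi_pos.le (not_lt.1 hcon))
  have h4 : n = 0 := Int.abs_lt_one_iff.1 (by exact_mod_cast h3)
  rw [h4, Int.cast_zero, zero_mul] at h1
  linarith

theorem norm_polarPoint_sub {c d : ℂ} (hd : ‖d‖ = 1) {ρ : ℝ} (hρ : 0 ≤ ρ) (θ : ℝ) :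
    ‖polarPoint c d ρ θ - c‖ = ρ := by
  rw [polarPoint, add_sub_cancel_left, norm_mul, norm_mul, hd, Complex.norm_exp_ofReal_mul_I,
    Complex.norm_real, Real.norm_of_nonneg hρ, one_mul, mul_one]

theorem continuous_polarPoint (c d : ℂ) : Continuous fun p : ℝ × ℝ => polarPoint c d p.1 p.2 := by
  unfold polarPoint; fun_prop

theorem polarPoint_star (c d : ℂ) (ρ θ l : ℝ) :
    c + l * (polarPoint c d ρ θ - c) = polarPoint c d (l * ρ) θ := by
  simp only [polarPoint]; push_cast; ring

/-- The function `ψ` has slope `1` or `-1` near `θ₀`. -/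
def IsAngularLine (ψ : ℝ → ℝ) (θ₀ : ℝ) : Prop :=
  ∃ ε : ℝ, (ε = 1 ∨ ε = -1) ∧ ∀ᶠ θ in 𝓝 θ₀, ψ θ = ψ θ₀ + ε * (θ - θ₀)

/-- The function `ψ` folds the line near `θ₀`. -/
def IsAngularFold (ψ : ℝ → ℝ) (θ₀ : ℝ) : Prop :=
  ∃ ε : ℝ, (ε = 1 ∨ ε = -1) ∧ ∀ᶠ θ in 𝓝 θ₀, ψ θ = ψ θ₀ + ε * |θ - θ₀|

theorem IsAngularLine.eventually {ψ : ℝ → ℝ} {θ₀ : ℝ} (h : IsAngularLine ψ θ₀) :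
    ∀ᶠ θ in 𝓝 θ₀, IsAngularLine ψ θ := by
  obtain ⟨ε, hε, h⟩ := h
  filter_upwards [h.eventually_nhds] with θ hθ
  refine ⟨ε, hε, hθ.mono fun θ' h' => ?_⟩
  rw [h', hθ.self_of_nhds]
  ring

theorem IsAngularFold.eventually {ψ : ℝ → ℝ} {θ₀ : ℝ} (h : IsAngularFold ψ θ₀) :
    ∀ᶠ θ in 𝓝 θ₀, θ ≠ θ₀ → IsAngularLine ψ θ := by
  obtain ⟨ε, hε, h⟩ := h
  filter_upwards [h.eventually_nhds] with θ hθ hne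
  rcases lt_or_gt_of_ne hne with hlt | hgt
  · refine ⟨-ε, by rcases hε with rfl | rfl <;> simp, ?_⟩
    filter_upwards [hθ, Iio_mem_nhds hlt] with θ' h' hlt'
    rw [h', hθ.self_of_nhds, abs_of_neg (sub_neg.2 hlt), abs_of_neg (sub_neg.2 hlt')]
    ring
  · refine ⟨ε, hε, ?_⟩
    filter_upwards [hθ, Ioi_mem_nhds hgt] with θ' h' hgt'
    rw [h', hθ.self_of_nhds, abs_of_pos (sub_pos.2 hgt), abs_of_pos (sub_pos.2 hgt')]
    ring

/-- The map of the plane that fixes distances from `c` and folds angles by `ψ`. -/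
noncomputable def conic (b c : ℂ) (Θ : ℂ → ℝ) (ψ : ℝ → ℝ) (x : ℂ) : ℂ :=
  b + ‖x - c‖ * Complex.exp (ψ (Θ x) * Complex.I)

/-- Up to half a turn, the sine of an angle has the sign of the angle, so folding along the real
axis takes the absolute value of the angle. -/
theorem foldReal_mul_exp {ρ δ : ℝ} (hρ : 0 ≤ ρ) (hδ : |δ| ≤ Real.pi) :
    foldReal (ρ * Complex.exp (δ * Complex.I)) = ρ * Complex.exp ((|δ| : ℝ) * Complex.I) := by
  have h : |Real.sin δ| = Real.sin |δ| := by
    rcases le_total 0 δ with h0 | h0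
    · rw [abs_of_nonneg h0] at hδ ⊢
      exact abs_of_nonneg (Real.sin_nonneg_of_nonneg_of_le_pi h0 hδ)
    · rw [abs_of_nonpos h0] at hδ ⊢
      rw [Real.sin_neg]
      refine abs_of_nonpos ?_
      have := Real.sin_nonneg_of_nonneg_of_le_pi (neg_nonneg.2 h0) hδ
      rw [Real.sin_neg] at this
      linarith
  rw [foldReal_ofReal_mul hρ]
  congr 1
  rw [foldReal]
  apply Complex.ext
  · simp [Complex.exp_ofReal_mul_I_re, Real.cos_abs]
  · simp only [Complex.exp_ofReal_mul_I_im, h]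

theorem exists_exp_eq {a : ℂ} (ha : ‖a‖ = 1) : ∃ χ : ℝ, Complex.exp (χ * Complex.I) = a :=
  ⟨a.arg, by simpa [ha] using Complex.norm_mul_exp_arg_mul_I a⟩

/-! ### Isometries and radial folds in polar coordinates -/

namespace IsPolarChart

variable {S : Set ℂ} {c d : ℂ} {Θ : ℂ → ℝ} (h : IsPolarChart S c d Θ)
include h

theorem ne_zero : d ≠ 0 := by
  rintro rfl
  have := h.norm_eq_one
  simp at this

theorem mem_diff {x : ℂ} (hx : x ∈ interior S) : x ∈ S \ {c} :=
  ⟨interior_subset hx, fun hxc => h.center_notMem (mem_singleton_iff.1 hxc ▸ hx)⟩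

theorem norm_pos {x : ℂ} (hx : x ∈ interior S) : 0 < ‖x - c‖ :=
  norm_pos_iff.2 (sub_ne_zero.2 (h.mem_diff hx).2)

theorem continuousAt {x : ℂ} (hx : x ∈ interior S) : ContinuousAt Θ x := by
  refine h.continuousOn.continuousAt ?_
  filter_upwards [isOpen_interior.mem_nhds hx] with y hy
  exact h.mem_diff hy

theorem sub_eq {x : ℂ} (hx : x ∈ interior S) :
    x - c = ‖x - c‖ * (d * Complex.exp (Θ x * Complex.I)) := by
  have := h.polar x (h.mem_diff hx)
  rw [polarPoint] at this
  linear_combination -this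

theorem angle_polarPoint {ρ θ : ℝ} (hρ : 0 < ρ) (hθ : |θ| < Real.pi)
    (hmem : polarPoint c d ρ θ ∈ interior S) : Θ (polarPoint c d ρ θ) = θ := by
  have h1 := h.polar _ (h.mem_diff hmem)
  rw [norm_polarPoint_sub h.norm_eq_one hρ.le] at h1
  have h2 := add_left_cancel h1
  have hρ' : (ρ : ℂ) ≠ 0 := by exact_mod_cast hρ.ne'
  refine eq_of_exp_mul_I_eq (mul_left_cancel₀ h.ne_zero (mul_left_cancel₀ hρ' h2)) ?_
  have h3 := h.abs_lt _ hmem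
  rw [_root_.abs_lt] at h3 hθ ⊢
  constructor <;> linarith [h3.1, h3.2, hθ.1, hθ.2]

theorem polarPoint_mem {ρ ρ' θ : ℝ} (hmem : polarPoint c d ρ θ ∈ interior S) (hρ' : 0 < ρ')
    (hle : ρ' ≤ ρ) : polarPoint c d ρ' θ ∈ interior S := by
  have hρ : 0 < ρ := hρ'.trans_le hle
  have := h.star _ hmem (ρ' / ρ) ⟨div_pos hρ' hρ, (div_le_one hρ).2 hle⟩
  rwa [polarPoint_star, div_mul_cancel₀ _ hρ.ne'] at this

theorem exists_polarPoint_mem {θ : ℝ} (hθ : θ ∈ Θ '' interior S) :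
    ∃ ρ > 0, polarPoint c d ρ θ ∈ interior S := by
  obtain ⟨x, hx, rfl⟩ := hθ
  exact ⟨‖x - c‖, h.norm_pos hx, by rwa [h.polar x (h.mem_diff hx)]⟩

theorem abs_lt_of_mem {θ : ℝ} (hθ : θ ∈ Θ '' interior S) : |θ| < Real.pi := by
  obtain ⟨x, hx, rfl⟩ := hθ
  exact h.abs_lt x hx

theorem mem_angles {ρ θ : ℝ} (hρ : 0 < ρ) (hθ : |θ| < Real.pi)
    (hmem : polarPoint c d ρ θ ∈ interior S) : θ ∈ Θ '' interior S :=
  ⟨_, hmem, h.angle_polarPoint hρ hθ hmem⟩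

theorem isOpen_angles : IsOpen (Θ '' interior S) := by
  rw [isOpen_iff_mem_nhds]
  intro θ hθ
  obtain ⟨ρ, hρ, hmem⟩ := h.exists_polarPoint_mem hθ
  have hc : Continuous fun θ => polarPoint c d ρ θ :=
    (continuous_polarPoint c d).comp (continuous_const.prodMk continuous_id)
  filter_upwards [hc.continuousAt.preimage_mem_nhds (isOpen_interior.mem_nhds hmem),
    continuous_abs.continuousAt.eventually_lt_const (h.abs_lt_of_mem hθ)] with θ' h1 h2
  exact h.mem_angles hρ h2 h1

theorem ordConnected_angles (hc : IsPreconnected (interior S)) :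
    OrdConnected (Θ '' interior S) :=
  isPreconnected_iff_ordConnected.1
    (hc.image _ fun _ hx => (h.continuousAt hx).continuousWithinAt)

open ComplexConjugate in
theorem unfoldedAt_of_line {f : ℂ → ℂ} {x b : ℂ} (hx : x ∈ interior S) {χ ε : ℝ}
    (hε : ε = 1 ∨ ε = -1)
    (hf : ∀ᶠ y in 𝓝 x, f y = b + ‖y - c‖ * Complex.exp ((χ + ε * (Θ y - Θ x) : ℝ) * Complex.I)) :
    UnfoldedAt f x := by
  have hd := h.ne_zero
  rcases hε with rfl | rfl
  · obtain ⟨g, hg⟩ := exists_isometryEquiv_mul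
      (a := Complex.exp ((χ - Θ x : ℝ) * Complex.I) / d)
      (by rw [norm_div, Complex.norm_exp_ofReal_mul_I, h.norm_eq_one, div_one])
      (b - Complex.exp ((χ - Θ x : ℝ) * Complex.I) / d * c)
    refine ⟨g, ?_⟩
    filter_upwards [hf, isOpen_interior.mem_nhds hx] with y hy hyS
    have e : (((χ + 1 * (Θ y - Θ x) : ℝ) : ℂ) * Complex.I) =
        (χ - Θ x : ℝ) * Complex.I + Θ y * Complex.I := by push_cast; ring
    rw [hy, hg, e, Complex.exp_add]
    have h1 : Complex.exp ((χ - Θ x : ℝ) * Complex.I) / d * (y - c) =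
        ‖y - c‖ * (Complex.exp ((χ - Θ x : ℝ) * Complex.I) * Complex.exp (Θ y * Complex.I)) := by
      rw [div_mul_eq_mul_div, div_eq_iff hd]
      conv_lhs => rw [h.sub_eq hyS]
      ring
    linear_combination -h1
  · have hd' : conj d ≠ 0 := by simpa using hd
    obtain ⟨g, hg⟩ := exists_isometryEquiv_conj
      (a := Complex.exp ((χ + Θ x : ℝ) * Complex.I) / conj d)
      (by rw [norm_div, Complex.norm_exp_ofReal_mul_I, Complex.norm_conj, h.norm_eq_one, div_one])
      (b - Complex.exp ((χ + Θ x : ℝ) * Complex.I) / conj d * conj c)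
    refine ⟨g, ?_⟩
    filter_upwards [hf, isOpen_interior.mem_nhds hx] with y hy hyS
    have e : (((χ + -1 * (Θ y - Θ x) : ℝ) : ℂ) * Complex.I) =
        (χ + Θ x : ℝ) * Complex.I + -(Θ y * Complex.I) := by push_cast; ring
    rw [hy, hg, e, Complex.exp_add]
    have h1 : Complex.exp ((χ + Θ x : ℝ) * Complex.I) / conj d * conj (y - c) =
        ‖y - c‖ * (Complex.exp ((χ + Θ x : ℝ) * Complex.I) * Complex.exp (-(Θ y * Complex.I))) := by
      rw [div_mul_eq_mul_div, div_eq_iff hd']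
      conv_lhs => rw [h.sub_eq hyS]
      rw [map_mul, map_mul, ← Complex.exp_conj, map_mul, Complex.conj_ofReal, Complex.conj_ofReal,
        Complex.conj_I, mul_neg]
      ring
    rw [map_sub] at h1
    linear_combination -h1

open ComplexConjugate in
/-- A fold along a ray from the centre, in polar coordinates. -/
theorem foldReal_eq {x y : ℂ} (hy : y ∈ interior S) {ε : ℝ}
    (hε : ε = 1 ∨ ε = -1) (hδ : |Θ y - Θ x| ≤ Real.pi) :
    foldReal ((y - c) / (ε * (d * Complex.exp (Θ x * Complex.I)))) =
      ε * (‖y - c‖ * Complex.exp ((ε * |Θ y - Θ x| : ℝ) * Complex.I)) := by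
  have h1 : (y - c) / (d * Complex.exp (Θ x * Complex.I)) =
      ‖y - c‖ * Complex.exp ((Θ y - Θ x : ℝ) * Complex.I) := by
    rw [div_eq_iff (mul_ne_zero h.ne_zero (Complex.exp_ne_zero _))]
    conv_lhs => rw [h.sub_eq hy]
    have : Complex.exp (Θ y * Complex.I) =
        Complex.exp ((Θ y - Θ x : ℝ) * Complex.I) * Complex.exp (Θ x * Complex.I) := by
      rw [← Complex.exp_add]; push_cast; ring_nf
    rw [this]
    ring
  have h2 := foldReal_mul_exp (norm_nonneg (y - c)) hδ
  rcases hε with rfl | rfl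
  · rw [Complex.ofReal_one, one_mul, one_mul, one_mul, h1, h2]
  · rw [Complex.ofReal_neg, Complex.ofReal_one, neg_one_mul, neg_one_mul, neg_one_mul, div_neg,
      foldReal_neg, h1, h2, map_mul, ← Complex.exp_conj, map_mul, Complex.conj_ofReal,
      Complex.conj_ofReal, Complex.conj_I]
    push_cast
    ring_nf

theorem eventually_abs_sub_le {x : ℂ} (hx : x ∈ interior S) :
    ∀ᶠ y in 𝓝 x, |Θ y - Θ x| ≤ Real.pi := by
  have : ContinuousAt (fun y => |Θ y - Θ x|) x :=
    ((h.continuousAt hx).sub continuousAt_const).abs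
  refine (this.eventually_lt_const ?_).mono fun y hy => hy.le
  simpa using Real.pi_pos

/-- The crease direction is `ε` times the direction of the ray through `x`: the sign decides which
half-plane `foldReal` keeps, that is, whether the angle grows or falls on leaving the crease. -/
theorem exists_foldReal_of_fold {f : ℂ → ℂ} {x b : ℂ} (hx : x ∈ interior S) {χ ε : ℝ}
    (hε : ε = 1 ∨ ε = -1)
    (hf : ∀ᶠ y in 𝓝 x, f y = b + ‖y - c‖ * Complex.exp ((χ + ε * |Θ y - Θ x| : ℝ) * Complex.I)) :
    ∃ a u : ℂ, ‖a‖ = 1 ∧ ‖u‖ = 1 ∧ ((x - c) / u).im = 0 ∧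
      ∀ᶠ y in 𝓝 x, f y = b + a * foldReal ((y - c) / u) := by
  have hεε : (ε : ℂ) * ε = 1 := by rcases hε with rfl | rfl <;> simp
  have hεn : ‖(ε : ℂ)‖ = 1 := by rcases hε with rfl | rfl <;> simp
  have hε0 : (ε : ℂ) ≠ 0 := by rintro h0; simp [h0] at hεn
  have hu0 : d * Complex.exp (Θ x * Complex.I) ≠ 0 := mul_ne_zero h.ne_zero (Complex.exp_ne_zero _)
  refine ⟨ε * Complex.exp (χ * Complex.I), ε * (d * Complex.exp (Θ x * Complex.I)),
    by rw [norm_mul, hεn, Complex.norm_exp_ofReal_mul_I, one_mul],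
    by rw [norm_mul, norm_mul, hεn, Complex.norm_exp_ofReal_mul_I, h.norm_eq_one, one_mul, one_mul],
    ?_, ?_⟩
  · have : (x - c) / (ε * (d * Complex.exp (Θ x * Complex.I))) = ((ε * ‖x - c‖ : ℝ) : ℂ) := by
      rw [div_eq_iff (mul_ne_zero hε0 hu0)]
      conv_lhs => rw [h.sub_eq hx]
      push_cast
      linear_combination -(‖x - c‖ : ℂ) * (d * Complex.exp (Θ x * Complex.I)) * hεε
    rw [this, Complex.ofReal_im]
  · filter_upwards [hf, isOpen_interior.mem_nhds hx, h.eventually_abs_sub_le hx] with y hy hyS hδ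
    rw [hy, h.foldReal_eq hyS hε hδ]
    have e : (((χ + ε * |Θ y - Θ x| : ℝ) : ℂ) * Complex.I) =
        χ * Complex.I + (ε * |Θ y - Θ x| : ℝ) * Complex.I := by push_cast; ring
    rw [e, Complex.exp_add]
    linear_combination -(‖y - c‖ : ℂ) * Complex.exp (χ * Complex.I) *
      Complex.exp ((ε * |Θ y - Θ x| : ℝ) * Complex.I) * hεε

theorem conic_eventually {f : ℂ → ℂ} {b : ℂ} {ψ : ℝ → ℝ} (hf : EqOn f (conic b c Θ ψ) (interior S))
    {x : ℂ} (hx : x ∈ interior S) {k : ℝ → ℝ} (hψ : ∀ᶠ θ in 𝓝 (Θ x), ψ θ = k θ) :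
    ∀ᶠ y in 𝓝 x, f y = b + ‖y - c‖ * Complex.exp (k (Θ y) * Complex.I) := by
  filter_upwards [isOpen_interior.mem_nhds hx, (h.continuousAt hx).tendsto.eventually hψ]
    with y hy hy'
  rw [hf hy, conic, hy']

theorem unfoldedAt_of_isAngularLine {f : ℂ → ℂ} {b : ℂ} {ψ : ℝ → ℝ}
    (hf : EqOn f (conic b c Θ ψ) (interior S)) {x : ℂ} (hx : x ∈ interior S)
    (hψ : IsAngularLine ψ (Θ x)) : UnfoldedAt f x := by
  obtain ⟨ε, hε, hψ⟩ := hψ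
  exact h.unfoldedAt_of_line hx hε
    (h.conic_eventually hf hx (k := fun θ => ψ (Θ x) + ε * (θ - Θ x)) hψ)

theorem foldedAt_of_isAngularFold {f : ℂ → ℂ} {b : ℂ} {ψ : ℝ → ℝ}
    (hf : EqOn f (conic b c Θ ψ) (interior S)) {x : ℂ} (hx : x ∈ interior S)
    (hψ : IsAngularFold ψ (Θ x)) : FoldedAt f x ∧ ¬ UnfoldedAt f x := by
  obtain ⟨ε, hε, hψ⟩ := hψ
  obtain ⟨a, u, ha, hu, him, hev⟩ := h.exists_foldReal_of_fold hx hε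
    (h.conic_eventually hf hx (k := fun θ => ψ (Θ x) + ε * |θ - Θ x|) hψ)
  exact ⟨foldedAt_of_foldReal ha hu hev him, not_unfoldedAt_of_foldReal hu hev him⟩

/-- Near an unfolded point the map is affine in polar coordinates. -/
theorem exists_line_of_unfoldedAt {f : ℂ → ℂ} {x : ℂ} (hx : x ∈ interior S)
    (hf : UnfoldedAt f x) : ∃ (b : ℂ) (χ ε : ℝ), (ε = 1 ∨ ε = -1) ∧
      ∀ᶠ y in 𝓝 x, f y = b + ‖y - c‖ * Complex.exp ((χ + ε * (Θ y - Θ x) : ℝ) * Complex.I) := by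
  obtain ⟨g, hg⟩ := hf
  obtain ⟨a, b, ha, hab | hab⟩ := isometryEquiv_complex_form g
  · obtain ⟨χ, hχ⟩ := exists_exp_eq (a := a * (d * Complex.exp (Θ x * Complex.I)))
      (by rw [norm_mul, norm_mul, ha, h.norm_eq_one, Complex.norm_exp_ofReal_mul_I]; simp)
    refine ⟨b + a * c, χ, 1, .inl rfl, ?_⟩
    filter_upwards [hg, isOpen_interior.mem_nhds hx] with y hy hyS
    have e : (((χ + 1 * (Θ y - Θ x) : ℝ) : ℂ) * Complex.I) =
        χ * Complex.I + (Θ y - Θ x : ℝ) * Complex.I := by push_cast; ring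
    have e2 : Complex.exp (Θ y * Complex.I) =
        Complex.exp (Θ x * Complex.I) * Complex.exp ((Θ y - Θ x : ℝ) * Complex.I) := by
      rw [← Complex.exp_add]; push_cast; ring_nf
    have h1 := h.sub_eq hyS
    rw [e2] at h1
    rw [hy, hab, e, Complex.exp_add, hχ]
    linear_combination a * h1
  · obtain ⟨χ, hχ⟩ := exists_exp_eq
      (a := a * (starRingEnd ℂ) (d * Complex.exp (Θ x * Complex.I)))
      (by rw [norm_mul, Complex.norm_conj, norm_mul, ha, h.norm_eq_one,
        Complex.norm_exp_ofReal_mul_I]; simp)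
    refine ⟨b + a * (starRingEnd ℂ) c, χ, -1, .inr rfl, ?_⟩
    filter_upwards [hg, isOpen_interior.mem_nhds hx] with y hy hyS
    have e : (((χ + -1 * (Θ y - Θ x) : ℝ) : ℂ) * Complex.I) =
        χ * Complex.I + (starRingEnd ℂ) ((Θ y - Θ x : ℝ) * Complex.I) := by
      rw [map_mul, Complex.conj_ofReal, Complex.conj_I]; push_cast; ring
    have e2 : Complex.exp (Θ y * Complex.I) =
        Complex.exp (Θ x * Complex.I) * Complex.exp ((Θ y - Θ x : ℝ) * Complex.I) := by
      rw [← Complex.exp_add]; push_cast; ring_nf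
    have h1 := congrArg (starRingEnd ℂ) (h.sub_eq hyS)
    rw [e2] at h1
    simp only [map_sub, map_mul, Complex.conj_ofReal] at h1 hχ
    rw [hy, hab, e, Complex.exp_add, Complex.exp_conj, hχ]
    linear_combination a * h1

/-- Near a radial fold the map is a fold in polar coordinates. -/
theorem exists_fold_of_foldReal {f : ℂ → ℂ} {x : ℂ} (hx : x ∈ interior S) {a b u : ℂ}
    (ha : ‖a‖ = 1) (hu : ‖u‖ = 1) (him : ((x - c) / u).im = 0)
    (hf : ∀ᶠ y in 𝓝 x, f y = b + a * foldReal ((y - c) / u)) : ∃ χ ε : ℝ, (ε = 1 ∨ ε = -1) ∧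
      ∀ᶠ y in 𝓝 x, f y = b + ‖y - c‖ * Complex.exp ((χ + ε * |Θ y - Θ x| : ℝ) * Complex.I) := by
  have hu0 : u ≠ 0 := by rintro rfl; simp at hu
  have hxn := h.norm_pos hx
  have hxn' : (‖x - c‖ : ℂ) ≠ 0 := by exact_mod_cast hxn.ne'
  set r := ((x - c) / u).re with hr
  have hxu : x - c = r * u := by
    have := eq_of_div_im_eq_zero hu0 him
    linear_combination this
  have hrn : |r| = ‖x - c‖ := by
    rw [hxu, norm_mul, hu, mul_one, Complex.norm_real, Real.norm_eq_abs]
  -- `ε` records whether `u` points away from `c` or towards it.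
  obtain ⟨ε, hε, hrε⟩ : ∃ ε : ℝ, (ε = 1 ∨ ε = -1) ∧ r = ε * ‖x - c‖ := by
    rcases le_total 0 r with h0 | h0
    · exact ⟨1, .inl rfl, by rw [← hrn, abs_of_nonneg h0, one_mul]⟩
    · exact ⟨-1, .inr rfl, by rw [← hrn, abs_of_nonpos h0]; ring⟩
  have hεε : (ε : ℂ) * ε = 1 := by rcases hε with rfl | rfl <;> simp
  have hεn : ‖(ε : ℂ)‖ = 1 := by rcases hε with rfl | rfl <;> simp
  have hue : u = ε * (d * Complex.exp (Θ x * Complex.I)) := by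
    have h1 := h.sub_eq hx
    have h2 : (‖x - c‖ : ℂ) * (ε * u) = ‖x - c‖ * (d * Complex.exp (Θ x * Complex.I)) := by
      rw [← h1]
      conv_rhs => rw [hxu, hrε]
      push_cast
      ring
    rw [← mul_left_cancel₀ hxn' h2]
    linear_combination -u * hεε
  obtain ⟨χ, hχ⟩ := exists_exp_eq (a := ε * a) (by rw [norm_mul, hεn, ha, one_mul])
  refine ⟨χ, ε, hε, ?_⟩
  filter_upwards [hf, isOpen_interior.mem_nhds hx, h.eventually_abs_sub_le hx] with y hy hyS hδ
  have e : (((χ + ε * |Θ y - Θ x| : ℝ) : ℂ) * Complex.I) =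
      χ * Complex.I + (ε * |Θ y - Θ x| : ℝ) * Complex.I := by push_cast; ring
  rw [hy, hue, h.foldReal_eq hyS hε hδ, e, Complex.exp_add, hχ]
  ring

end IsPolarChart

/-! ### From radial folds to a conical folding -/

theorem affine_germ_unique {b b' v v' : ℂ} {l : ℝ}
    (h : ∀ᶠ μ : ℝ in 𝓝 l, b + μ * v = b' + μ * v') : b = b' ∧ v = v' := by
  obtain ⟨ε, hε, hball⟩ := Metric.eventually_nhds_iff_ball.1 h
  have h0 := hball l (Metric.mem_ball_self hε)
  have h1 := hball (l + ε / 2) (by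
    rw [mem_ball_iff_norm, add_sub_cancel_left, Real.norm_of_nonneg] <;> linarith)
  have hε' : ((ε / 2 : ℝ) : ℂ) ≠ 0 := by exact_mod_cast (half_pos hε).ne'
  have hv : v = v' := by
    refine mul_left_cancel₀ hε' ?_
    push_cast at h1 ⊢
    linear_combination h1 - h0
  subst hv
  exact ⟨add_right_cancel h0, rfl⟩

/-- Affine germs are locally constant along the connected half-open interval, so `g` is affine
there; continuity at 0 identifies the constant term. -/
theorem affine_on_ray {g : ℝ → ℂ} (hg : ContinuousOn g (Icc 0 1))
    (hloc : ∀ l ∈ Ioc (0 : ℝ) 1, ∃ b v : ℂ, ∀ᶠ μ : ℝ in 𝓝 l, g μ = b + μ * v)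
    {b v : ℂ} (h1 : ∀ᶠ μ : ℝ in 𝓝 1, g μ = b + μ * v) :
    b = g 0 ∧ ∀ l ∈ Ioc (0 : ℝ) 1, g l = g 0 + l * (g 1 - g 0) := by
  choose! B V hBV using hloc
  have hone : (1 : ℝ) ∈ Ioc (0 : ℝ) 1 := by simp
  have hconst : ∀ l ∈ Ioc (0 : ℝ) 1, B l = B 1 ∧ V l = V 1 := by
    intro l hl
    refine isPreconnected_Ioc.induction₂ (fun l μ => B l = B μ ∧ V l = V μ) (fun l hl => ?_)
      (fun _ _ _ _ _ _ h h' => ⟨h.1.trans h'.1, h.2.trans h'.2⟩)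
      (fun _ _ _ _ h => ⟨h.1.symm, h.2.symm⟩) hl hone
    filter_upwards [self_mem_nhdsWithin, nhdsWithin_le_nhds (hBV l hl).eventually_nhds] with μ hμ h
    refine affine_germ_unique (l := μ) ?_
    filter_upwards [h, hBV μ hμ] with ν h1 h2
    rw [← h1, h2]
  have hb : B 1 = b ∧ V 1 = v := affine_germ_unique (l := 1) (by
    filter_upwards [h1, hBV 1 hone] with ν h1 h2
    rw [← h1, h2])
  have hval : ∀ l ∈ Ioc (0 : ℝ) 1, g l = b + l * v := fun l hl => by
    rw [(hBV l hl).self_of_nhds, (hconst l hl).1, (hconst l hl).2, hb.1, hb.2]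
  have h0 : b = g 0 := by
    have ht : Tendsto g (𝓝[Ioc 0 1] 0) (𝓝 (g 0)) :=
      (hg 0 (by simp)).mono_left (nhdsWithin_mono _ Ioc_subset_Icc_self)
    have ht' : Tendsto (fun l : ℝ => b + l * v) (𝓝[Ioc 0 1] 0) (𝓝 b) := by
      have : Continuous fun l : ℝ => b + l * v := by fun_prop
      simpa using (this.tendsto 0).mono_left nhdsWithin_le_nhds
    have hne : (𝓝[Ioc (0 : ℝ) 1] 0).NeBot := by
      rw [← mem_closure_iff_nhdsWithin_neBot, closure_Ioc one_ne_zero.symm]; simp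
    refine tendsto_nhds_unique (ht'.congr' ?_) ht
    filter_upwards [self_mem_nhdsWithin] with l hl
    exact (hval l hl).symm
  refine ⟨h0, fun l hl => ?_⟩
  rw [hval l hl, hval 1 hone, ← h0]
  push_cast
  ring

/-- Continuous choice of an argument along an interval. -/
theorem exists_angle_lift {I : Set ℝ} (hI : IsOpen I) (hI' : OrdConnected I) {G : ℝ → ℂ}
    (hG : ContinuousOn G I) (hn : ∀ θ ∈ I, ‖G θ‖ = 1) :
    ∃ φ : ℝ → ℝ, ContinuousOn φ I ∧ ∀ θ ∈ I, Complex.exp (φ θ * Complex.I) = G θ := by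
  rcases I.eq_empty_or_nonempty with rfl | ⟨θ₀, hθ₀⟩
  · exact ⟨0, continuousOn_empty _, by simp⟩
  -- The lifting theorem for the covering `Circle.exp` uses these two properties of `I`.
  have : ContractibleSpace I := hI'.convex.contractibleSpace ⟨θ₀, hθ₀⟩
  have : LocallyPathConnectedSpace I := hI.locallyPathConnectedSpace
  let g : C(I, Circle) := ⟨fun θ => ⟨G θ, mem_sphere_zero_iff_norm.2 (hn θ θ.2)⟩,
    (continuousOn_iff_continuous_domRestrict.1 hG).subtype_mk _⟩
  obtain ⟨χ, hχ⟩ := exists_exp_eq (hn θ₀ hθ₀)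
  obtain ⟨F, ⟨-, hF⟩, -⟩ := Circle.isCoveringMap_exp.existsUnique_continuousMap_lifts g
    ⟨θ₀, hθ₀⟩ χ (Subtype.ext (by change _ = G θ₀; simpa using hχ))
  classical
  refine ⟨fun θ => if h : θ ∈ I then F ⟨θ, h⟩ else 0, ?_, fun θ hθ => ?_⟩
  · rw [continuousOn_iff_continuous_domRestrict]
    convert F.continuous using 1
    ext θ
    simp [θ.2]
  · have := congrArg (fun z : Circle => (z : ℂ)) (congrFun hF ⟨θ, hθ⟩)
    simp only [dif_pos hθ]
    rw [← Circle.coe_exp]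
    exact this

/-- Even at a fold there is a right derivative, and it is 1 or -1; the mean value inequality needs
only right derivatives. -/
theorem lipschitzOnWith_of_angular {I : Set ℝ} (hI : OrdConnected I) {φ : ℝ → ℝ}
    (h : ∀ θ ∈ I, IsAngularLine φ θ ∨ IsAngularFold φ θ) : LipschitzOnWith 1 φ I := by
  have hder : ∀ θ ∈ I, ∃ ε : ℝ, |ε| ≤ 1 ∧ HasDerivWithinAt φ ε (Ici θ) θ := by
    intro θ hθ
    have key : ∀ ε : ℝ, HasDerivWithinAt (fun θ' => φ θ + ε * (θ' - θ)) ε (Ici θ) θ := fun ε => by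
      have := (((hasDerivWithinAt_id θ (Ici θ)).sub_const θ).const_mul ε).const_add (φ θ)
      simpa using this
    have habs : ∀ ε : ℝ, (ε = 1 ∨ ε = -1) → |ε| ≤ 1 := by rintro ε (rfl | rfl) <;> simp
    rcases h θ hθ with ⟨ε, hε, hev⟩ | ⟨ε, hε, hev⟩
    · exact ⟨ε, habs ε hε, (key ε).congr_of_eventuallyEq (nhdsWithin_le_nhds hev)
        hev.self_of_nhds⟩
    · refine ⟨ε, habs ε hε, (key ε).congr_of_eventuallyEq ?_ (by simp)⟩
      filter_upwards [nhdsWithin_le_nhds hev, self_mem_nhdsWithin] with θ' h1 h2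
      rw [h1, abs_of_nonneg (sub_nonneg.2 h2)]
  have hcont : ∀ θ ∈ I, ContinuousAt φ θ := by
    intro θ hθ
    rcases h θ hθ with ⟨ε, -, hev⟩ | ⟨ε, -, hev⟩
    · exact ContinuousAt.congr (f := fun θ' => φ θ + ε * (θ' - θ)) (by fun_prop)
        (hev.mono fun _ h => h.symm)
    · exact ContinuousAt.congr (f := fun θ' => φ θ + ε * |θ' - θ|)
        (Continuous.continuousAt (by fun_prop)) (hev.mono fun _ h => h.symm)
  choose! D hD1 hD using hder
  have hle : ∀ x ∈ I, ∀ y ∈ I, x ≤ y → |φ y - φ x| ≤ y - x := by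
    intro x hx y hy hxy
    have hsub := hI.out hx hy
    have := norm_image_sub_le_of_norm_deriv_right_le_segment (f := φ) (f' := D) (C := 1)
      (fun z hz => (hcont z (hsub hz)).continuousWithinAt)
      (fun z hz => hD z (hsub (Ico_subset_Icc_self hz)))
      (fun z hz => hD1 z (hsub (Ico_subset_Icc_self hz))) y (right_mem_Icc.2 hxy)
    simpa using this
  refine LipschitzOnWith.of_dist_le_mul fun x hx y hy => ?_
  rw [NNReal.coe_one, one_mul, Real.dist_eq, Real.dist_eq]
  rcases le_total x y with hxy | hxy
  · rw [abs_sub_comm, abs_sub_comm x y, abs_of_nonneg (sub_nonneg.2 hxy)]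
    exact hle x hx y hy hxy
  · rw [abs_of_nonneg (sub_nonneg.2 hxy)]
    exact hle y hy x hx hxy

theorem IsAngularLine.congr {φ ψ : ℝ → ℝ} {θ : ℝ} (h : IsAngularLine φ θ) (h' : ψ =ᶠ[𝓝 θ] φ) :
    IsAngularLine ψ θ := by
  obtain ⟨ε, hε, hev⟩ := h
  refine ⟨ε, hε, ?_⟩
  filter_upwards [hev, h'] with θ' h1 h2
  rw [h2, h1, h'.self_of_nhds]

theorem IsAngularFold.congr {φ ψ : ℝ → ℝ} {θ : ℝ} (h : IsAngularFold φ θ) (h' : ψ =ᶠ[𝓝 θ] φ) :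
    IsAngularFold ψ θ := by
  obtain ⟨ε, hε, hev⟩ := h
  refine ⟨ε, hε, ?_⟩
  filter_upwards [hev, h'] with θ' h1 h2
  rw [h2, h1, h'.self_of_nhds]

/-- All folds run along rays from `c`. -/
def IsRadial (S : Set ℂ) (c : ℂ) (f : ℂ → ℂ) : Prop :=
  ∀ x ∈ foldSet S f, ∀ᶠ ε : ℝ in 𝓝 0, c + (1 + ε) * (x - c) ∈ foldSet S f

/-- Two continuous lifts of the same map to the circle that agree at `θ₀` agree nearby, since they
could only differ by multiples of 2π. -/
theorem eq_of_angle_lift {φ k : ℝ → ℝ} {θ₀ χ : ℝ} (hφ : ContinuousAt φ θ₀) (hk : ContinuousAt k θ₀)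
    (h0 : k θ₀ = 0) (h : ∀ᶠ θ in 𝓝 θ₀, Complex.exp (φ θ * Complex.I) =
      Complex.exp ((χ + k θ : ℝ) * Complex.I)) : ∀ᶠ θ in 𝓝 θ₀, φ θ = φ θ₀ + k θ := by
  have hc : ContinuousAt (fun θ => |φ θ - (φ θ₀ + k θ)|) θ₀ :=
    (hφ.sub (continuousAt_const.add hk)).abs
  have hlt : ∀ᶠ θ in 𝓝 θ₀, |φ θ - (φ θ₀ + k θ)| < 2 * Real.pi :=
    hc.eventually_lt_const (by simpa [h0] using Real.two_pi_pos)
  have h1 := h.self_of_nhds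
  rw [h0, add_zero] at h1
  filter_upwards [h, hlt] with θ h2 h3
  refine eq_of_exp_mul_I_eq ?_ h3
  rw [h2]
  push_cast
  rw [add_mul, add_mul, Complex.exp_add, Complex.exp_add, h1]

namespace IsPolarChart

variable {S : Set ℂ} {c d : ℂ} {Θ : ℂ → ℝ}

theorem exists_angular_form (h : IsPolarChart S c d Θ) {f : ℂ → ℂ} (hf : IsFlatFolding S f)
    (hr : IsRadial S c f) {x : ℂ} (hx : x ∈ interior S) :
    ∃ (b : ℂ) (χ : ℝ) (k : ℝ → ℝ), (∃ ε : ℝ, (ε = 1 ∨ ε = -1) ∧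
      (k = (fun θ => ε * (θ - Θ x)) ∨ k = fun θ => ε * |θ - Θ x|)) ∧
      ∀ᶠ y in 𝓝 x, f y = b + ‖y - c‖ * Complex.exp ((χ + k (Θ y) : ℝ) * Complex.I) := by
  by_cases hu : UnfoldedAt f x
  · obtain ⟨b, χ, ε, hε, hev⟩ := h.exists_line_of_unfoldedAt hx hu
    exact ⟨b, χ, _, ⟨ε, hε, .inl rfl⟩, hev⟩
  obtain ⟨a, b, u, ha, hu1, hev⟩ :=
    ((hf.unfoldedAt_or_foldedAt x hx).resolve_left hu).exists_foldReal
  -- A second fold point on the ray through `x`, close to `x`, forces the crease to run along the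
  -- ray.
  have him : ((x - c) / u).im = 0 := by
    have ht : Tendsto (fun ε : ℝ => c + (1 + ε) * (x - c)) (𝓝 0) (𝓝 x) := by
      have : Continuous fun ε : ℝ => c + (1 + ε) * (x - c) := by fun_prop
      simpa using this.tendsto 0
    have h1 := (ht.eventually hev.eventually_nhds).and (hr x ⟨hx, hu⟩)
    obtain ⟨δ, hδ, hball⟩ := Metric.eventually_nhds_iff_ball.1 h1
    obtain ⟨h2, h3⟩ := hball (δ / 2) (by
      rw [mem_ball_zero_iff, Real.norm_of_nonneg] <;> linarith)
    have h4 := (unfoldedAt_iff_of_foldReal ha hu1 h2).not_left.1 h3.2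
    have e : (c + (1 + ((δ / 2 : ℝ) : ℂ)) * (x - c) - x) / u = (δ / 2 : ℝ) * ((x - c) / u) := by
      ring
    rw [e, Complex.im_ofReal_mul] at h4
    exact (mul_eq_zero.1 h4).resolve_left (half_pos hδ).ne'
  obtain ⟨r, hr'⟩ : ∃ r : ℝ, (c - x) / u = r := by
    refine ⟨((c - x) / u).re, Complex.ext rfl ?_⟩
    have : (c - x) / u = -((x - c) / u) := by ring
    rw [this, Complex.neg_im, him, Complex.ofReal_im, neg_zero]
  obtain ⟨χ, ε, hε, hev'⟩ := h.exists_fold_of_foldReal (f := f) (b := b + a * r) hx ha hu1 him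
    (hev.mono fun y hy => by
      have e : (y - x) / u = (y - c) / u + r := by rw [← hr']; ring
      rw [hy, e, foldReal_add_ofReal]; ring)
  exact ⟨b + a * r, χ, _, ⟨ε, hε, .inr rfl⟩, hev'⟩

/-- The angle is constant on a ray, so the local polar forms are affine in the radius, and
`affine_on_ray` follows them down to `c`. All of them thus have the same apex `f c`. -/
theorem homogeneous (h : IsPolarChart S c d Θ) (hc : c ∈ S) {f : ℂ → ℂ} (hf : IsFlatFolding S f)
    (hr : IsRadial S c f) {x : ℂ} (hx : x ∈ interior S) {b : ℂ} {χ : ℝ} {k : ℝ → ℝ}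
    (hev : ∀ᶠ y in 𝓝 x, f y = b + ‖y - c‖ * Complex.exp ((χ + k (Θ y) : ℝ) * Complex.I)) :
    b = f c ∧ ∀ l ∈ Ioc (0 : ℝ) 1, f (c + l * (x - c)) = f c + l * (f x - f c) := by
  have hcont : Continuous fun l : ℝ => c + l * (x - c) := by fun_prop
  have hmaps : MapsTo (fun l : ℝ => c + l * (x - c)) (Icc 0 1) S := by
    intro l hl
    rcases hl.1.eq_or_lt with rfl | h0
    · simpa using hc
    · exact interior_subset (h.star x hx l ⟨h0, hl.2⟩)
  have key : ∀ l ∈ Ioc (0 : ℝ) 1, ∀ (b : ℂ) (χ : ℝ) (k : ℝ → ℝ),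
      (∀ᶠ y in 𝓝 (c + l * (x - c)), f y =
        b + ‖y - c‖ * Complex.exp ((χ + k (Θ y) : ℝ) * Complex.I)) →
      ∀ᶠ μ : ℝ in 𝓝 l, f (c + μ * (x - c)) =
        b + μ * (‖x - c‖ * Complex.exp ((χ + k (Θ x) : ℝ) * Complex.I)) := by
    intro l hl b χ k hev
    have hxl := h.star x hx l hl
    filter_upwards [(hcont.tendsto l).eventually hev, Ioi_mem_nhds hl.1,
      hcont.continuousAt.preimage_mem_nhds (isOpen_interior.mem_nhds hxl)] with μ h1 h2 h3
    have hμ : Θ (c + μ * (x - c)) = Θ x := by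
      have e : c + μ * (x - c) = polarPoint c d (μ * ‖x - c‖) (Θ x) := by
        rw [← polarPoint_star, h.polar x (h.mem_diff hx)]
      change c + μ * (x - c) ∈ interior S at h3
      rw [e] at h3 ⊢
      exact h.angle_polarPoint (mul_pos h2 (h.norm_pos hx)) (h.abs_lt x hx) h3
    rw [h1, hμ, add_sub_cancel_left, norm_mul, Complex.norm_real,
      Real.norm_of_nonneg (le_of_lt h2)]
    push_cast
    ring
  have hray := affine_on_ray (g := fun l : ℝ => f (c + l * (x - c)))
    (hf.continuousOn.comp hcont.continuousOn hmaps) (fun l hl => by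
      obtain ⟨b, χ, k, -, hev⟩ := h.exists_angular_form hf hr (h.star x hx l hl)
      exact ⟨b, _, key l hl b χ k hev⟩)
    (key 1 (by simp) b χ k (by simpa using hev))
  simpa using hray

/-- By homogeneity the direction of `f x - f c` depends on the angle of `x` only; φ is a continuous
lift of this direction, and the local polar forms give its slopes. It is extended to a 1-Lipschitz
function on the line, so that formulas in φ make sense and are continuous up to the boundary of the
paper. -/
theorem exists_conic (h : IsPolarChart S c d Θ) (hc : c ∈ S) (hS : IsPreconnected (interior S))
    {f : ℂ → ℂ} (hf : IsFlatFolding S f) (hr : IsRadial S c f) :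
    ∃ φ : ℝ → ℝ, LipschitzWith 1 φ ∧
      (∀ θ ∈ Θ '' interior S, IsAngularLine φ θ ∨ IsAngularFold φ θ) ∧
      EqOn f (conic (f c) c Θ φ) (interior S) := by
  have hI := h.isOpen_angles
  have hI' := h.ordConnected_angles hS
  set G : ℂ → ℂ := fun x => (f x - f c) / ‖x - c‖ with hG
  have hG1 : ∀ x ∈ interior S, ∀ l ∈ Ioc (0 : ℝ) 1, G (c + l * (x - c)) = G x := by
    intro x hx l hl
    obtain ⟨b, χ, k, -, hev⟩ := h.exists_angular_form hf hr hx
    have hl0 : (l : ℂ) ≠ 0 := by exact_mod_cast hl.1.ne'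
    simp only [hG]
    rw [(h.homogeneous hc hf hr hx hev).2 l hl, add_sub_cancel_left, add_sub_cancel_left, norm_mul,
      Complex.norm_real, Real.norm_of_nonneg hl.1.le, Complex.ofReal_mul,
      mul_div_mul_left _ _ hl0]
  have hG2 : ∀ x ∈ interior S, ∀ y ∈ interior S, Θ x = Θ y → G x = G y := by
    have hwlog : ∀ x ∈ interior S, ∀ y ∈ interior S, Θ x = Θ y → ‖x - c‖ ≤ ‖y - c‖ → G x = G y := by
      intro x hx y hy hxy hle
      have hny := h.norm_pos hy
      have e : x = c + ((‖x - c‖ / ‖y - c‖ : ℝ) : ℂ) * (y - c) := by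
        conv_rhs => rw [← h.polar y (h.mem_diff hy)]
        rw [polarPoint_star, norm_polarPoint_sub h.norm_eq_one (norm_nonneg _),
          div_mul_cancel₀ _ hny.ne', ← hxy, h.polar x (h.mem_diff hx)]
      rw [e]
      exact hG1 y hy _ ⟨div_pos (h.norm_pos hx) hny, (div_le_one hny).2 hle⟩
    intro x hx y hy hxy
    rcases le_total ‖x - c‖ ‖y - c‖ with hle | hle
    · exact hwlog x hx y hy hxy hle
    · exact (hwlog y hy x hx hxy.symm hle).symm
  have hsec : ∀ θ ∈ Θ '' interior S, ∃ x ∈ interior S, Θ x = θ := fun θ hθ => hθ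
  choose! X hXS hXθ using hsec
  -- the angular function, locally
  have hloc : ∀ θ₀ ∈ Θ '' interior S, ∃ (χ : ℝ) (k : ℝ → ℝ), (∃ ε : ℝ, (ε = 1 ∨ ε = -1) ∧
      (k = (fun θ => ε * (θ - θ₀)) ∨ k = fun θ => ε * |θ - θ₀|)) ∧
      ∀ᶠ θ in 𝓝 θ₀, G (X θ) = Complex.exp ((χ + k θ : ℝ) * Complex.I) := by
    intro θ₀ hθ₀
    obtain ⟨b, χ, k, hk, hev⟩ := h.exists_angular_form hf hr (hXS θ₀ hθ₀)
    rw [hXθ θ₀ hθ₀] at hk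
    refine ⟨χ, k, hk, ?_⟩
    have hb := (h.homogeneous hc hf hr (hXS θ₀ hθ₀) hev).1
    set ρ := ‖X θ₀ - c‖ with hρ
    have hρ0 : 0 < ρ := h.norm_pos (hXS θ₀ hθ₀)
    have hpt : polarPoint c d ρ θ₀ = X θ₀ := by
      have := h.polar _ (h.mem_diff (hXS θ₀ hθ₀))
      rwa [hXθ θ₀ hθ₀] at this
    have hcont : Tendsto (fun θ => polarPoint c d ρ θ) (𝓝 θ₀) (𝓝 (X θ₀)) := by
      rw [← hpt]
      exact ((continuous_polarPoint c d).comp (continuous_const.prodMk continuous_id)).tendsto θ₀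
    filter_upwards [hI.mem_nhds hθ₀, hcont.eventually hev,
      hcont.eventually (isOpen_interior.mem_nhds (hXS θ₀ hθ₀))] with θ hθ h1 h2
    have hang := h.angle_polarPoint hρ0 (h.abs_lt_of_mem hθ) h2
    have hρ' : (ρ : ℂ) ≠ 0 := by exact_mod_cast hρ0.ne'
    rw [hG2 _ (hXS θ hθ) _ h2 ((hXθ θ hθ).trans hang.symm)]
    simp only [hG]
    rw [h1, hang, hb, norm_polarPoint_sub h.norm_eq_one hρ0.le, add_sub_cancel_left,
      mul_div_cancel_left₀ _ hρ']
  have hkc : ∀ {θ₀ : ℝ} {k : ℝ → ℝ}, (∃ ε : ℝ, (ε = 1 ∨ ε = -1) ∧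
      (k = (fun θ => ε * (θ - θ₀)) ∨ k = fun θ => ε * |θ - θ₀|)) → Continuous k ∧ k θ₀ = 0 := by
    rintro θ₀ k ⟨ε, -, rfl | rfl⟩
    · exact ⟨by fun_prop, by simp⟩
    · exact ⟨by fun_prop, by simp⟩
  have hGX : ContinuousOn (fun θ => G (X θ)) (Θ '' interior S) := by
    intro θ₀ hθ₀
    obtain ⟨χ, k, hk, hev⟩ := hloc θ₀ hθ₀
    have hkc' := (hkc hk).1
    refine (ContinuousAt.congr (f := fun θ => Complex.exp ((χ + k θ : ℝ) * Complex.I))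
      (Continuous.continuousAt (by fun_prop)) (hev.mono fun _ h => h.symm)).continuousWithinAt
  have hGn : ∀ θ ∈ Θ '' interior S, ‖G (X θ)‖ = 1 := by
    intro θ hθ
    obtain ⟨χ, k, hk, hev⟩ := hloc θ hθ
    rw [hev.self_of_nhds, Complex.norm_exp_ofReal_mul_I]
  obtain ⟨φ, hφc, hφ⟩ := exists_angle_lift hI hI' hGX hGn
  have hang : ∀ θ ∈ Θ '' interior S, IsAngularLine φ θ ∨ IsAngularFold φ θ := by
    intro θ₀ hθ₀
    obtain ⟨χ, k, hk, hev⟩ := hloc θ₀ hθ₀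
    obtain ⟨hk1, hk2⟩ := hkc hk
    have := eq_of_angle_lift (hφc.continuousAt (hI.mem_nhds hθ₀)) hk1.continuousAt hk2 (χ := χ) (by
      filter_upwards [hev, hI.mem_nhds hθ₀] with θ h1 h2
      rw [hφ θ h2, h1])
    obtain ⟨ε, hε, rfl | rfl⟩ := hk
    · exact .inl ⟨ε, hε, this⟩
    · exact .inr ⟨ε, hε, this⟩
  obtain ⟨ψ, hψ, hψφ⟩ := (lipschitzOnWith_of_angular hI' hang).extend_real
  have hψev : ∀ θ ∈ Θ '' interior S, ψ =ᶠ[𝓝 θ] φ := fun θ hθ => by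
    filter_upwards [hI.mem_nhds hθ] with θ' h'
    exact (hψφ h').symm
  refine ⟨ψ, hψ, fun θ hθ => (hang θ hθ).imp (fun h => h.congr (hψev θ hθ))
    fun h => h.congr (hψev θ hθ), fun x hx => ?_⟩
  have hx' : Θ x ∈ Θ '' interior S := ⟨x, hx, rfl⟩
  have hn : (‖x - c‖ : ℂ) ≠ 0 := by exact_mod_cast (h.norm_pos hx).ne'
  rw [conic, ← hψφ hx', hφ _ hx', hG2 _ (hXS _ hx') x hx (hXθ _ hx')]
  simp only [hG]
  rw [mul_div_cancel₀ _ hn]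
  ring

end IsPolarChart

/-! ### Unfolding a conical folding by opening the angles -/

/-- The stacking order of the rays of a conical folding. -/
def angularOrder (S : Set ℂ) (c d : ℂ) (above : ℂ → ℂ → Prop) (θ θ' : ℝ) : Prop :=
  ∃ ρ : ℝ, 0 < ρ ∧ polarPoint c d ρ θ ∈ interior S ∧ polarPoint c d ρ θ' ∈ interior S ∧
    above (polarPoint c d ρ θ) (polarPoint c d ρ θ')

/-- The angle folding `φ`, slowed down about `θ₀` by the factor `τ`. -/
noncomputable def angularZoom (φ : ℝ → ℝ) (θ₀ τ θ : ℝ) : ℝ := φ (θ₀ + τ * (θ - θ₀)) / τ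

theorem tendsto_angularZoom (θ₀ τ θ : ℝ) :
    Tendsto (fun θ => θ₀ + τ * (θ - θ₀)) (𝓝 θ) (𝓝 (θ₀ + τ * (θ - θ₀))) :=
  (by fun_prop : Continuous fun θ => θ₀ + τ * (θ - θ₀)).tendsto θ

theorem IsAngularLine.zoom {φ : ℝ → ℝ} {θ₀ τ θ : ℝ} (hτ : 0 < τ)
    (h : IsAngularLine φ (θ₀ + τ * (θ - θ₀))) : IsAngularLine (angularZoom φ θ₀ τ) θ := by
  obtain ⟨ε, hε, h⟩ := h
  refine ⟨ε, hε, ((tendsto_angularZoom θ₀ τ θ).eventually h).mono fun θ' h' => ?_⟩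
  rw [angularZoom, angularZoom, h']
  field_simp
  ring

theorem IsAngularFold.zoom {φ : ℝ → ℝ} {θ₀ τ θ : ℝ} (hτ : 0 < τ)
    (h : IsAngularFold φ (θ₀ + τ * (θ - θ₀))) : IsAngularFold (angularZoom φ θ₀ τ) θ := by
  obtain ⟨ε, hε, h⟩ := h
  refine ⟨ε, hε, ((tendsto_angularZoom θ₀ τ θ).eventually h).mono fun θ' h' => ?_⟩
  have e : θ₀ + τ * (θ' - θ₀) - (θ₀ + τ * (θ - θ₀)) = τ * (θ' - θ) := by ring
  rw [angularZoom, angularZoom, h', e, abs_mul, abs_of_pos hτ]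
  field_simp

theorem abs_angularZoom_sub_le {φ : ℝ → ℝ} (hφ : LipschitzWith 1 φ) {τ : ℝ} (hτ : 0 < τ)
    (θ₀ θ θ' : ℝ) : |angularZoom φ θ₀ τ θ - angularZoom φ θ₀ τ θ'| ≤ |θ - θ'| := by
  have h := hφ.dist_le_mul (θ₀ + τ * (θ - θ₀)) (θ₀ + τ * (θ' - θ₀))
  have e : θ₀ + τ * (θ - θ₀) - (θ₀ + τ * (θ' - θ₀)) = τ * (θ - θ') := by ring
  rw [Real.dist_eq, Real.dist_eq, NNReal.coe_one, one_mul, e, abs_mul, abs_of_pos hτ] at h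
  rw [angularZoom, angularZoom, ← sub_div, abs_div, abs_of_pos hτ, div_le_iff₀ hτ]
  linarith

namespace IsPolarChart

variable {S : Set ℂ} {c d : ℂ} {Θ : ℂ → ℝ}

theorem conic_polarPoint (h : IsPolarChart S c d Θ) {f : ℂ → ℂ} {b : ℂ} {φ : ℝ → ℝ}
    (heq : EqOn f (conic b c Θ φ) (interior S)) {ρ θ : ℝ} (hρ : 0 < ρ) (hθ : |θ| < Real.pi)
    (hmem : polarPoint c d ρ θ ∈ interior S) :
    f (polarPoint c d ρ θ) = b + ρ * Complex.exp (φ θ * Complex.I) := by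
  rw [heq hmem, conic, h.angle_polarPoint hρ hθ hmem, norm_polarPoint_sub h.norm_eq_one hρ.le]

theorem norm_eq_of_conic_eq {b : ℂ} {φ : ℝ → ℝ} {x y : ℂ}
    (hxy : conic b c Θ φ x = conic b c Θ φ y) : ‖x - c‖ = ‖y - c‖ := by
  have h1 := congrArg norm (add_left_cancel hxy)
  simpa [Complex.norm_exp_ofReal_mul_I] using h1

theorem angle_ne (h : IsPolarChart S c d Θ) {x y : ℂ} (hx : x ∈ interior S) (hy : y ∈ interior S)
    (hn : ‖x - c‖ = ‖y - c‖) (hxy : x ≠ y) : Θ x ≠ Θ y := fun he =>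
  hxy (by rw [← h.polar x (h.mem_diff hx), hn, he, h.polar y (h.mem_diff hy)])

/-- Angles in the paper differ by less than 2π and φ does not increase differences, so the image
never wraps around: equal images force equal values of φ, not just equality modulo 2π. -/
theorem angle_eq_of_conic_eq (h : IsPolarChart S c d Θ) {b : ℂ} {φ : ℝ → ℝ}
    (hφ : ∀ θ θ', |φ θ - φ θ'| ≤ |θ - θ'|) {x y : ℂ} (hx : x ∈ interior S) (hy : y ∈ interior S)
    (hxy : conic b c Θ φ x = conic b c Θ φ y) : φ (Θ x) = φ (Θ y) := by
  have hn := norm_eq_of_conic_eq hxy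
  have hn' : (‖y - c‖ : ℂ) ≠ 0 := by exact_mod_cast (h.norm_pos hy).ne'
  simp only [conic, hn] at hxy
  refine eq_of_exp_mul_I_eq (mul_left_cancel₀ hn' (add_left_cancel hxy)) ?_
  refine (hφ _ _).trans_lt ?_
  have h1 := h.abs_lt x hx
  have h2 := h.abs_lt y hy
  rw [_root_.abs_lt] at h1 h2 ⊢
  constructor <;> linarith [h1.1, h1.2, h2.1, h2.2]

section Order

variable {f : ℂ → ℂ} {b : ℂ} {φ : ℝ → ℝ} {above : ℂ → ℂ → Prop}

theorem contact_polarPoint (h : IsPolarChart S c d Θ)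
    (heq : EqOn f (conic b c Θ φ) (interior S)) {θ θ' : ℝ}
    (hθ : LayerContact {θ ∈ Θ '' interior S | IsAngularLine φ θ} φ θ θ') {ρ : ℝ} (hρ : 0 < ρ)
    (h1 : polarPoint c d ρ θ ∈ interior S) (h2 : polarPoint c d ρ θ' ∈ interior S) :
    Contact S f (polarPoint c d ρ θ) (polarPoint c d ρ θ') := by
  obtain ⟨⟨hI, hl⟩, ⟨hI', hl'⟩, hne, he⟩ := hθ
  have a1 := h.angle_polarPoint hρ (h.abs_lt_of_mem hI) h1
  have a2 := h.angle_polarPoint hρ (h.abs_lt_of_mem hI') h2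
  refine ⟨⟨h1, h.unfoldedAt_of_isAngularLine heq h1 (by rwa [a1])⟩,
    ⟨h2, h.unfoldedAt_of_isAngularLine heq h2 (by rwa [a2])⟩, fun heq' => hne ?_, ?_⟩
  · rw [← a1, heq', a2]
  · rw [h.conic_polarPoint heq hρ (h.abs_lt_of_mem hI) h1,
      h.conic_polarPoint heq hρ (h.abs_lt_of_mem hI') h2, he]

/-- The radii at which both points lie in the interior form an interval, and consistency makes the
order constant along it. So the radius in `angularOrder` does not matter. -/
theorem angularOrder_iff (h : IsPolarChart S c d Θ)
    (heq : EqOn f (conic b c Θ φ) (interior S)) (ha : IsStackingOrder S f above) {θ θ' : ℝ}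
    (hθ : LayerContact {θ ∈ Θ '' interior S | IsAngularLine φ θ} φ θ θ') {ρ : ℝ} (hρ : 0 < ρ)
    (h1 : polarPoint c d ρ θ ∈ interior S) (h2 : polarPoint c d ρ θ' ∈ interior S) :
    angularOrder S c d above θ θ' ↔ above (polarPoint c d ρ θ) (polarPoint c d ρ θ') := by
  refine ⟨fun ⟨ρ', hρ', h1', h2', hab⟩ => ?_, fun hab => ⟨ρ, hρ, h1, h2, hab⟩⟩
  set J : Set ℝ := {ρ | 0 < ρ ∧ polarPoint c d ρ θ ∈ interior S ∧
    polarPoint c d ρ θ' ∈ interior S} with hJ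
  have hJc : IsPreconnected J := by
    refine isPreconnected_iff_ordConnected.2 ⟨?_⟩
    rintro r ⟨hr, -, -⟩ r' ⟨-, hr1, hr2⟩ s hs
    have hs0 : 0 < s := hr.trans_le hs.1
    exact ⟨hs0, h.polarPoint_mem hr1 hs0 hs.2, h.polarPoint_mem hr2 hs0 hs.2⟩
  refine (hJc.induction₂ (fun r s => above (polarPoint c d r θ) (polarPoint c d r θ') ↔
    above (polarPoint c d s θ) (polarPoint c d s θ')) (fun r hr => ?_)
    (fun _ _ _ _ _ _ h h' => h.trans h') (fun _ _ _ _ h => h.symm) (x := ρ') (y := ρ)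
    ⟨hρ', h1', h2'⟩ ⟨hρ, h1, h2⟩).1 hab
  have hc : ∀ θ, Continuous fun r => polarPoint c d r θ := fun θ =>
    (continuous_polarPoint c d).comp (continuous_id.prodMk continuous_const)
  have ht : Tendsto (fun s => (polarPoint c d s θ, polarPoint c d s θ')) (𝓝 r)
      (𝓝 (polarPoint c d r θ, polarPoint c d r θ')) := ((hc θ).prodMk (hc θ')).tendsto r
  filter_upwards [self_mem_nhdsWithin, nhdsWithin_le_nhds (ht.eventually
    (ha.consistent _ _ (h.contact_polarPoint heq hθ hr.1 hr.2.1 hr.2.2)))] with s hs hev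
  exact (hev (h.contact_polarPoint heq hθ hs.1 hs.2.1 hs.2.2)).symm

/-- There need not be one radius that works for all angles. But the axioms involve at most three
angles at a time, and by star-shapedness three angles have a common radius, at which the order is
pulled back from the paper by the circular arc. -/
theorem layerOrder_angular (h : IsPolarChart S c d Θ)
    (heq : EqOn f (conic b c Θ φ) (interior S)) (ha : IsStackingOrder S f above) :
    LayerOrder {θ ∈ Θ '' interior S | IsAngularLine φ θ}
      {θ ∈ Θ '' interior S | IsAngularFold φ θ} φ (angularOrder S c d above) := by
  refine .of_local fun x hx y hy z hz => ?_
  have hI : ∀ {θ}, θ ∈ {θ ∈ Θ '' interior S | IsAngularLine φ θ} ∪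
      {θ ∈ Θ '' interior S | IsAngularFold φ θ} → θ ∈ Θ '' interior S := by
    rintro θ (hθ | hθ)
    exacts [hθ.1, hθ.1]
  obtain ⟨r₁, hr₁, h₁⟩ := h.exists_polarPoint_mem (hI hx)
  obtain ⟨r₂, hr₂, h₂⟩ := h.exists_polarPoint_mem (hI hy)
  obtain ⟨r₃, hr₃, h₃⟩ := h.exists_polarPoint_mem (hI hz)
  set ρ := min r₁ (min r₂ r₃) with hρdef
  have hρ : 0 < ρ := lt_min hr₁ (lt_min hr₂ hr₃)
  have hc : Continuous fun θ => polarPoint c d ρ θ :=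
    (continuous_polarPoint c d).comp (continuous_const.prodMk continuous_id)
  refine ⟨(fun θ => polarPoint c d ρ θ) ⁻¹' interior S, isOpen_interior.preimage hc,
    h.polarPoint_mem h₁ hρ (min_le_left _ _),
    h.polarPoint_mem h₂ hρ ((min_le_right _ _).trans (min_le_left _ _)),
    h.polarPoint_mem h₃ hρ ((min_le_right _ _).trans (min_le_right _ _)), ?_⟩
  refine LayerOrder.congr (above := fun θ θ' => above (polarPoint c d ρ θ) (polarPoint c d ρ θ'))
    ((isStackingOrder_iff.1 ha).comap (m := fun θ => polarPoint c d ρ θ) ?_ ?_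
      (fun _ _ => hc.continuousAt) ?_) fun θ θ' hθ => ?_
  · rintro θ ⟨⟨hθ, hl⟩, hmem⟩
    have := h.angle_polarPoint hρ (h.abs_lt_of_mem hθ) hmem
    exact ⟨hmem, h.unfoldedAt_of_isAngularLine heq hmem (by rwa [this])⟩
  · rintro θ ⟨⟨hθ, hl⟩, hmem⟩
    have := h.angle_polarPoint hρ (h.abs_lt_of_mem hθ) hmem
    exact ⟨hmem, (h.foldedAt_of_isAngularFold heq hmem (by rwa [this])).2⟩
  · have hIW : ∀ {θ}, θ ∈ ({θ ∈ Θ '' interior S | IsAngularLine φ θ} ∩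
        (fun θ => polarPoint c d ρ θ) ⁻¹' interior S) ∪
        ({θ ∈ Θ '' interior S | IsAngularFold φ θ} ∩
        (fun θ => polarPoint c d ρ θ) ⁻¹' interior S) →
        |θ| < Real.pi ∧ polarPoint c d ρ θ ∈ interior S := by
      rintro θ (hθ | hθ)
      exacts [⟨h.abs_lt_of_mem hθ.1.1, hθ.2⟩, ⟨h.abs_lt_of_mem hθ.1.1, hθ.2⟩]
    intro θ hθ θ' hθ' he
    obtain ⟨h1, h2⟩ := hIW hθ
    obtain ⟨h1', h2'⟩ := hIW hθ'
    refine ⟨?_, fun hne he' => hne ?_⟩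
    · rw [h.conic_polarPoint heq hρ h1 h2, h.conic_polarPoint heq hρ h1' h2', he]
    · have h3 := congrArg Θ he'
      rwa [h.angle_polarPoint hρ h1 h2, h.angle_polarPoint hρ h1' h2'] at h3
  · exact h.angularOrder_iff heq ha ⟨hθ.1.1, hθ.2.1.1, hθ.2.2⟩ hρ hθ.1.2 hθ.2.1.2

end Order

theorem isPreconnected_ray (h : IsPolarChart S c d Θ) (θ : ℝ) :
    IsPreconnected {x ∈ interior S | Θ x = θ} := by
  by_cases hθ : |θ| < Real.pi
  swap
  · convert isPreconnected_empty
    refine eq_empty_of_forall_notMem fun x hx => hθ ?_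
    rw [← hx.2]
    exact h.abs_lt x hx.1
  have hJ : IsPreconnected {ρ : ℝ | 0 < ρ ∧ polarPoint c d ρ θ ∈ interior S} := by
    refine isPreconnected_iff_ordConnected.2 ⟨?_⟩
    rintro r ⟨hr, -⟩ r' ⟨-, hr1⟩ s hs
    have hs0 : 0 < s := hr.trans_le hs.1
    exact ⟨hs0, h.polarPoint_mem hr1 hs0 hs.2⟩
  convert hJ.image (fun ρ => polarPoint c d ρ θ) ((continuous_polarPoint c d).comp
    (continuous_id.prodMk continuous_const)).continuousOn using 1
  ext x
  constructor
  · rintro ⟨hx, rfl⟩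
    have := h.polar x (h.mem_diff hx)
    exact ⟨‖x - c‖, ⟨h.norm_pos hx, by rwa [this]⟩, this⟩
  · rintro ⟨ρ, ⟨hρ, hmem⟩, rfl⟩
    exact ⟨hmem, h.angle_polarPoint hρ hθ hmem⟩

/-- Fold angles are isolated, so the angle is constant on each fold line, and different fold angles
belong to different fold lines. -/
theorem finite_fold_angles (h : IsPolarChart S c d Θ) {f : ℂ → ℂ} (hf : IsFlatFolding S f) {b : ℂ}
    {φ : ℝ → ℝ} (heq : EqOn f (conic b c Θ φ) (interior S))
    (hang : ∀ θ ∈ Θ '' interior S, IsAngularLine φ θ ∨ IsAngularFold φ θ) :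
    {θ ∈ Θ '' interior S | IsAngularFold φ θ}.Finite := by
  have hfold : ∀ x ∈ foldSet S f, IsAngularFold φ (Θ x) := fun x hx =>
    (hang _ ⟨x, hx.1, rfl⟩).resolve_left fun hl => hx.2 (h.unfoldedAt_of_isAngularLine heq hx.1 hl)
  have hconst : ∀ C ⊆ foldSet S f, IsPreconnected C → ∀ x ∈ C, ∀ y ∈ C, Θ x = Θ y := by
    intro C hC hpre x hx y hy
    refine hpre.induction₂ (fun x y => Θ x = Θ y) (fun x hx => ?_)
      (fun _ _ _ _ _ _ h h' => h.trans h') (fun _ _ _ _ h => h.symm) hx hy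
    have hev := (h.continuousAt (hC hx).1).tendsto.eventually (hfold x (hC hx)).eventually
    filter_upwards [self_mem_nhdsWithin, nhdsWithin_le_nhds hev] with y hy hy'
    by_contra hne
    exact (hC hy).2 (h.unfoldedAt_of_isAngularLine heq (hC hy).1 (hy' (Ne.symm hne)))
  have hX : ∀ θ ∈ {θ ∈ Θ '' interior S | IsAngularFold φ θ}, ∃ x ∈ foldSet S f, Θ x = θ := by
    rintro _ ⟨⟨x, hx, rfl⟩, hfold⟩
    exact ⟨x, ⟨hx, (h.foldedAt_of_isAngularFold heq hx hfold).2⟩, rfl⟩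
  choose! X hXf hXθ using hX
  refine Finite.of_finite_image (f := fun θ => connectedComponentIn (foldSet S f) (X θ))
    (hf.finite_foldLines.subset ?_) fun θ hθ θ' hθ' he => ?_
  · rintro _ ⟨θ, hθ, rfl⟩
    exact ⟨X θ, hXf θ hθ, rfl⟩
  · rw [← hXθ θ hθ, ← hXθ θ' hθ']
    refine hconst _ (connectedComponentIn_subset _ _) isPreconnected_connectedComponentIn _
      (mem_connectedComponentIn (hXf θ hθ)) _ ?_
    simp only at he
    rw [he]
    exact mem_connectedComponentIn (hXf θ' hθ')

/-- The angular analogue of the zoom about `c`: restricting φ to a smaller interval about `θ₀` and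
scaling back preserves slopes and the Lipschitz bound, and stretches the angles between folds until
none is left. -/
theorem canUnfold_of_conic (h : IsPolarChart S c d Θ) (hS : IsSpiralShapedDomain S c) {f : ℂ → ℂ}
    {above : ℂ → ℂ → Prop} (hf : IsFlatFolding S f) (ha : IsStackingOrder S f above) {φ : ℝ → ℝ}
    (hφ : LipschitzWith 1 φ)
    (hang : ∀ θ ∈ Θ '' interior S, IsAngularLine φ θ ∨ IsAngularFold φ θ) {b : ℂ}
    (heq : EqOn f (conic b c Θ φ) (interior S)) : CanUnfold S f above := by
  have hfin := h.finite_fold_angles hf heq hang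
  have hI' : Convex ℝ (Θ '' interior S) :=
    (h.ordConnected_angles hS.isConnected_interior.isPreconnected).convex
  -- an unfolded ray
  obtain ⟨θ₀, hθ₀, hl₀⟩ : ∃ θ₀ ∈ Θ '' interior S, IsAngularLine φ θ₀ := by
    obtain ⟨x, hx⟩ := hS.isConnected_interior.nonempty
    rcases hang _ ⟨x, hx, rfl⟩ with hl | hl
    · exact ⟨_, ⟨x, hx, rfl⟩, hl⟩
    · have hne : ∀ᶠ θ in 𝓝[≠] (Θ x), θ ∈ Θ '' interior S ∧ IsAngularLine φ θ := by
        filter_upwards [nhdsWithin_le_nhds hl.eventually, self_mem_nhdsWithin,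
          nhdsWithin_le_nhds (h.isOpen_angles.mem_nhds ⟨x, hx, rfl⟩)] with θ h1 h2 h3
        exact ⟨h3, h1 h2⟩
      obtain ⟨θ, h1, h2⟩ := hne.exists
      exact ⟨θ, h1, h2⟩
  obtain ⟨δ, hδ, hball⟩ := Metric.eventually_nhds_iff_ball.1 hl₀.eventually
  -- Angles differ from `θ₀` by less than 2π, so at scale `τ₁` all of them land in the `δ`-ball
  -- where φ has no folds.
  set τ₁ : ℝ := min 1 (δ / (2 * Real.pi)) with hτ₁
  have hτ₁0 : 0 < τ₁ := lt_min one_pos (div_pos hδ Real.two_pi_pos)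
  set τ : ℝ → ℝ := fun t => 1 - t * (1 - τ₁) with hτ
  have hτ1 : ∀ t ∈ Icc (0 : ℝ) 1, τ₁ ≤ τ t ∧ τ t ≤ 1 := fun t ht => by
    have h1 : 0 ≤ 1 - τ₁ := sub_nonneg.2 (min_le_left _ _)
    simp only [hτ]
    constructor
    · nlinarith [ht.2]
    · nlinarith [ht.1]
  have hτ0 : ∀ t ∈ Icc (0 : ℝ) 1, 0 < τ t := fun t ht => hτ₁0.trans_le (hτ1 t ht).1
  have hτc : Continuous τ := by fun_prop
  set m : ℝ → ℂ → ℝ := fun t x => θ₀ + τ t * (Θ x - θ₀) with hm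
  set F : ℝ → ℂ → ℂ := fun t => conic b c Θ (angularZoom φ θ₀ (τ t)) with hF
  have hmI : ∀ t ∈ Icc (0 : ℝ) 1, ∀ x ∈ interior S, m t x ∈ Θ '' interior S := by
    intro t ht x hx
    have := hI' hθ₀ ⟨x, hx, rfl⟩ (sub_nonneg.2 (hτ1 t ht).2) (hτ0 t ht).le (by ring)
    convert this using 1
    simp only [hm, smul_eq_mul]
    ring
  have hcont : ContinuousOn (fun p : ℝ × ℂ => F p.1 p.2) (Icc (0 : ℝ) 1 ×ˢ S) := by
    rintro ⟨t, x⟩ ⟨ht, hx⟩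
    rcases eq_or_ne x c with rfl | hxc
    · -- distances from the centre are preserved
      rw [ContinuousWithinAt, tendsto_iff_norm_sub_tendsto_zero]
      have hlim : Tendsto (fun p : ℝ × ℂ => ‖p.2 - x‖) (𝓝[Icc (0 : ℝ) 1 ×ˢ S] (t, x)) (𝓝 0) := by
        have : Continuous fun p : ℝ × ℂ => ‖p.2 - x‖ := by fun_prop
        simpa using (this.tendsto (t, x)).mono_left nhdsWithin_le_nhds
      refine hlim.congr fun p => ?_
      simp only [hF, conic]
      rw [sub_self, norm_zero, Complex.ofReal_zero, zero_mul, add_zero, add_sub_cancel_left,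
        norm_mul, Complex.norm_exp_ofReal_mul_I, mul_one, Complex.norm_real, norm_norm]
    · have hΘ : ContinuousWithinAt (fun p : ℝ × ℂ => Θ p.2) (Icc (0 : ℝ) 1 ×ˢ S) (t, x) := by
        have h1 : ContinuousWithinAt Θ S x := by
          refine (h.continuousOn x ⟨hx, hxc⟩).mono_of_mem_nhdsWithin ?_
          filter_upwards [self_mem_nhdsWithin, nhdsWithin_le_nhds (isOpen_ne.mem_nhds hxc)]
            with y h1 h2
          exact ⟨h1, h2⟩
        exact h1.comp continuous_snd.continuousWithinAt fun p hp => hp.2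
      have hτ' : ContinuousWithinAt (fun p : ℝ × ℂ => τ p.1) (Icc (0 : ℝ) 1 ×ˢ S) (t, x) :=
        (hτc.comp continuous_fst).continuousWithinAt
      have hmc : ContinuousWithinAt (fun p : ℝ × ℂ => m p.1 p.2) (Icc (0 : ℝ) 1 ×ˢ S) (t, x) :=
        continuousWithinAt_const.add (hτ'.mul (hΘ.sub continuousWithinAt_const))
      have hψ : ContinuousWithinAt (fun p : ℝ × ℂ => φ (m p.1 p.2) / τ p.1)
          (Icc (0 : ℝ) 1 ×ˢ S) (t, x) :=
        (hφ.continuous.continuousAt.comp_continuousWithinAt hmc).div hτ' (hτ0 t ht).ne'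
      have hn : Continuous fun p : ℝ × ℂ => (‖p.2 - c‖ : ℂ) := by fun_prop
      have he : Continuous fun r : ℝ => Complex.exp (r * Complex.I) := by fun_prop
      exact continuousWithinAt_const.add (hn.continuousWithinAt.mul
        (he.continuousAt.comp_continuousWithinAt hψ))
  have hunf : ∀ t ∈ Icc (0 : ℝ) 1, ∀ x ∈ interior S, IsAngularLine φ (m t x) →
      UnfoldedAt (F t) x := fun t ht x hx hl =>
    h.unfoldedAt_of_isAngularLine (eqOn_refl _ _) hx (hl.zoom (hτ0 t ht))
  have hfold : ∀ t ∈ Icc (0 : ℝ) 1, ∀ x ∈ interior S, IsAngularFold φ (m t x) →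
      FoldedAt (F t) x ∧ ¬ UnfoldedAt (F t) x := fun t ht x hx hl =>
    h.foldedAt_of_isAngularFold (eqOn_refl _ _) hx (hl.zoom (hτ0 t ht))
  have hU : ∀ t ∈ Icc (0 : ℝ) 1,
      MapsTo (m t) (unfoldedSet S (F t)) {θ ∈ Θ '' interior S | IsAngularLine φ θ} :=
    fun t ht x hx => ⟨hmI t ht x hx.1, (hang _ (hmI t ht x hx.1)).resolve_right fun hl =>
      (hfold t ht x hx.1 hl).2 hx.2⟩
  have hK : ∀ t ∈ Icc (0 : ℝ) 1,
      MapsTo (m t) (foldSet S (F t)) {θ ∈ Θ '' interior S | IsAngularFold φ θ} :=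
    fun t ht x hx => ⟨hmI t ht x hx.1, (hang _ (hmI t ht x hx.1)).resolve_left fun hl =>
      hx.2 (hunf t ht x hx.1 hl)⟩
  have hflat : ∀ t ∈ Icc (0 : ℝ) 1, IsFlatFolding S (F t) := by
    intro t ht
    refine ⟨?_, fun x hx => ?_, ?_⟩
    · have hpair : ContinuousOn (fun x : ℂ => (t, x)) S :=
        (continuous_const.prodMk continuous_id).continuousOn
      have hmaps : MapsTo (fun x : ℂ => (t, x)) S (Icc (0 : ℝ) 1 ×ˢ S) := fun x hx => ⟨ht, hx⟩
      exact (hcont.comp hpair hmaps).congr fun x _ => rfl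
    · rcases hang (m t x) (hmI t ht x hx) with hl | hl
      · exact .inl (hunf t ht x hx hl)
      · exact .inr (hfold t ht x hx hl).1
    · rw [← hasFinitelyManyPieces_iff]
      have hunion : foldSet S (F t) = ⋃ k ∈ {θ ∈ Θ '' interior S | IsAngularFold φ θ},
          {x ∈ interior S | Θ x = θ₀ + (k - θ₀) / τ t} := by
        have hτne := (hτ0 t ht).ne'
        ext x
        simp only [mem_iUnion]
        constructor
        · intro hx
          refine ⟨m t x, hK t ht hx, hx.1, ?_⟩
          simp only [hm]
          field_simp
          ring
        · rintro ⟨k, hk, hx, hxk⟩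
          have : m t x = k := by simp only [hm, hxk]; field_simp; ring
          exact ⟨hx, (hfold t ht x hx (this ▸ hk.2)).2⟩
      rw [hunion]
      exact .biUnion hfin fun k _ => (h.isPreconnected_ray _).hasFinitelyManyPieces
  have hmot : IsFoldingMotion S F (fun t x y => angularOrder S c d above (m t x) (m t y)) := by
    refine (h.layerOrder_angular heq ha).isFoldingMotion hS.isCompact hflat hcont hU hK ?_ ?_
    · intro t _ x hx
      have h1 : ContinuousAt (fun p : ℝ × ℂ => m p.1 p.2) (t, x) := by
        have hΘ : ContinuousAt (fun p : ℝ × ℂ => Θ p.2) (t, x) :=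
          ContinuousAt.comp (g := Θ) (f := fun p : ℝ × ℂ => p.2) (h.continuousAt hx)
            continuousAt_snd
        have hτ' : ContinuousAt (fun p : ℝ × ℂ => τ p.1) (t, x) :=
          (hτc.comp continuous_fst).continuousAt
        have hmul : ContinuousAt (fun p : ℝ × ℂ => τ p.1 * (Θ p.2 - θ₀)) (t, x) :=
          hτ'.mul (hΘ.sub continuousAt_const)
        exact hmul.const_add θ₀
      exact h1.tendsto.mono_left
        (prod_mono_left (𝓝 x) (nhdsWithin_le_nhds (s := Icc (0 : ℝ) 1) (a := t)) |>.trans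
          (nhds_prod_eq (x := t) (y := x)).ge)
    · intro t ht x hx y hy hxy
      have h1 := h.angle_eq_of_conic_eq (abs_angularZoom_sub_le hφ (hτ0 t ht) θ₀) hx hy hxy
      refine ⟨(div_left_inj' (hτ0 t ht).ne').1 h1, fun hne he => ?_⟩
      refine h.angle_ne hx hy (norm_eq_of_conic_eq hxy) hne ?_
      exact sub_left_injective (mul_left_cancel₀ (hτ0 t ht).ne' (add_left_cancel he))
  have hF1 : IsUnfolded S (F 1) := by
    have h1 : (1 : ℝ) ∈ Icc (0 : ℝ) 1 := by simp
    refine isUnfolded_of_foldSet_eq_empty hS.isConnected_interior hS.subset_closure_interior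
      (hflat 1 h1).continuousOn (eq_empty_of_forall_notMem fun x hx => ?_)
    refine hx.2 (hunf 1 h1 x hx.1 (hball _ ?_))
    have hlt : |Θ x - θ₀| < 2 * Real.pi := by
      have h1 := h.abs_lt x hx.1
      have h2 := h.abs_lt_of_mem hθ₀
      rw [_root_.abs_lt] at h1 h2 ⊢
      constructor <;> linarith [h1.1, h1.2, h2.1, h2.2]
    have hτ11 : τ 1 = τ₁ := by simp [hτ]
    rw [mem_ball_iff_norm, Real.norm_eq_abs]
    simp only [hm]
    rw [hτ11, add_sub_cancel_left, abs_mul, abs_of_pos hτ₁0]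
    calc τ₁ * |Θ x - θ₀| < τ₁ * (2 * Real.pi) := mul_lt_mul_of_pos_left hlt hτ₁0
      _ ≤ δ / (2 * Real.pi) * (2 * Real.pi) :=
        mul_le_mul_of_nonneg_right (min_le_right _ _) Real.two_pi_pos.le
      _ = δ := div_mul_cancel₀ _ Real.two_pi_pos.ne'
  have h0 : (0 : ℝ) ∈ Icc (0 : ℝ) 1 := by simp
  have hτ00 : τ 0 = 1 := by simp [hτ]
  have hm0 : ∀ x, m 0 x = Θ x := fun x => by simp [hm, hτ00]
  have hF0 : EqOn (F 0) f S := by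
    have hint : EqOn (F 0) f (interior S) := fun x hx => by
      rw [heq hx]
      simp [hF, conic, angularZoom, hτ00]
    exact hint.of_subset_closure (hflat 0 h0).continuousOn hf.continuousOn interior_subset
      hS.subset_closure_interior
  have hcan : CanUnfold S (F 0) (fun x y => angularOrder S c d above (m 0 x) (m 0 y)) :=
    ⟨F, _, hmot, rfl, rfl, hF1⟩
  -- Points in contact are equally far from `c`, so the angular order can be read off at their
  -- common radius, where it is the given order.
  refine hcan.congr hF0 fun x y hxy => ?_
  have hxS := hxy.1.1
  have hyS := hxy.2.1.1
  have hn : ‖x - c‖ = ‖y - c‖ := norm_eq_of_conic_eq hxy.2.2.2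
  have hpx := h.polar x (h.mem_diff hxS)
  have hpy := h.polar y (h.mem_diff hyS)
  rw [← hn] at hpy
  have hx1 := hU 0 h0 hxy.1
  have hy1 := hU 0 h0 hxy.2.1
  have he := h.angle_eq_of_conic_eq (abs_angularZoom_sub_le hφ (hτ0 0 h0) θ₀) hxS hyS hxy.2.2.2
  have he' : φ (m 0 x) = φ (m 0 y) := (div_left_inj' (hτ0 0 h0).ne').1 he
  rw [hm0] at hx1 hy1
  rw [hm0, hm0] at he'
  have := h.angularOrder_iff heq ha ⟨hx1, hy1, h.angle_ne hxS hyS hn hxy.2.2.1, he'⟩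
    (h.norm_pos hxS) (by rwa [hpx]) (by rwa [hpy])
  rw [hpx, hpy] at this
  rw [hm0, hm0]
  exact this.symm

end IsPolarChart

/-! ### The centre on the boundary, and the conclusion -/

section Main

variable {S : Set ℂ} {c : ℂ}

theorem isRadial_zoom {f : ℂ → ℂ} {α : ℂ} (hα : α ≠ 0) (hM : MapsTo (similarity c α) S S)
    (h : ∀ x ∈ interior S, similarity c α x ∈ foldSet S f → ∀ᶠ ε : ℝ in 𝓝 0,
      c + (1 + ε) * (similarity c α x - c) ∈ foldSet S f) : IsRadial S c (zoom f c α) := by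
  intro x hx
  rw [foldSet_zoom hα hM] at hx ⊢
  have hcont : Continuous fun ε : ℝ => c + (1 + ε) * (x - c) := by fun_prop
  have hmem : ∀ᶠ ε : ℝ in 𝓝 0, c + (1 + ε) * (x - c) ∈ interior S :=
    hcont.continuousAt.preimage_mem_nhds (isOpen_interior.mem_nhds (by simpa using hx.2))
  filter_upwards [h x hx.2 hx.1, hmem] with ε h1 h2
  refine ⟨?_, h2⟩
  rw [mem_preimage]
  convert h1 using 1
  simp only [similarity]
  ring

/-- A ball about the centre that only meets fold lines with the centre in their closure. -/
theorem exists_ball_of_foldLines {f : ℂ → ℂ} (hf : IsFlatFolding S f) :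
    ∃ r > 0, ∀ x ∈ Metric.ball c r, x ∈ foldSet S f →
      c ∈ closure (connectedComponentIn (foldSet S f) x) := by
  have hfin : {C ∈ componentsOf (foldSet S f) | c ∉ closure C}.Finite :=
    hf.finite_foldLines.subset fun C hC => hC.1
  have hcl : IsClosed (⋃ C ∈ {C ∈ componentsOf (foldSet S f) | c ∉ closure C}, closure C) :=
    hfin.isClosed_biUnion fun _ _ => isClosed_closure
  have hc : c ∈ (⋃ C ∈ {C ∈ componentsOf (foldSet S f) | c ∉ closure C}, closure C)ᶜ := by
    simp only [mem_compl_iff, mem_iUnion, not_exists]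
    exact fun C hC => hC.2
  obtain ⟨r, hr, hball⟩ := Metric.isOpen_iff.1 hcl.isOpen_compl c hc
  refine ⟨r, hr, fun x hx hxf => ?_⟩
  by_contra hcon
  refine hball hx (mem_biUnion (x := connectedComponentIn (foldSet S f) x) ⟨⟨x, hxf, rfl⟩, hcon⟩
    (subset_closure (mem_connectedComponentIn hxf)))

/-- Near `c` only fold lines with `c` in their closure remain. For non-real κ such a line would make
`c` interior, so a small copy is flat. For real κ such lines lie on rays from `c`, so a small copy
is a conical folding. -/
theorem IsSpiralShapedDomain.canUnfold_of_center_notMem_interior (hS : IsSpiralShapedDomain S c)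
    (hc : c ∉ interior S) {f : ℂ → ℂ} {above : ℂ → ℂ → Prop} (hf : IsFlatFolding S f)
    (ha : IsStackingOrder S f above) : CanUnfold S f above := by
  obtain ⟨κ, hκ, hsp⟩ := hS.isSpiralCenter
  obtain ⟨r, hr, hball⟩ := exists_ball_of_foldLines (c := c) hf
  obtain ⟨u, hu, hline⟩ := hf.exists_fold_lines
  have hu0 : ∀ x ∈ foldSet S f, u x ≠ 0 := fun x hx h0 => by
    have := (hu x hx).1
    simp [h0] at this
  have hcomp : ∀ x ∈ foldSet S f, ∀ y ∈ connectedComponentIn (foldSet S f) x,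
      ((y - x) / u x).im = 0 := fun x hx =>
    hline _ (connectedComponentIn_subset _ _) isPreconnected_connectedComponentIn x
      (mem_connectedComponentIn hx)
  by_cases hκ' : κ.im = 0
  swap
  · refine hS.canUnfold_of_ball_disjoint hf ha hr fun x hx hxf => hc ?_
    exact center_mem_interior_of_mem_closure hκ hκ' hsp hS.center_mem
      isPreconnected_connectedComponentIn
      (fun y hy => (connectedComponentIn_subset (foldSet S f) x hy).1) (hu0 x hxf) (hcomp x hxf)
      (hball x hx hxf)
  obtain ⟨s, hs, hM⟩ := hS.exists_mapsTo_ball hκ hr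
  refine hS.canUnfold_of_zoom hκ hsp hf ha hs fun above' _ hf' ha' => ?_
  have hrad : IsRadial S c (zoom f c (Complex.exp (s * κ))) := by
    refine isRadial_zoom (Complex.exp_ne_zero _) (hsp s hs) fun x hx hxf => ?_
    set y := similarity c (Complex.exp (s * κ)) x with hy
    have hcl := hball y (hM (interior_subset hx)) hxf
    -- The straight line that carries the fold is closed, so it contains `c`.
    have him : ((c - y) / u y).im = 0 :=
      closure_minimal (hcomp y hxf) (isClosed_singleton.preimage (Complex.continuous_im.comp
        ((continuous_id.sub continuous_const).div_const (u y)))) hcl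
    have hcont : Tendsto (fun ε : ℝ => c + (1 + ε) * (y - c)) (𝓝 0) (𝓝 y) := by
      have : Continuous fun ε : ℝ => c + (1 + ε) * (y - c) := by fun_prop
      simpa using this.tendsto 0
    filter_upwards [hcont.eventually (hu y hxf).2] with ε hε
    rw [hε]
    have e : (c + (1 + ε) * (y - c) - y) / u y = ((-ε : ℝ) : ℂ) * ((c - y) / u y) := by
      push_cast; ring
    rw [e, Complex.im_ofReal_mul, him, mul_zero]
  have hstar : ∀ x ∈ interior S, ∀ l ∈ Ioc (0 : ℝ) 1, c + l * (x - c) ∈ interior S :=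
    fun x hx l hl => mem_interior_of_star hκ hκ' hsp hx hl
  obtain ⟨d, Θ, h⟩ := exists_isPolarChart hS.isCompact.isClosed hS.subset_closure_interior
    hS.center_mem hc hS.finite_segment hstar
  obtain ⟨φ, hφ, hang, heq⟩ := h.exists_conic hS.center_mem
    hS.isConnected_interior.isPreconnected hf' hrad
  exact h.canUnfold_of_conic hS hf' ha' hφ hang heq

end Main

theorem theorem3 (S : Set ℂ) (c : ℂ) (hS : IsSpiralShapedDomain S c)
    (f : ℂ → ℂ) (above : ℂ → ℂ → Prop)
    (hf : IsFlatFolding S f) (habove : IsStackingOrder S f above) :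
    ∃ (F : ℝ → ℂ → ℂ) (A : ℝ → ℂ → ℂ → Prop),
      IsFoldingMotion S F A ∧ F 0 = f ∧ A 0 = above ∧ IsUnfolded S (F 1) := by
  by_cases hc : c ∈ interior S
  · exact hS.canUnfold_of_center_mem_interior hc hf habove
  · exact hS.canUnfold_of_center_notMem_interior hc hf habove
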